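/- Let $X$ be a locally compact, second countable Hausdorff space, let $\mathcal B_0(X)$ be the class of relatively compact Borel sets, and let $\nu$ be a non-atomic Radon measure on $X$. Let $\Gamma$ be the space of all locally finite subsets $\gamma$ of $X$, identified with the measures $\sum_{x\in\gamma}\varepsilon_x$, with the vague topology and its Borel $\sigma$-algebra; write $\gamma\setminus x$, $\gamma\cup x$ for $\gamma\setminus\{x\}$, $\gamma\cup\{x\}$ and $\langle\varphi,\gamma\rangle=\sum_{x\in\gamma}\varphi(x)$. Let $K$ be a bounded Hermitian operator on (real or complex) $L^2(X,\nu)$ with $\mathbf 0\le K\le\mathbf 1$, such that $P_\Lambda KP_\Lambda$ is of trace class for each $\Lambda\in\mathcal B_0(X)$ (where $P_\Lambda$ is multiplication by $\chi_\Lambda$) and such that $1$ is not in the spectrum of $K$. Let $\mu$ be the fermion (determinantal) point process corresponding to $K$, i.e. the probability measure on $\Gamma$ with correlation functions $k_\mu^{(n)}(x_1,\dots,x_n)=\det(K(x_i,x_j))_{i,j=1}^n$ with respect to $\nu$, where $K(x,y)=\int_X K_1(x,z)K_1(z,y)\,\nu(dz)$ and $K_1(\cdot,\cdot)$ is a version of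 the integral kernel of $\sqrt K$. Let $\mathcal D$ be the set of all functions $F(\gamma)=g(\langle\varphi_1,\gamma\rangle,\dots,\langle\varphi_N,\gamma\rangle)$ on $\Gamma$ with $N\in\mathbb N$, $\varphi_1,\dots,\varphi_N$ continuous real functions on $X$ with compact support, and $g$ a bounded continuous real function on $\mathbb R^N$. Put $(D_x^-F)(\gamma)=F(\gamma\setminus x)-F(\gamma)$ and $(D_{xy}^{-+}F)(\gamma)=F(\gamma\setminus x\cup y)-F(\gamma)$. A bilinear form $\mathcal E$ on $\mathcal D$ is called closable on $L^2(\Gamma,\mu)$ if $\mathcal D\subset L^2(\Gamma,\mu)$ and, for every sequence $(F_n)$ in $\mathcal D$ with $\|F_n\|_{L^2(\Gamma,\mu)}\to0$ and $\mathcal E(F_n-F_m,F_n-F_m)\to0$ as $n,m\to\infty$, one has $\mathcal E(F_n,F_n)\to0$. 1) Let $d:X\times\Gamma\to[0,\infty)$ be measurable with $\int_\Gamma\mu(d\gamma)\int_\Lambda\gamma(dx)\,d(x,\gamma\setminus x)<\infty$ for each $\Lambda\in\mathcal B_0(X)$. Then the Glauber form $$\mathcal E_{\mathrm G}(F,G)=\int_\Gamma\mu(d\gamma)\int_X\gamma(dx)\,d(x,\gamma\setminus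 x)(D_x^-F)(\gamma)(D_x^-G)(\gamma),\qquad F,G\in\mathcal D,$$ is closable on $L^2(\Gamma,\mu)$. 2) Let $r:X\times\Gamma\to[0,\infty]$ be a (version of the) Papangelou intensity of $\mu$, i.e. $r$ is measurable and $\int_\Gamma\mu(d\gamma)\int_X\gamma(dx)F(x,\gamma)=\int_\Gamma\mu(d\gamma)\int_X\nu(dx)\,r(x,\gamma)F(x,\gamma\cup x)$ for all measurable $F:X\times\Gamma\to[0,\infty]$. Let $c:X\times X\times\Gamma\to[0,\infty)$ be measurable with $c(x,y,\gamma)=0$ unless $r(x,\gamma)>0$ and $r(y,\gamma)>0$, and with $\int_\Gamma\mu(d\gamma)\int_X\gamma(dx)\int_X\nu(dy)\,c(x,y,\gamma\setminus x)(\chi_\Lambda(x)+\chi_\Lambda(y))<\infty$ for each $\Lambda\in\mathcal B_0(X)$. Assume that, for some $u\in\mathbb R$ and all $\Lambda\in\mathcal B_0(X)$, the function $$\gamma\mapsto\int_\Lambda\nu(dx)\int_\Lambda\gamma(dy)\,r(x,\gamma\setminus y)\,r(y,\gamma\setminus y)^u\chi_{\{r(y,\gamma\setminus y)>0\}}\,c(x,y,\gamma\setminus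 y)$$ belongs to $L^2(\Gamma,\mu)$. Then the Kawasaki form $$\mathcal E_{\mathrm K}(F,G)=\int_\Gamma\mu(d\gamma)\int_X\gamma(dx)\int_X\nu(dy)\,c(x,y,\gamma\setminus x)(D_{xy}^{-+}F)(\gamma)(D_{xy}^{-+}G)(\gamma),\qquad F,G\in\mathcal D,$$ is closable on $L^2(\Gamma,\mu)$. -/

import Mathlib

open MeasureTheory Filter Topology
open scoped ENNReal NNReal CompactlySupported

noncomputable section

namespace FermionDynamics

/-! ### Operators on `L²(X, ν)` -/

section Operators

variable {X : Type*} [MeasurableSpace X]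

/-- The operator `P_Λ` of multiplication by the indicator function of a measurable set `Λ` on
`L²(X, ν)`, where the scalars `𝕜` are `ℝ` or `ℂ`. -/
def mulIndicatorL2 (𝕜 : Type*) [RCLike 𝕜] (ν : Measure X) {Λ : Set X} (hΛ : MeasurableSet Λ) :
    Lp 𝕜 2 ν →L[𝕜] Lp 𝕜 2 ν :=
  LinearMap.mkContinuous
    { toFun := fun f => ((Lp.memLp f).indicator hΛ).toLp (Λ.indicator f)
      map_add' := by
        intro f g
        rw [← MemLp.toLp_add]
        apply MemLp.toLp_congr
        filter_upwards [Lp.coeFn_add f g] with x hx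
        by_cases h : x ∈ Λ
        · simpa only [Set.indicator_of_mem h, Pi.add_apply] using hx
        · simp [h]
      map_smul' := by
        intro c f
        rw [RingHom.id_apply, ← MemLp.toLp_const_smul]
        apply MemLp.toLp_congr
        filter_upwards [Lp.coeFn_smul c f] with x hx
        by_cases h : x ∈ Λ
        · simpa only [Set.indicator_of_mem h, Pi.smul_apply] using hx
        · simp [h] }
    1 (by
      intro f
      rw [one_mul]
      refine Lp.norm_le_norm_of_ae_le ?_
      filter_upwards [((Lp.memLp f).indicator hΛ).coeFn_toLp] with x hx
      simp only [LinearMap.coe_mk, AddHom.coe_mk]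
      rw [hx]
      exact norm_indicator_le_norm_self _ _)

/-- A positive operator `T` is of trace class, i.e. `Tr T = ∑ᵢ ⟨bᵢ, T bᵢ⟩ < ∞` for the orthonormal
bases `b`. (For a positive operator the value of the sum does not depend on the basis.) -/
def HasFiniteTrace {𝕜 H : Type*} [RCLike 𝕜] [NormedAddCommGroup H] [InnerProductSpace 𝕜 H]
    (T : H →L[𝕜] H) : Prop :=
  ∀ (w : Set H) (b : HilbertBasis w 𝕜 H), Summable fun i : w => RCLike.re (inner 𝕜 (b i) (T (b i)))

/-- `k` is (a version of) the integral kernel of the operator `T` on `L²(X, ν)`. -/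
def IsIntegralKernel {𝕜 : Type*} [RCLike 𝕜] {ν : Measure X} (T : Lp 𝕜 2 ν →L[𝕜] Lp 𝕜 2 ν)
    (k : X → X → 𝕜) : Prop :=
  Measurable (Function.uncurry k) ∧
    ∀ f : Lp 𝕜 2 ν, ∀ᵐ x ∂ν,
      Integrable (fun z => k x z * f z) ν ∧ T f x = ∫ z, k x z * f z ∂ν

/-- Borel sets with compact closure, the class `𝓑₀(X)`. -/
def IsBoundedBorel [TopologicalSpace X] (Λ : Set X) : Prop :=
  MeasurableSet Λ ∧ IsCompact (closure Λ)

/-- The assumptions on the operator `K`: `0 ≤ K ≤ 1`, the operators `P_Λ K P_Λ` with `Λ` bounded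
are of trace class, and `1` is not in the spectrum of `K`. The order is the Loewner order, so
`0 ≤ K` includes that `K` is Hermitian. -/
structure IsAdmissible [TopologicalSpace X] {𝕜 : Type*} [RCLike 𝕜] {ν : Measure X}
    (K : Lp 𝕜 2 ν →L[𝕜] Lp 𝕜 2 ν) : Prop where
  nonneg : 0 ≤ K
  le_one : K ≤ 1
  locallyTraceClass : ∀ (Λ : Set X) (hΛ : IsBoundedBorel Λ),
    HasFiniteTrace (mulIndicatorL2 𝕜 ν hΛ.1 ∘L K ∘L mulIndicatorL2 𝕜 ν hΛ.1)
  one_notMem_spectrum : (1 : 𝕜) ∉ spectrum 𝕜 K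

end Operators

/-! ### The configuration space -/

/-- The configuration space `Γ_X`: all subsets of `X` that have finitely many points in every
relatively compact set. -/
def Configuration (X : Type*) [TopologicalSpace X] : Type _ :=
  {γ : Set X // ∀ Λ : Set X, IsCompact (closure Λ) → (γ ∩ Λ).Finite}

namespace Configuration

variable {X : Type*} [TopologicalSpace X]

/-- The set of points of a configuration. -/
def points (γ : Configuration X) : Set X := γ.1

/-- The Radon measure `∑_{x ∈ γ} ε_x` with which the configuration `γ` is identified. -/
def toMeasure [MeasurableSpace X] (γ : Configuration X) : Measure X :=
  Measure.sum fun x : γ.points => Measure.dirac (x : X)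

/-- The pairing `⟨f, γ⟩ = ∑_{x ∈ γ} f x` (a finite sum if `f` has compact support). -/
def pairing (f : X → ℝ) (γ : Configuration X) : ℝ := ∑' x : γ.points, f x

/-- The configuration `γ \ x`. -/
def erase (γ : Configuration X) (x : X) : Configuration X :=
  ⟨γ.1 \ {x}, fun Λ hΛ => (γ.2 Λ hΛ).subset (Set.inter_subset_inter_left _ Set.sdiff_subset)⟩

/-- The configuration `γ ∪ x`. -/
def insert (γ : Configuration X) (x : X) : Configuration X :=
  ⟨γ.1 ∪ {x}, fun Λ hΛ => by
    rw [Set.union_inter_distrib_right]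
    exact (γ.2 Λ hΛ).union ((Set.finite_singleton x).subset Set.inter_subset_left)⟩

/-- The vague topology: the weakest topology for which all maps `γ ↦ ⟨f, γ⟩`, `f` continuous with
compact support, are continuous. -/
instance : TopologicalSpace (Configuration X) :=
  ⨅ f : C_c(X, ℝ), TopologicalSpace.induced (pairing f) inferInstance

/-- The Borel `σ`-algebra of the vague topology. -/
instance : MeasurableSpace (Configuration X) := borel (Configuration X)

instance : BorelSpace (Configuration X) := ⟨rfl⟩

end Configuration

/-! ### Point processes -/

section PointProcesses

variable {X : Type*} [TopologicalSpace X] [MeasurableSpace X]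

/-- `k` is the `n`-th correlation function of `μ`: it is measurable and symmetric, and for each
measurable symmetric `f ≥ 0` one has
`∫ ∑_{{x₁,…,xₙ} ⊂ γ} f(x₁,…,xₙ) μ(dγ) = (1/n!) ∫ f k dν^{⊗n}`.
The sum over the `n`-point subsets of `γ` is written as `1/n!` times the sum over the `n`-tuples of
distinct points of `γ`. -/
def IsCorrelationFunction (ν : Measure X) (μ : Measure (Configuration X)) (n : ℕ)
    (k : (Fin n → X) → ℝ≥0∞) : Prop :=
  Measurable k ∧ (∀ (σ : Equiv.Perm (Fin n)) (x : Fin n → X), k (x ∘ σ) = k x) ∧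
    ∀ f : (Fin n → X) → ℝ≥0∞, Measurable f →
      (∀ (σ : Equiv.Perm (Fin n)) (x : Fin n → X), f (x ∘ σ) = f x) →
      ∫⁻ γ, ((n.factorial : ℝ≥0∞)⁻¹ * ∑' x : Fin n ↪ γ.points, f fun i => (x i : X)) ∂μ =
        (n.factorial : ℝ≥0∞)⁻¹ * ∫⁻ x, f x * k x ∂(Measure.pi fun _ : Fin n => ν)

/-- `μ` is the fermion (determinantal) point process corresponding to `K`: its correlation
functions are `det (K(xᵢ, xⱼ))ᵢⱼ`, where the kernel of `K` is taken as
`K(x, y) = ∫ K₁(x, z) K₁(z, y) ν(dz)` with `K₁` a version of the kernel of the positive square root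
`√K`. (The determinants are real and nonnegative `ν^{⊗n}`-a.e., and any two versions `K₁` give
`ν^{⊗n}`-a.e. the same determinants.) -/
def IsFermionProcess {𝕜 : Type*} [RCLike 𝕜] {ν : Measure X} (K : Lp 𝕜 2 ν →L[𝕜] Lp 𝕜 2 ν)
    (μ : Measure (Configuration X)) : Prop :=
  ∃ (sqrtK : Lp 𝕜 2 ν →L[𝕜] Lp 𝕜 2 ν) (K₁ : X → X → 𝕜),
    0 ≤ sqrtK ∧ sqrtK ∘L sqrtK = K ∧ IsIntegralKernel sqrtK K₁ ∧
      ∀ n : ℕ, IsCorrelationFunction ν μ n fun x =>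
        ENNReal.ofReal (RCLike.re
          (Matrix.of fun i j : Fin n => ∫ z, K₁ (x i) z * K₁ z (x j) ∂ν).det)

/-- `r` is (a version of) the Papangelou (conditional) intensity of `μ`. -/
def IsPapangelouIntensity (ν : Measure X) (μ : Measure (Configuration X))
    (r : X → Configuration X → ℝ≥0∞) : Prop :=
  Measurable (Function.uncurry r) ∧
    ∀ F : X → Configuration X → ℝ≥0∞, Measurable (Function.uncurry F) →
      ∫⁻ γ, ∫⁻ x, F x γ ∂γ.toMeasure ∂μ = ∫⁻ γ, ∫⁻ x, r x γ * F x (γ.insert x) ∂ν ∂μ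

end PointProcesses

/-! ### Cylinder functions, the Glauber and the Kawasaki form -/

section Forms

variable {X : Type*} [TopologicalSpace X]

/-- The class `𝓕C_b(C₀(X), Γ)` of cylinder functions
`F(γ) = g(⟨φ₁, γ⟩, …, ⟨φ_N, γ⟩)` with `φᵢ ∈ C₀(X)` (continuous with compact support) and `g`
continuous and bounded. -/
def CylinderFunctions (X : Type*) [TopologicalSpace X] : Set (Configuration X → ℝ) :=
  {F | ∃ (N : ℕ) (φ : Fin N → C_c(X, ℝ)) (g : BoundedContinuousFunction (Fin N → ℝ) ℝ),
    F = fun γ => g fun i => Configuration.pairing (φ i) γ}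

/-- `(D_x^- F)(γ) = F(γ \ x) - F(γ)`. -/
def Dminus (x : X) (F : Configuration X → ℝ) (γ : Configuration X) : ℝ := F (γ.erase x) - F γ

/-- `(D_{xy}^{-+} F)(γ) = F(γ \ x ∪ y) - F(γ)`. -/
def Dminusplus (x y : X) (F : Configuration X → ℝ) (γ : Configuration X) : ℝ :=
  F ((γ.erase x).insert y) - F γ

variable [MeasurableSpace X]

/-- The Glauber form with death rate `d`. -/
def glauberForm (μ : Measure (Configuration X)) (d : X → Configuration X → ℝ≥0)
    (F G : Configuration X → ℝ) : ℝ :=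
  ∫ γ, ∫ x, (d x (γ.erase x) : ℝ) * Dminus x F γ * Dminus x G γ ∂γ.toMeasure ∂μ

/-- The Kawasaki form with jump rate `c`. -/
def kawasakiForm (ν : Measure X) (μ : Measure (Configuration X))
    (c : X → X → Configuration X → ℝ≥0) (F G : Configuration X → ℝ) : ℝ :=
  ∫ γ, ∫ x, ∫ y, (c x y (γ.erase x) : ℝ) * Dminusplus x y F γ * Dminusplus x y G γ
    ∂ν ∂γ.toMeasure ∂μ

end Forms

/-- A bilinear form `E` with domain `D` is closable on `L²(μ)`: `D` consists of
square-integrable functions, and if `Fₙ ∈ D` is a sequence with `Fₙ → 0` in `L²(μ)` and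
`E(Fₙ - Fₘ, Fₙ - Fₘ) → 0` as `n, m → ∞`, then `E(Fₙ, Fₙ) → 0`. -/
def IsClosableForm {Ω : Type*} [MeasurableSpace Ω] (μ : Measure Ω) (D : Set (Ω → ℝ))
    (E : (Ω → ℝ) → (Ω → ℝ) → ℝ) : Prop :=
  (∀ F ∈ D, MemLp F 2 μ) ∧
    ∀ F : ℕ → Ω → ℝ, (∀ n, F n ∈ D) →
      Tendsto (fun n => eLpNorm (F n) 2 μ) atTop (𝓝 0) →
      Tendsto (fun p : ℕ × ℕ => E (F p.1 - F p.2) (F p.1 - F p.2)) atTop (𝓝 0) →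
      Tendsto (fun n => E (F n) (F n)) atTop (𝓝 0)

end FermionDynamics

end

/-!
Both closability statements come from one criterion, `isClosableForm_of_ae_tendsto`. The form is
written as `∫ (T F)² dm` with the difference operator `T` and a weighted measure `m` on the space
of pairs `(γ, x)` or triples `(γ, x, y)`. By Fatou's lemma it suffices that `T Fₙ → 0` holds
`m`-almost everywhere as soon as the squared `L²(μ)`-norms of the `Fₙ` are summable; then `Fₙ → 0`
holds `μ`-almost everywhere, and the question is whether the exceptional set is also avoided by
`γ \ x`, respectively by `γ \ x ∪ y`.

For the Kawasaki form (`isClosableForm_kawasakiForm`) this follows from the defining identity of the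
Papangelou intensity `r`, applied twice. It turns the integral over `(γ, x, y)` into one over
`(γ ∪ x, x, y)` with density `r(x, γ)`, and where `c(x, y, γ) ≠ 0` one has `r(y, γ) > 0`, so that
the law of `γ ∪ y` does not charge `μ`-null sets there.

For the Glauber form (`isClosableForm_glauberForm`) one needs that removing a point does not lead
into the exceptional set, and no intensity is given. The assumption that `1` is not in the spectrum
of `K` provides the stronger estimate `HasPalmBound`: for bounded `Λ`, the expectation of
`∑_{x ∈ γ ∩ Λ} F(γ \ x)²` is at most a multiple of that of `F(γ)²`. To prove it, fix a bounded set
`B ⊇ Λ` that contains the supports in the definition of `F`, and split according to the number of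
points in `B`. The expectations of sums over exactly `n` points in `B` are alternating series of
integrals against the correlation functions (`hasSum_lintegral_exactSum`). For a Gram kernel
`∑ₖ fₖ(x) conj(fₖ(y))` of finite rank, bounded by `q < 1`, the functions can be rotated into
orthogonal ones (`exists_orthogonal_gramMatrix_eq`). The Cauchy–Binet formula then lets all
additional variables be integrated out, and the series sums up to
`det(1 - K) ∫ g(x) det(J(xᵢ, xⱼ)) dx` with the kernel `J` of `K (1 - K)⁻¹`
(`hasSum_integral_gramMatrix`). Now Fischer's inequality for positive semidefinite matrices bounds
the effect of one more variable in `Λ` by the factor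
`∫_Λ J(x, x) dx ≤ (1 - q)⁻¹ ∫_Λ K(x, x) dx` (`gramSeries_nonneg_and_cons_le`).

The kernel of `K` is such a Gram kernel of infinite rank: with an orthonormal basis `bₖ` and
`fₖ = √K bₖ`, the identity `∫ K₁(x, z) K₁(z, y) dz = ∑ₖ fₖ(x) conj(fₖ(y))` holds for all `x` and `y`
outside one null set (`ae_hasSum_kernel`), which is what is needed because determinants involve the
diagonal. It holds since `K₁(x, ·)` is almost everywhere the conjugate of the vector that represents
the functional `f ↦ √K f(x)`. Hadamard's inequality and the trace condition dominate the passage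
from finite subfamilies of `(fₖ)` to the full one (`IsGramExpansion.hasPalmBound`).
-/

namespace FermionDynamics

/-! ### The configuration space as a measurable space -/

open ProbabilityTheory

namespace Configuration

variable {X : Type*} [TopologicalSpace X]

@[ext] lemma ext {γ η : Configuration X} (h : γ.points = η.points) : γ = η := Subtype.ext h

lemma points_erase (γ : Configuration X) (x : X) : (γ.erase x).points = γ.points \ {x} := rfl

lemma points_insert (γ : Configuration X) (x : X) : (γ.insert x).points = γ.points ∪ {x} := rfl

lemma erase_insert {γ : Configuration X} {x : X} (hx : x ∉ γ.points) :
    (γ.insert x).erase x = γ := by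
  ext y
  simp only [points_erase, points_insert, Set.mem_sdiff, Set.mem_union, Set.mem_singleton_iff]
  grind

lemma finite_inter (γ : Configuration X) {Λ : Set X} (hΛ : IsCompact (closure Λ)) :
    (γ.points ∩ Λ).Finite := γ.2 Λ hΛ

lemma countable_points [SigmaCompactSpace X] [T2Space X] (γ : Configuration X) :
    γ.points.Countable := by
  have h : γ.points = ⋃ n, γ.points ∩ compactCovering X n := by
    rw [← Set.inter_iUnion, iUnion_compactCovering, Set.inter_univ]
  rw [h]
  refine Set.countable_iUnion fun n => (γ.finite_inter ?_).countable
  rw [(isCompact_compactCovering X n).isClosed.closure_eq]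
  exact isCompact_compactCovering X n

/-! ### Pairings -/

lemma finite_support_indicator (γ : Configuration X) (φ : C_c(X, ℝ)) :
    (Function.support (γ.points.indicator φ)).Finite := by
  refine (γ.finite_inter (Λ := Function.support φ) φ.hasCompactSupport).subset ?_
  intro x hx
  simpa [Set.indicator_apply_eq_zero] using hx

lemma pairing_eq_tsum_indicator (f : X → ℝ) (γ : Configuration X) :
    pairing f γ = ∑' x, γ.points.indicator f x := by
  rw [pairing, tsum_subtype]

lemma pairing_eq_sum (f : X → ℝ) (γ : Configuration X) (s : Finset X)
    (hs : (s : Set X) ⊆ γ.points) (hf : ∀ x ∈ γ.points, x ∉ s → f x = 0) :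
    pairing f γ = ∑ x ∈ s, f x := by
  rw [pairing_eq_tsum_indicator, tsum_eq_sum (s := s)]
  · exact Finset.sum_congr rfl fun x hx => Set.indicator_of_mem (hs hx) _
  · intro x hx
    by_cases h : x ∈ γ.points
    · rw [Set.indicator_of_mem h, hf x h hx]
    · rw [Set.indicator_of_notMem h]

lemma pairing_insert (φ : C_c(X, ℝ)) {γ : Configuration X} {x : X} (hx : x ∉ γ.points) :
    pairing φ (γ.insert x) = pairing φ γ + φ x := by
  classical
  have h : (γ.insert x).points.indicator φ = γ.points.indicator φ + Pi.single x (φ x) := by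
    funext y
    by_cases hy : y = x
    · subst hy; simp [points_insert, hx]
    · simp [points_insert, hy, Set.indicator]
  rw [pairing_eq_tsum_indicator, pairing_eq_tsum_indicator, h]
  simp only [Pi.add_apply]
  rw [Summable.tsum_add, tsum_pi_single]
  · exact summable_of_hasFiniteSupport (γ.finite_support_indicator φ)
  · exact (hasSum_pi_single x (φ x)).summable

lemma insert_erase {γ : Configuration X} {x : X} (hx : x ∈ γ.points) :
    (γ.erase x).insert x = γ := by
  ext y
  simp only [points_erase, points_insert, Set.mem_sdiff, Set.mem_union, Set.mem_singleton_iff]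
  grind

lemma insert_of_mem {γ : Configuration X} {x : X} (hx : x ∈ γ.points) : γ.insert x = γ := by
  ext y
  simp only [points_insert, Set.mem_union, Set.mem_singleton_iff]
  grind

lemma erase_of_notMem {γ : Configuration X} {x : X} (hx : x ∉ γ.points) : γ.erase x = γ := by
  ext y
  simp only [points_erase, Set.mem_sdiff, Set.mem_singleton_iff]
  grind

lemma pairing_erase (φ : C_c(X, ℝ)) {γ : Configuration X} {x : X} (hx : x ∈ γ.points) :
    pairing φ (γ.erase x) = pairing φ γ - φ x := by
  have h := pairing_insert φ (γ := γ.erase x) (x := x) (by simp [points_erase])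
  rw [insert_erase hx] at h
  rw [h]; ring

/-! ### The measure `∑_{x ∈ γ} ε_x` -/

section ToMeasure

variable [T2Space X] [MeasurableSpace X] [BorelSpace X]

lemma lintegral_toMeasure (γ : Configuration X) (f : X → ℝ≥0∞) :
    ∫⁻ x, f x ∂γ.toMeasure = ∑' x : γ.points, f x := by
  rw [toMeasure, lintegral_sum_measure]
  simp

lemma toMeasure_apply (γ : Configuration X) (A : Set X) (hA : MeasurableSet A) :
    γ.toMeasure A = (γ.points ∩ A).encard := by
  rw [← lintegral_indicator_one hA, lintegral_toMeasure,
    tsum_subtype γ.points (A.indicator (1 : X → ℝ≥0∞)), Set.indicator_indicator, ← tsum_subtype]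
  simp

lemma toMeasure_lt_top (γ : Configuration X) {A : Set X} (hA : IsBoundedBorel A) :
    γ.toMeasure A < ∞ := by
  rw [toMeasure_apply γ A hA.1, (γ.finite_inter hA.2).encard_eq_coe]
  simp

lemma lintegral_ofReal_pairing (φ : C_c(X, ℝ)) (hφ : ∀ x, 0 ≤ φ x) (γ : Configuration X) :
    ∫⁻ x, ENNReal.ofReal (φ x) ∂γ.toMeasure = ENNReal.ofReal (pairing φ γ) := by
  have h : Summable (γ.points.indicator (φ : X → ℝ)) :=
    summable_of_hasFiniteSupport (γ.finite_support_indicator φ)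
  rw [lintegral_toMeasure, pairing, ENNReal.ofReal_tsum_of_nonneg
    (f := fun x : γ.points => φ x) (fun x => hφ x) ((summable_subtype_iff_indicator (f := φ)).2 h)]

end ToMeasure

/-! ### The vague topology is second countable -/

lemma continuous_pairing (φ : C_c(X, ℝ)) : Continuous (pairing (φ : X → ℝ)) :=
  continuous_iff_le_induced.2 (iInf_le _ φ)

lemma abs_pairing_sub_le (f g χ : C_c(X, ℝ)) (ε : ℝ) (h : ∀ x, |f x - g x| ≤ ε * χ x)
    (γ : Configuration X) : |pairing f γ - pairing g γ| ≤ ε * pairing χ γ := by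
  have s (φ : C_c(X, ℝ)) : Summable (γ.points.indicator (φ : X → ℝ)) :=
    summable_of_hasFiniteSupport (γ.finite_support_indicator φ)
  simp only [pairing_eq_tsum_indicator]
  rw [← Summable.tsum_sub (s f) (s g), ← tsum_mul_left]
  have key (x : X) : ‖γ.points.indicator f x - γ.points.indicator g x‖
      ≤ ε * γ.points.indicator χ x := by
    by_cases hx : x ∈ γ.points
    · simpa [hx] using h x
    · simp [hx]
  rw [← Real.norm_eq_abs]
  refine tsum_of_norm_bounded (Summable.hasSum ((s χ).mul_left ε)) key

variable [LocallyCompactSpace X] [SecondCountableTopology X] [T2Space X]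

/-- Countably many pairings generate the vague topology. The functions with support in a fixed
compact set `L` contain a countable set that is dense for uniform convergence, and uniform
closeness of such `f`, `g` makes the pairings close, locally uniformly in the configuration. -/
lemma exists_countable_generating : ∃ S : Set C_c(X, ℝ), S.Countable ∧
    (inferInstance : TopologicalSpace (Configuration X)) =
      ⨅ f : S, TopologicalSpace.induced (pairing (f : C_c(X, ℝ))) inferInstance := by
  classical
  let L := CompactExhaustion.choice X
  have hχ (n : ℕ) : ∃ χ : C_c(X, ℝ), Set.EqOn χ 1 (L n) ∧ ∀ x, 0 ≤ χ x := by
    obtain ⟨f, hf1, -, hf2, hf3⟩ := exists_continuous_one_zero_of_isCompact (L.isCompact n)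
      isClosed_empty (Set.disjoint_empty _)
    exact ⟨⟨f, hf2⟩, hf1, fun x => (hf3 x).1⟩
  choose χ hχ1 hχ0 using hχ
  have hT (n : ℕ) : ∃ T : Set C_c(X, ℝ), T.Countable ∧ (∀ g ∈ T, tsupport g ⊆ L n) ∧
      ∀ f : C_c(X, ℝ), tsupport f ⊆ L n → ∀ ε > 0, ∃ g ∈ T, ∀ x ∈ L n, |f x - g x| < ε := by
    let A : Set C(X, ℝ) := {f | tsupport f ⊆ L n}
    obtain ⟨D, hDc, hDd⟩ := TopologicalSpace.exists_countable_dense A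
    have hcs (f : A) : HasCompactSupport f.1 :=
      (L.isCompact n).of_isClosed_subset (isClosed_tsupport _) f.2
    let toCc : A → C_c(X, ℝ) := fun f => ⟨f.1, hcs f⟩
    refine ⟨toCc '' D, hDc.image _, ?_, ?_⟩
    · rintro g ⟨f, -, rfl⟩
      exact f.2
    · intro f hf ε hε
      let f' : A := ⟨f.toContinuousMap, hf⟩
      have hmem := mem_closure_iff_seq_limit.1 (hDd f')
      obtain ⟨u, huD, hu⟩ := hmem
      have hu' : Tendsto (fun k => (u k).1) atTop (𝓝 f'.1) :=
        (continuous_subtype_val.tendsto _).comp hu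
      rw [ContinuousMap.tendsto_iff_forall_isCompact_tendstoUniformlyOn] at hu'
      have := (Metric.tendstoUniformlyOn_iff.1 (hu' _ (L.isCompact n)) ε hε).exists
      obtain ⟨k, hk⟩ := this
      exact ⟨toCc (u k), ⟨_, huD k, rfl⟩, fun x hx => hk x hx⟩
  choose T hTc hTs hTd using hT
  let S : Set C_c(X, ℝ) := Set.range χ ∪ ⋃ n, T n
  refine ⟨S, (Set.countable_range χ).union (Set.countable_iUnion hTc), ?_⟩
  refine le_antisymm (le_iInf fun f => iInf_le _ f.1) (le_iInf fun f => ?_)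
  rw [← continuous_iff_le_induced]
  let t : TopologicalSpace (Configuration X) :=
    ⨅ f : S, TopologicalSpace.induced (pairing (f : C_c(X, ℝ))) inferInstance
  have hcont (g : S) : Continuous[t, _] (pairing (g : C_c(X, ℝ))) :=
    continuous_iff_le_induced.2 (iInf_le _ g)
  obtain ⟨n, hn⟩ := L.exists_superset_of_isCompact (f.hasCompactSupport : IsCompact (tsupport f))
  refine @continuous_of_locally_uniform_approx_of_continuousAt _ _ t _ _ ?_
  intro γ u hu
  obtain ⟨δ, hδ, hδu⟩ := Metric.mem_uniformity_dist.1 hu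
  have hχS : χ n ∈ S := Or.inl ⟨n, rfl⟩
  let M := pairing (χ n) γ + 1
  have hM : 0 < M := by
    have : 0 ≤ pairing (χ n) γ := tsum_nonneg fun x => hχ0 n x
    positivity
  obtain ⟨g, hgT, hg⟩ := hTd n f hn (δ / (2 * M)) (by positivity)
  refine ⟨pairing (χ n) ⁻¹' Set.Iio M, ?_, pairing g, ?_, ?_⟩
  · exact ((hcont ⟨χ n, hχS⟩).isOpen_preimage _ isOpen_Iio).mem_nhds
      (by change pairing (χ n) γ < M; simp [M])
  · exact (hcont ⟨g, Or.inr (Set.mem_iUnion.2 ⟨n, hgT⟩)⟩).continuousAt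
  · intro η hη
    apply hδu
    rw [Real.dist_eq]
    have h1 := abs_pairing_sub_le f g (χ n) (δ / (2 * M)) (fun x => ?_) η
    · refine h1.trans_lt ?_
      have hη' : pairing (χ n) η < M := hη
      calc δ / (2 * M) * pairing (χ n) η ≤ δ / (2 * M) * M := by gcongr
        _ = δ / 2 := by field_simp
        _ < δ := by linarith
    · by_cases hx : x ∈ L n
      · rw [hχ1 n hx]
        simpa using (hg x hx).le
      · rw [image_eq_zero_of_notMem_tsupport fun h => hx (hn h),
          image_eq_zero_of_notMem_tsupport fun h => hx (hTs n g hgT h)]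
        have := hχ0 n x
        simp only [sub_zero, abs_zero]
        positivity

/-- A map into the configuration space is measurable as soon as its pairings are. -/
lemma measurable_of_pairing {Y : Type*} [MeasurableSpace Y] {f : Y → Configuration X}
    (hf : ∀ φ : C_c(X, ℝ), Measurable fun y => pairing φ (f y)) : Measurable f := by
  obtain ⟨S, hS, hS'⟩ := exists_countable_generating (X := X)
  have : Countable S := hS
  have hsc : SecondCountableTopology (Configuration X) := by
    have h := TopologicalSpace.secondCountableTopology_iInf
      (t := fun f : S => TopologicalSpace.induced
        (pairing (X := X) (f : C_c(X, ℝ))) inferInstance)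
      fun f => TopologicalSpace.secondCountableTopology_induced _ _ _
    rw [← hS'] at h
    exact h
  have hgen : (inferInstance : TopologicalSpace (Configuration X)) =
      TopologicalSpace.generateFrom (⋃ f : C_c(X, ℝ),
        {s | IsOpen[TopologicalSpace.induced (pairing (X := X) f) inferInstance] s}) := by
    exact (_root_.generateFrom_iUnion_isOpen
      fun f : C_c(X, ℝ) => TopologicalSpace.induced (pairing (X := X) f) inferInstance).symm
  have hb := borel_eq_generateFrom_of_subbasis hgen
  rw [BorelSpace.measurable_eq (α := Configuration X), hb]
  refine measurable_generateFrom ?_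
  intro t ht
  obtain ⟨φ, hφ⟩ := Set.mem_iUnion.1 ht
  obtain ⟨V, hV, rfl⟩ := isOpen_induced_iff.1 hφ
  exact hf φ hV.measurableSet

/-! ### The kernel `γ ↦ ∑_{x ∈ γ} ε_x` -/

variable [MeasurableSpace X] [BorelSpace X]

/-- For open `U`, the number of points in `U` is a limit of pairings with Urysohn functions that
lie between the indicator functions of compact subsets and of `U`. -/
lemma measurable_toMeasure_apply_isOpen {U : Set X} (hU : IsOpen U) :
    Measurable fun γ : Configuration X => γ.toMeasure U := by
  have : LocallyCompactSpace U := hU.locallyCompactSpace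
  let L := CompactExhaustion.choice U
  have hK (n : ℕ) : IsCompact (Subtype.val '' L n : Set X) :=
    (L.isCompact n).image continuous_subtype_val
  have hφ (n : ℕ) := exists_continuousMap_one_of_isCompact_subset_isOpen (hK n) hU (by simp)
  choose φ h1 h2 h3 h4 using hφ
  let φ' (n : ℕ) : C_c(X, ℝ) := ⟨φ n, h2 n⟩
  have hm (n : ℕ) : Measurable fun γ : Configuration X =>
      ∫⁻ x, ENNReal.ofReal (φ' n x) ∂γ.toMeasure := by
    simp_rw [lintegral_ofReal_pairing (φ' n) fun x => (h4 n x).1]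
    exact ENNReal.measurable_ofReal.comp (continuous_pairing _).measurable
  refine measurable_of_tendsto_metrizable hm (tendsto_pi_nhds.2 fun γ => ?_)
  have hlim : Tendsto (fun n => γ.toMeasure (Subtype.val '' L n : Set X)) atTop
      (𝓝 (γ.toMeasure U)) := by
    have : U = ⋃ n, (Subtype.val '' L n : Set X) := by
      rw [← Set.image_iUnion, L.iUnion_eq]; simp
    conv => enter [3, 1]; rw [this]
    exact tendsto_measure_iUnion_atTop fun i j hij => Set.image_mono (L.subset hij)
  refine tendsto_of_tendsto_of_tendsto_of_le_of_le hlim tendsto_const_nhds ?_ ?_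
  · intro n
    change γ.toMeasure (Subtype.val '' L n : Set X) ≤ ∫⁻ x, ENNReal.ofReal (φ' n x) ∂γ.toMeasure
    rw [← lintegral_indicator_one (hK n).measurableSet]
    refine lintegral_mono fun x => ?_
    by_cases hx : x ∈ (Subtype.val '' L n : Set X)
    · have : φ' n x = 1 := h1 n hx
      simp [this, Set.indicator_of_mem hx]
    · simp [Set.indicator_of_notMem hx]
  · intro n
    change ∫⁻ x, ENNReal.ofReal (φ' n x) ∂γ.toMeasure ≤ γ.toMeasure U
    rw [← lintegral_indicator_one hU.measurableSet]
    refine lintegral_mono fun x => ?_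
    by_cases hx : x ∈ U
    · have : φ' n x ≤ 1 := (h4 n x).2
      simpa [hx] using this
    · have : φ' n x = 0 := image_eq_zero_of_notMem_tsupport (fun h => hx (h3 n h))
      simp [this]

lemma measurable_toMeasure : Measurable fun γ : Configuration X => γ.toMeasure := by
  let L := CompactExhaustion.choice X
  let V (n : ℕ) : Set X := interior (L n)
  have hV (n : ℕ) : IsOpen (V n) := isOpen_interior
  have hVb (n : ℕ) : IsBoundedBorel (V n) := ⟨(hV n).measurableSet,
    (L.isCompact n).of_isClosed_subset isClosed_closure
      ((L.isCompact n).isClosed.closure_subset_iff.2 interior_subset)⟩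
  have key (n : ℕ) : Measurable fun γ : Configuration X => γ.toMeasure.restrict (V n) := by
    have hfin (γ : Configuration X) : IsFiniteMeasure (γ.toMeasure.restrict (V n)) :=
      isFiniteMeasure_restrict.2 (γ.toMeasure_lt_top (hVb n)).ne
    refine Measurable.measure_of_isPiSystem (S := {s | IsOpen s}) BorelSpace.measurable_eq
      isPiSystem_isOpen ?_ ?_
    · intro s hs
      have hs' : IsOpen s := hs
      simp_rw [Measure.restrict_apply hs'.measurableSet]
      exact measurable_toMeasure_apply_isOpen (hs'.inter (hV n))
    · simp_rw [Measure.restrict_apply MeasurableSet.univ, Set.univ_inter]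
      exact measurable_toMeasure_apply_isOpen (hV n)
  refine Measure.measurable_of_measurable_coe _ fun s hs => ?_
  have hmono : Monotone fun n => s ∩ V n := fun i j hij =>
    Set.inter_subset_inter_right _ (interior_mono (L.subset hij))
  have hun : s = ⋃ n, s ∩ V n := by
    have hV1 : ⋃ n, V n = Set.univ := by
      refine Set.eq_univ_of_forall fun x => ?_
      obtain ⟨n, hn⟩ := L.exists_mem x
      exact Set.mem_iUnion.2 ⟨n + 1, L.subset_interior_succ n hn⟩
    rw [← Set.inter_iUnion, hV1, Set.inter_univ]
  have h (γ : Configuration X) : γ.toMeasure s = ⨆ n, (γ.toMeasure.restrict (V n)) s := by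
    simp_rw [Measure.restrict_apply hs]
    conv_lhs => rw [hun]
    exact hmono.measure_iUnion
  simp_rw [h]
  exact Measurable.iSup fun n => (Measure.measurable_coe hs).comp (key n)

/-- The measures `∑_{x ∈ γ} ε_x` as a kernel. -/
noncomputable def kernel (X : Type*) [TopologicalSpace X] [LocallyCompactSpace X]
    [SecondCountableTopology X] [T2Space X] [MeasurableSpace X] [BorelSpace X] :
    Kernel (Configuration X) X :=
  ⟨fun γ => γ.toMeasure, measurable_toMeasure⟩

lemma kernel_apply (γ : Configuration X) : kernel X γ = γ.toMeasure := rfl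

/-- The kernel is the countable sum, over the cells `D i` of a partition of `X` into bounded sets
and over the possible numbers `k` of points in a cell, of finite kernels. -/
instance : IsSFiniteKernel (kernel X) := by
  classical
  let L := CompactExhaustion.choice X
  let D (n : ℕ) : Set X := disjointed (fun n => (L n : Set X)) n
  have hDm (n : ℕ) : MeasurableSet (D n) :=
    MeasurableSet.disjointed (fun i => (L.isCompact i).measurableSet) n
  have hDb (n : ℕ) : IsBoundedBorel (D n) := ⟨hDm n,
    (L.isCompact n).of_isClosed_subset isClosed_closure
      ((L.isCompact n).isClosed.closure_subset_iff.2 (disjointed_subset _ n))⟩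
  have hset (n k : ℕ) : MeasurableSet {γ : Configuration X | γ.toMeasure (D n) = k} :=
    (Kernel.measurable_coe (kernel X) (hDm n)) (measurableSet_singleton _)
  let κ (p : ℕ × ℕ) : Kernel (Configuration X) X :=
    Kernel.piecewise (hset p.1 p.2) ((kernel X).restrict (hDm p.1)) 0
  have hκ (p : ℕ × ℕ) : IsFiniteKernel (κ p) := by
    refine ⟨⟨p.2, by simp, fun γ => ?_⟩⟩
    simp only [κ, Kernel.piecewise_apply]
    split_ifs with h
    · rw [Kernel.restrict_apply, Measure.restrict_apply_univ]
      exact le_of_eq h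
    · simp
  have hsum : kernel X = Kernel.sum κ := by
    ext γ s hs
    rw [Kernel.sum_apply' _ _ hs, ENNReal.tsum_prod' , kernel_apply]
    have h1 (n : ℕ) : ∑' k : ℕ, κ (n, k) γ s = γ.toMeasure (s ∩ D n) := by
      have hcard : γ.toMeasure (D n) = ((γ.finite_inter (hDb n).2).toFinset.card : ℕ) := by
        rw [toMeasure_apply γ _ (hDm n), (γ.finite_inter (hDb n).2).encard_eq_coe_toFinset_card]
        simp
      rw [tsum_eq_single (γ.finite_inter (hDb n).2).toFinset.card]
      · simp only [κ, Kernel.piecewise_apply, Set.mem_ofPred_eq]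
        rw [if_pos hcard, Kernel.restrict_apply, Measure.restrict_apply hs, kernel_apply]
      · intro k hk
        simp only [κ, Kernel.piecewise_apply, Set.mem_ofPred_eq]
        rw [if_neg, _root_.zero_apply, Measure.coe_zero, Pi.zero_apply]
        rw [hcard]
        exact_mod_cast hk.symm
    simp_rw [h1]
    rw [← measure_iUnion, ← Set.inter_iUnion]
    · have : ⋃ n, D n = Set.univ := by
        simp only [D]
        rw [iUnion_disjointed, L.iUnion_eq]
      rw [this, Set.inter_univ]
    · intro i j hij
      exact (disjoint_disjointed _ hij).mono Set.inter_subset_right Set.inter_subset_right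
    · exact fun n => hs.inter (hDm n)
  rw [hsum]
  infer_instance

/-! ### Measurability of adding and removing points -/

/-- The relation `x ∈ γ` is measurable because `γ({x})` is a measurable function of `(γ, x)`. -/
lemma measurableSet_mem : MeasurableSet {p : Configuration X × X | p.2 ∈ p.1.points} := by
  have hdiag : MeasurableSet {q : (Configuration X × X) × X | q.2 = q.1.2} :=
    measurableSet_eq_fun measurable_snd (measurable_snd.comp measurable_fst)
  have h := Kernel.measurable_kernel_prodMk_left (κ := (kernel X).prodMkRight X) hdiag
  have h2 : {p : Configuration X × X | p.2 ∈ p.1.points} =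
      {p | (kernel X).prodMkRight X p (Prod.mk p ⁻¹' {q | q.2 = q.1.2}) = 0}ᶜ := by
    ext p
    have : (Prod.mk p ⁻¹' {q : (Configuration X × X) × X | q.2 = q.1.2}) = {p.2} := by
      ext; simp
    simp [Kernel.prodMkRight_apply, kernel_apply, toMeasure_apply, Set.encard_eq_zero]
  rw [h2]
  exact (h (measurableSet_singleton 0)).compl

lemma measurable_insert : Measurable fun p : Configuration X × X => p.1.insert p.2 := by
  classical
  refine measurable_of_pairing fun φ => ?_
  have h : (fun p : Configuration X × X => pairing φ (p.1.insert p.2)) =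
      fun p => if p.2 ∈ p.1.points then pairing φ p.1 else pairing φ p.1 + φ p.2 := by
    funext p
    split_ifs with hp
    · rw [insert_of_mem hp]
    · rw [pairing_insert φ hp]
  rw [h]
  have h1 : Measurable fun p : Configuration X × X => pairing φ p.1 :=
    (continuous_pairing φ).measurable.comp measurable_fst
  exact Measurable.ite measurableSet_mem h1
    (h1.add (φ.continuous.measurable.comp measurable_snd))

lemma measurable_erase : Measurable fun p : Configuration X × X => p.1.erase p.2 := by
  classical
  refine measurable_of_pairing fun φ => ?_
  have h : (fun p : Configuration X × X => pairing φ (p.1.erase p.2)) =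
      fun p => if p.2 ∈ p.1.points then pairing φ p.1 - φ p.2 else pairing φ p.1 := by
    funext p
    split_ifs with hp
    · rw [pairing_erase φ hp]
    · rw [erase_of_notMem hp]
  rw [h]
  have h1 : Measurable fun p : Configuration X × X => pairing φ p.1 :=
    (continuous_pairing φ).measurable.comp measurable_fst
  exact Measurable.ite measurableSet_mem (h1.sub (φ.continuous.measurable.comp measurable_snd)) h1

end Configuration

/-! ### A closability criterion -/

lemma tendsto_zero_of_tsum_enorm_sq {a : ℕ → ℝ} (h : ∑' n, ‖a n‖ₑ ^ 2 ≠ ∞) :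
    Tendsto a atTop (𝓝 0) := by
  have h1 := ENNReal.tendsto_atTop_zero_of_tsum_ne_top h
  have h2 : Tendsto (fun n => (‖a n‖ₑ ^ 2).toReal) atTop (𝓝 0) := by
    exact (ENNReal.tendsto_toReal ENNReal.zero_ne_top).comp h1
  have h3 : (fun n => (‖a n‖ₑ ^ 2).toReal) = fun n => |a n| ^ 2 := by
    funext n; simp
  rw [h3] at h2
  rw [tendsto_zero_iff_abs_tendsto_zero]
  have h4 := (Real.continuous_sqrt.tendsto 0).comp h2
  simpa [Function.comp_def, Real.sqrt_sq_eq_abs] using h4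

lemma eLpNorm_two_sq {Ω : Type*} [MeasurableSpace Ω] (μ : Measure Ω) (F : Ω → ℝ) :
    eLpNorm F 2 μ ^ 2 = ∫⁻ ω, ‖F ω‖ₑ ^ 2 ∂μ := by
  simpa using eLpNorm_nnreal_pow_eq_lintegral (f := F) (μ := μ) (p := 2) (by norm_num)

/-- Closability by Fatou's lemma. The form is `E(F, F) = ∫ (T F)² dm`; whenever the `L²`-norms of a
sequence `Fₖ` in the domain are summable, `T Fₖ → 0` almost everywhere, and then
`E(Fₙ, Fₙ) ≤ lim infₖ E(Fₙ - Fₖ, Fₙ - Fₖ)`. -/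
lemma isClosableForm_of_ae_tendsto {Ω Z : Type*} [MeasurableSpace Ω] [MeasurableSpace Z]
    {μ : Measure Ω} {m : Measure Z} {D : Set (Ω → ℝ)} {E : (Ω → ℝ) → (Ω → ℝ) → ℝ}
    (T : (Ω → ℝ) → Z → ℝ) (hL2 : ∀ F ∈ D, MemLp F 2 μ)
    (hD : ∀ F ∈ D, ∀ G ∈ D, F - G ∈ D) (hT : ∀ F G z, T (F - G) z = T F z - T G z)
    (hm : ∀ F ∈ D, Measurable (T F))
    (hfin : ∀ F ∈ D, ∫⁻ z, ‖T F z‖ₑ ^ 2 ∂m ≠ ∞)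
    (hE : ∀ F ∈ D, E F F = (∫⁻ z, ‖T F z‖ₑ ^ 2 ∂m).toReal)
    (hae : ∀ F : ℕ → Ω → ℝ, (∀ n, F n ∈ D) → ∑' n, ∫⁻ ω, ‖F n ω‖ₑ ^ 2 ∂μ ≠ ∞ →
      ∀ᵐ z ∂m, Tendsto (fun n => T (F n) z) atTop (𝓝 0)) :
    IsClosableForm μ D E := by
  refine ⟨hL2, fun F hF hF0 hFE => ?_⟩
  obtain ⟨φ, hφ, hφs⟩ : ∃ φ : ℕ → ℕ, StrictMono φ ∧
      ∀ k, ∫⁻ ω, ‖F (φ k) ω‖ₑ ^ 2 ∂μ ≤ 2⁻¹ ^ k := by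
    refine extraction_forall_of_eventually (P := fun k n => ∫⁻ ω, ‖F n ω‖ₑ ^ 2 ∂μ ≤ 2⁻¹ ^ k) ?_
    intro k
    have h1 : Tendsto (fun n => ∫⁻ ω, ‖F n ω‖ₑ ^ 2 ∂μ) atTop (𝓝 0) := by
      simp_rw [← eLpNorm_two_sq]
      simpa using ENNReal.Tendsto.pow (n := 2) hF0
    filter_upwards [h1.eventually_lt_const
      (show (0 : ℝ≥0∞) < 2⁻¹ ^ k from ENNReal.pow_pos (by simp) k)] with n hn using hn.le
  have hlim := hae (fun k => F (φ k)) (fun k => hF _) (by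
    refine ne_top_of_le_ne_top ?_ (ENNReal.tsum_le_tsum hφs)
    rw [ENNReal.tsum_geometric]
    simp)
  rw [Metric.tendsto_atTop]
  intro ε hε
  have h2 := (Metric.tendsto_atTop.1 hFE) (ε / 2) (by positivity)
  obtain ⟨⟨a, b⟩, hab⟩ := h2
  refine ⟨a, fun n hn => ?_⟩
  have hle : ∫⁻ z, ‖T (F n) z‖ₑ ^ 2 ∂m ≤ ENNReal.ofReal (ε / 2) := by
    calc ∫⁻ z, ‖T (F n) z‖ₑ ^ 2 ∂m
        ≤ ∫⁻ z, liminf (fun k => ‖T (F n - F (φ k)) z‖ₑ ^ 2) atTop ∂m := by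
          refine lintegral_mono_ae ?_
          filter_upwards [hlim] with z hz
          refine le_of_eq (Tendsto.liminf_eq ?_).symm
          have h3 : Tendsto (fun k => T (F n - F (φ k)) z) atTop (𝓝 (T (F n) z)) := by
            simp_rw [hT]
            simpa using hz.const_sub (T (F n) z)
          exact ENNReal.Tendsto.pow h3.enorm
      _ ≤ liminf (fun k => ∫⁻ z, ‖T (F n - F (φ k)) z‖ₑ ^ 2 ∂m) atTop :=
          lintegral_liminf_le fun k => (hm _ (hD _ (hF _) _ (hF _))).enorm.pow_const 2
      _ ≤ ENNReal.ofReal (ε / 2) := by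
          refine liminf_le_of_frequently_le' ?_
          refine Eventually.frequently ?_
          filter_upwards [eventually_ge_atTop b] with k hk
          have h4 := hab (n, φ k) ⟨hn, hk.trans (hφ.id_le k)⟩
          have hmem := hD _ (hF n) _ (hF (φ k))
          simp only [dist_zero_right, Real.norm_eq_abs] at h4
          rw [hE _ hmem, abs_of_nonneg ENNReal.toReal_nonneg] at h4
          rw [← ENNReal.ofReal_toReal (hfin _ hmem)]
          exact ENNReal.ofReal_le_ofReal h4.le
  rw [dist_zero_right, Real.norm_eq_abs, hE _ (hF n), abs_of_nonneg ENNReal.toReal_nonneg]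
  have := ENNReal.toReal_mono ENNReal.ofReal_ne_top hle
  rw [ENNReal.toReal_ofReal (by positivity)] at this
  linarith

lemma lintegral_enorm_sq_withDensity {Z : Type*} [MeasurableSpace Z] {P : Measure Z} {c : Z → ℝ≥0}
    {D : Z → ℝ} (hc : Measurable c) (hD : Measurable D) :
    ∫⁻ z, ‖D z‖ₑ ^ 2 ∂(P.withDensity fun z => (c z : ℝ≥0∞)) = ∫⁻ z, c z * ‖D z‖ₑ ^ 2 ∂P := by
  rw [lintegral_withDensity_eq_lintegral_mul _ hc.coe_nnreal_ennreal (hD.enorm.pow_const 2)]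
  rfl

lemma enorm_mul_mul_self (c : ℝ≥0) (D : ℝ) : ‖(c : ℝ) * D * D‖ₑ = c * ‖D‖ₑ ^ 2 := by
  simp [enorm_mul, mul_assoc, sq]

lemma integrable_weight_mul_sq {Z : Type*} [MeasurableSpace Z] {P : Measure Z} {c : Z → ℝ≥0}
    {D : Z → ℝ} (hc : Measurable c) (hD : Measurable D) (h : ∫⁻ z, c z * ‖D z‖ₑ ^ 2 ∂P ≠ ∞) :
    Integrable (fun z => (c z : ℝ) * D z * D z) P := by
  refine ⟨((hc.coe_nnreal_real.mul hD).mul hD).aestronglyMeasurable, ?_⟩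
  rw [hasFiniteIntegral_iff_enorm]
  simp_rw [enorm_mul_mul_self]
  exact lt_top_iff_ne_top.2 h

lemma integral_weight_mul_sq {Z : Type*} [MeasurableSpace Z] {P : Measure Z} {c : Z → ℝ≥0}
    {D : Z → ℝ} (hc : Measurable c) (hD : Measurable D) :
    ∫ z, (c z : ℝ) * D z * D z ∂P = (∫⁻ z, c z * ‖D z‖ₑ ^ 2 ∂P).toReal := by
  rw [integral_eq_lintegral_of_nonneg_ae]
  · congr 1
    refine lintegral_congr fun z => ?_
    rw [← enorm_mul_mul_self, Real.enorm_eq_ofReal]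
    rw [mul_assoc]
    exact mul_nonneg (c z).2 (mul_self_nonneg _)
  · exact Eventually.of_forall fun z => by
      simp only [Pi.zero_apply]
      rw [mul_assoc]
      exact mul_nonneg (c z).2 (mul_self_nonneg _)
  · exact ((hc.coe_nnreal_real.mul hD).mul hD).aestronglyMeasurable

lemma enorm_sub_sq_le {M : ℝ≥0} {a b : ℝ} (ha : ‖a‖ₑ ≤ M) (hb : ‖b‖ₑ ≤ M) :
    ‖a - b‖ₑ ^ 2 ≤ (2 * M) ^ 2 := by
  gcongr
  calc ‖a - b‖ₑ ≤ ‖a‖ₑ + ‖b‖ₑ := enorm_sub_le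
    _ ≤ 2 * M := by rw [two_mul]; gcongr

/-! ### Cylinder functions -/

section Cylinder

open FermionDynamics.Configuration

variable {X : Type*} [TopologicalSpace X]

lemma CylinderFunctions.sub_mem {F G : Configuration X → ℝ} (hF : F ∈ CylinderFunctions X)
    (hG : G ∈ CylinderFunctions X) : F - G ∈ CylinderFunctions X := by
  obtain ⟨N, φ, g, rfl⟩ := hF
  obtain ⟨M, ψ, h, rfl⟩ := hG
  refine ⟨N + M, Fin.append φ ψ,
    g.compContinuous ⟨fun v i => v (Fin.castAdd M i), by fun_prop⟩ -
      h.compContinuous ⟨fun v i => v (Fin.natAdd N i), by fun_prop⟩, ?_⟩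
  funext γ
  simp

lemma CylinderFunctions.continuous {F : Configuration X → ℝ} (hF : F ∈ CylinderFunctions X) :
    Continuous F := by
  obtain ⟨N, φ, g, rfl⟩ := hF
  exact g.continuous.comp (continuous_pi fun i => continuous_pairing (φ i))

lemma CylinderFunctions.exists_bound {F : Configuration X → ℝ} (hF : F ∈ CylinderFunctions X) :
    ∃ M : ℝ≥0, ∀ γ, ‖F γ‖ₑ ≤ M := by
  obtain ⟨N, φ, g, rfl⟩ := hF
  refine ⟨‖g‖₊, fun γ => ?_⟩
  rw [← enorm_eq_nnnorm, enorm_le_iff_norm_le]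
  exact g.norm_coe_le_norm _

lemma pairing_congr_of_inter_eq (φ : C_c(X, ℝ)) {Λ : Set X} (hφ : tsupport φ ⊆ Λ)
    {γ η : Configuration X} (h : γ.points ∩ Λ = η.points ∩ Λ) :
    pairing φ γ = pairing φ η := by
  rw [pairing_eq_tsum_indicator, pairing_eq_tsum_indicator]
  congr 1
  funext x
  by_cases hx : x ∈ Λ
  · have : x ∈ γ.points ↔ x ∈ η.points := by
      have := Set.ext_iff.1 h x
      simpa [hx] using this
    by_cases hγ : x ∈ γ.points
    · rw [Set.indicator_of_mem hγ, Set.indicator_of_mem (this.1 hγ)]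
    · rw [Set.indicator_of_notMem hγ, Set.indicator_of_notMem (fun h => hγ (this.2 h))]
  · have : φ x = 0 := image_eq_zero_of_notMem_tsupport fun h => hx (hφ h)
    simp [Set.indicator, this]

lemma exists_tsupport_subset [R1Space X] [MeasurableSpace X] [BorelSpace X] {N : ℕ}
    (φ : Fin N → C_c(X, ℝ)) : ∃ Λ : Set X, IsBoundedBorel Λ ∧ ∀ i, tsupport (φ i) ⊆ Λ := by
  refine ⟨⋃ i, tsupport (φ i), ⟨?_, ?_⟩, fun i =>
    Set.subset_iUnion (fun i => tsupport (φ i)) i⟩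
  · exact MeasurableSet.iUnion fun i => (isClosed_tsupport _).measurableSet
  · exact (isCompact_iUnion fun i => (φ i).hasCompactSupport).closure

lemma CylinderFunctions.exists_local [R1Space X] [MeasurableSpace X] [BorelSpace X]
    {F : Configuration X → ℝ} (hF : F ∈ CylinderFunctions X) :
    ∃ Λ : Set X, IsBoundedBorel Λ ∧
      ∀ γ η : Configuration X, γ.points ∩ Λ = η.points ∩ Λ → F γ = F η := by
  obtain ⟨N, φ, g, rfl⟩ := hF
  obtain ⟨Λ, hΛ, h⟩ := exists_tsupport_subset φ
  refine ⟨Λ, hΛ, fun γ η hγ => ?_⟩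
  simp only [pairing_congr_of_inter_eq _ (h _) hγ]

lemma CylinderFunctions.memLp {μ : Measure (Configuration X)} [IsFiniteMeasure μ]
    {F : Configuration X → ℝ} (hF : F ∈ CylinderFunctions X) : MemLp F 2 μ := by
  obtain ⟨M, hM⟩ := CylinderFunctions.exists_bound hF
  refine MemLp.of_bound (CylinderFunctions.continuous hF).measurable.aestronglyMeasurable M (Eventually.of_forall ?_)
  intro γ
  have h : ‖F γ‖₊ ≤ M := by exact_mod_cast hM γ
  exact_mod_cast h

variable [LocallyCompactSpace X] [SecondCountableTopology X] [T2Space X] [MeasurableSpace X]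
  [BorelSpace X]

/-! ### The Glauber form -/

/-- The bound for the reduced Palm measures of `μ`, on cylinder functions: for each bounded `Λ`,
`∫ ∑_{x ∈ γ ∩ Λ} F(γ \ x)² μ(dγ) ≤ C ∫ F² dμ` with `C` independent of `F`. -/
def HasPalmBound (μ : Measure (Configuration X)) : Prop :=
  ∀ Λ : Set X, IsBoundedBorel Λ → ∃ C : ℝ≥0∞, C ≠ ∞ ∧ ∀ F ∈ CylinderFunctions X,
    ∫⁻ γ, ∫⁻ x in Λ, ‖F (γ.erase x)‖ₑ ^ 2 ∂γ.toMeasure ∂μ ≤ C * ∫⁻ γ, ‖F γ‖ₑ ^ 2 ∂μ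

lemma isBoundedBorel_compactCovering (n : ℕ) : IsBoundedBorel (compactCovering X n) := by
  have := (isCompact_compactCovering X n).isClosed
  exact ⟨this.measurableSet, by rw [this.closure_eq]; exact isCompact_compactCovering X n⟩

lemma ae_tendsto_zero_of_tsum {Ω : Type*} [MeasurableSpace Ω] {μ : Measure Ω} {F : ℕ → Ω → ℝ}
    (hF : ∀ n, Measurable (F n)) (h : ∑' n, ∫⁻ ω, ‖F n ω‖ₑ ^ 2 ∂μ ≠ ∞) :
    ∀ᵐ ω ∂μ, Tendsto (fun n => F n ω) atTop (𝓝 0) := by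
  rw [← lintegral_tsum fun n => ((hF n).enorm.pow_const 2).aemeasurable] at h
  filter_upwards [ae_lt_top' (AEMeasurable.tsum
    fun n => ((hF n).enorm.pow_const 2).aemeasurable) h] with ω hω
  exact tendsto_zero_of_tsum_enorm_sq hω.ne

lemma ae_compProd_kernel_of_ae {μ : Measure (Configuration X)} {p : Configuration X → Prop}
    (hp : MeasurableSet {γ | p γ}) (h : ∀ᵐ γ ∂μ, p γ) :
    ∀ᵐ q ∂(μ ⊗ₘ kernel X), p q.1 :=
  Measure.ae_compProd_of_ae_fst _ hp h

/-- The Palm bound, applied to `Fₙ` and summed over `n`, gives `Fₙ(γ \ x) → 0` for almost every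
`(γ, x)` with `x` in a bounded set. -/
lemma isClosableForm_glauberForm {μ : Measure (Configuration X)} [IsFiniteMeasure μ]
    (hμ : HasPalmBound μ) {d : X → Configuration X → ℝ≥0}
    (hd : Measurable fun p : X × Configuration X => d p.1 p.2)
    (hdint : ∀ Λ : Set X, IsBoundedBorel Λ →
      ∫⁻ γ, ∫⁻ x in Λ, (d x (γ.erase x) : ℝ≥0∞) ∂γ.toMeasure ∂μ < ∞) :
    IsClosableForm μ (CylinderFunctions X) (glauberForm μ d) := by
  let c : Configuration X × X → ℝ≥0 := fun p => d p.2 (p.1.erase p.2)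
  have hc : Measurable c := hd.comp (measurable_snd.prodMk measurable_erase)
  let T : (Configuration X → ℝ) → Configuration X × X → ℝ := fun F p => Dminus p.2 F p.1
  have hTm (F) (hF : F ∈ CylinderFunctions X) : Measurable (T F) :=
    ((CylinderFunctions.continuous hF).measurable.comp measurable_erase).sub
      ((CylinderFunctions.continuous hF).measurable.comp measurable_fst)
  have hfin (F) (hF : F ∈ CylinderFunctions X) :
      ∫⁻ z, c z * ‖T F z‖ₑ ^ 2 ∂(μ ⊗ₘ kernel X) ≠ ∞ := by
    obtain ⟨M, hM⟩ := CylinderFunctions.exists_bound hF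
    obtain ⟨Λ, hΛ, hloc⟩ := CylinderFunctions.exists_local hF
    have hb : ∀ z, (c z : ℝ≥0∞) * ‖T F z‖ₑ ^ 2 ≤ (2 * M) ^ 2 *
        (Prod.snd ⁻¹' Λ : Set (Configuration X × X)).indicator (fun z => (c z : ℝ≥0∞)) z := by
      intro z
      by_cases hz : z.2 ∈ Λ
      · have hz' : z ∈ (Prod.snd ⁻¹' Λ : Set (Configuration X × X)) := hz
        rw [Set.indicator_of_mem hz', mul_comm]
        exact mul_le_mul_left (enorm_sub_sq_le (hM _) (hM _)) _
      · have : T F z = 0 := by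
          refine sub_eq_zero.2 (hloc _ _ ?_)
          ext y
          simp only [points_erase, Set.mem_inter_iff, Set.mem_sdiff, Set.mem_singleton_iff]
          grind
        simp [this]
    refine ne_top_of_le_ne_top ?_ (lintegral_mono hb)
    have hms : MeasurableSet (Prod.snd ⁻¹' Λ : Set (Configuration X × X)) :=
      measurable_snd hΛ.1
    rw [lintegral_const_mul _ (hc.coe_nnreal_ennreal.indicator hms),
      Measure.lintegral_compProd (hc.coe_nnreal_ennreal.indicator hms)]
    refine ENNReal.mul_ne_top (by finiteness) (ne_of_lt ?_)
    refine lt_of_le_of_lt (le_of_eq ?_) (hdint Λ hΛ)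
    refine lintegral_congr fun γ => ?_
    rw [← lintegral_indicator hΛ.1]
    rfl
  refine isClosableForm_of_ae_tendsto (m := (μ ⊗ₘ kernel X).withDensity fun z => (c z : ℝ≥0∞)) T
    (fun F hF => CylinderFunctions.memLp hF) (fun F hF G hG => CylinderFunctions.sub_mem hF hG)
    (fun F G z => ?_) hTm (fun F hF => ?_) (fun F hF => ?_) (fun F hF hs => ?_)
  · simp only [T, Dminus, Pi.sub_apply]; ring
  · rw [lintegral_enorm_sq_withDensity hc (hTm F hF)]
    exact hfin F hF
  · rw [lintegral_enorm_sq_withDensity hc (hTm F hF), ← integral_weight_mul_sq hc (hTm F hF),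
      Measure.integral_compProd (integrable_weight_mul_sq hc (hTm F hF) (hfin F hF))]
    rfl
  · refine (withDensity_absolutelyContinuous _ _).ae_le ?_
    have hFm (n : ℕ) : Measurable (F n) := (CylinderFunctions.continuous (hF n)).measurable
    have h1 := ae_compProd_kernel_of_ae
      (measurableSet_tendsto (𝓝 0) hFm) (ae_tendsto_zero_of_tsum hFm hs)
    have h2 (n : ℕ) : ∀ᵐ q ∂(μ ⊗ₘ kernel X), q.2 ∈ compactCovering X n →
        Tendsto (fun k => F k (q.1.erase q.2)) atTop (𝓝 0) := by
      let A : Set (Configuration X × X) := Prod.snd ⁻¹' compactCovering X n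
      have hA : MeasurableSet A := measurable_snd (isBoundedBorel_compactCovering n).1
      have hG (k : ℕ) : Measurable (A.indicator fun q => F k (q.1.erase q.2)) :=
        ((hFm k).comp measurable_erase).indicator hA
      have h3 : ∑' k, ∫⁻ q, ‖A.indicator (fun q => F k (q.1.erase q.2)) q‖ₑ ^ 2
          ∂(μ ⊗ₘ kernel X) ≠ ∞ := by
        obtain ⟨C, hC, hCF⟩ := hμ _ (isBoundedBorel_compactCovering n)
        refine ne_top_of_le_ne_top (ENNReal.mul_ne_top hC hs) ?_
        rw [← ENNReal.tsum_mul_left]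
        refine ENNReal.tsum_le_tsum fun k => ?_
        rw [Measure.lintegral_compProd ((hG k).enorm.pow_const 2)]
        refine le_trans (le_of_eq ?_) (hCF (F k) (hF k))
        refine lintegral_congr fun γ => ?_
        rw [← lintegral_indicator (isBoundedBorel_compactCovering n).1]
        refine lintegral_congr fun x => ?_
        by_cases hx : x ∈ compactCovering X n
        · rw [Set.indicator_of_mem (by exact hx), Set.indicator_of_mem hx]
        · rw [Set.indicator_of_notMem (by exact hx), Set.indicator_of_notMem hx]
          simp
      filter_upwards [ae_tendsto_zero_of_tsum hG h3] with q hq hqn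
      simpa [Set.indicator_of_mem (show q ∈ A from hqn)] using hq
    filter_upwards [h1, ae_all_iff.2 h2] with q hq1 hq2
    obtain ⟨n, hn⟩ := exists_mem_compactCovering q.2
    simpa [T, Dminus] using (hq2 n hn).sub hq1

/-! ### The Kawasaki form -/

/-- The Papangelou intensity controls null sets only; this is enough, because the criterion asks for
convergence almost everywhere. -/
lemma isClosableForm_kawasakiForm {ν : Measure X} [SFinite ν] [NullSingletonClass ν]
    {μ : Measure (Configuration X)} [IsFiniteMeasure μ]
    {r : X → Configuration X → ℝ≥0∞} {c : X → X → Configuration X → ℝ≥0}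
    (hr : IsPapangelouIntensity ν μ r)
    (hc : Measurable fun p : X × X × Configuration X => c p.1 p.2.1 p.2.2)
    (hcr : ∀ x y γ, ¬(0 < r x γ ∧ 0 < r y γ) → c x y γ = 0)
    (hcint : ∀ Λ : Set X, IsBoundedBorel Λ →
        ∫⁻ γ, ∫⁻ x, ∫⁻ y, (c x y (γ.erase x) : ℝ≥0∞) *
          (Λ.indicator 1 x + Λ.indicator 1 y) ∂ν ∂γ.toMeasure ∂μ < ∞) :
    IsClosableForm μ (CylinderFunctions X) (kawasakiForm ν μ c) := by
  let P : Measure ((Configuration X × X) × X) := (μ ⊗ₘ kernel X).prod ν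
  let w : (Configuration X × X) × X → ℝ≥0 := fun p => c p.1.2 p.2 (p.1.1.erase p.1.2)
  have hme : Measurable fun p : (Configuration X × X) × X => p.1.1.erase p.1.2 :=
    measurable_erase.comp measurable_fst
  have hmi : Measurable fun p : (Configuration X × X) × X => (p.1.1.erase p.1.2).insert p.2 :=
    measurable_insert.comp (hme.prodMk measurable_snd)
  have hw : Measurable w :=
    hc.comp ((measurable_snd.comp measurable_fst).prodMk (measurable_snd.prodMk hme))
  let T : (Configuration X → ℝ) → (Configuration X × X) × X → ℝ :=
    fun F p => Dminusplus p.1.2 p.2 F p.1.1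
  have hTm (F) (hF : F ∈ CylinderFunctions X) : Measurable (T F) :=
    ((CylinderFunctions.continuous hF).measurable.comp hmi).sub
      ((CylinderFunctions.continuous hF).measurable.comp (measurable_fst.comp measurable_fst))
  -- iterated integrals with respect to `P`
  have hP (f : (Configuration X × X) × X → ℝ≥0∞) (hf : Measurable f) :
      ∫⁻ z, f z ∂P = ∫⁻ γ, ∫⁻ x, ∫⁻ y, f ((γ, x), y) ∂ν ∂γ.toMeasure ∂μ := by
    rw [lintegral_prod _ hf.aemeasurable, Measure.lintegral_compProd hf.lintegral_prod_right']
    rfl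
  have hfin (F) (hF : F ∈ CylinderFunctions X) : ∫⁻ z, w z * ‖T F z‖ₑ ^ 2 ∂P ≠ ∞ := by
    obtain ⟨M, hM⟩ := CylinderFunctions.exists_bound hF
    obtain ⟨Λ, hΛ, hloc⟩ := CylinderFunctions.exists_local hF
    let g : (Configuration X × X) × X → ℝ≥0∞ := fun z =>
      w z * (Λ.indicator 1 z.1.2 + Λ.indicator 1 z.2)
    have hg : Measurable g := by
      have h1 : Measurable (Λ.indicator (1 : X → ℝ≥0∞)) := measurable_one.indicator hΛ.1
      exact hw.coe_nnreal_ennreal.mul ((h1.comp (measurable_snd.comp measurable_fst)).add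
        (h1.comp measurable_snd))
    have hb : ∀ z, (w z : ℝ≥0∞) * ‖T F z‖ₑ ^ 2 ≤ (2 * M) ^ 2 * g z := by
      intro z
      by_cases hz : z.1.2 ∉ Λ ∧ z.2 ∉ Λ
      · have : T F z = 0 := by
          refine sub_eq_zero.2 (hloc _ _ ?_)
          ext y
          simp only [points_erase, points_insert, Set.mem_inter_iff, Set.mem_sdiff,
            Set.mem_singleton_iff, Set.mem_union]
          grind
        simp [this]
      · have h1 : (1 : ℝ≥0∞) ≤ Λ.indicator 1 z.1.2 + Λ.indicator 1 z.2 := by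
          rcases not_and_or.1 hz with h | h
          · rw [Set.indicator_of_mem (not_not.1 h)]; simp
          · rw [Set.indicator_of_mem (not_not.1 h) (1 : X → ℝ≥0∞)]; simp
        calc (w z : ℝ≥0∞) * ‖T F z‖ₑ ^ 2 ≤ (w z : ℝ≥0∞) * (2 * (M : ℝ≥0∞)) ^ 2 :=
              mul_le_mul_right (enorm_sub_sq_le (hM _) (hM _)) _
          _ = (2 * (M : ℝ≥0∞)) ^ 2 * ((w z : ℝ≥0∞) * 1) := by rw [mul_one, mul_comm]
          _ ≤ _ := mul_le_mul_right (mul_le_mul_right h1 _) _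
    refine ne_top_of_le_ne_top ?_ (lintegral_mono hb)
    rw [lintegral_const_mul _ hg, hP g hg]
    exact ENNReal.mul_ne_top (by finiteness) (hcint Λ hΛ).ne
  refine isClosableForm_of_ae_tendsto (m := P.withDensity fun z => (w z : ℝ≥0∞)) T
    (fun F hF => CylinderFunctions.memLp hF) (fun F hF G hG => CylinderFunctions.sub_mem hF hG)
    (fun F G z => ?_) hTm (fun F hF => ?_) (fun F hF => ?_) (fun F hF hs => ?_)
  · simp only [T, Dminusplus, Pi.sub_apply]; ring
  · rw [lintegral_enorm_sq_withDensity hw (hTm F hF)]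
    exact hfin F hF
  · have hint := integrable_weight_mul_sq hw (hTm F hF) (hfin F hF)
    rw [lintegral_enorm_sq_withDensity hw (hTm F hF), ← integral_weight_mul_sq hw (hTm F hF),
      integral_prod _ hint, Measure.integral_compProd hint.integral_prod_left]
    rfl
  · have hFm (n : ℕ) : Measurable (F n) := (CylinderFunctions.continuous (hF n)).measurable
    let N : Set (Configuration X) := {γ | Tendsto (fun n => F n γ) atTop (𝓝 0)}ᶜ
    have hN : MeasurableSet N := (measurableSet_tendsto (𝓝 0) hFm).compl
    have hN0 : μ N = 0 := ae_tendsto_zero_of_tsum hFm hs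
    -- adding a point according to the Papangelou intensity does not lead into the null set `N`
    have hadd : ∀ᵐ γ ∂μ, ∀ᵐ y ∂ν, r y γ * N.indicator 1 (γ.insert y) = 0 := by
      have hmeas : Measurable (Function.uncurry fun (_ : X) (γ : Configuration X) =>
          N.indicator (1 : Configuration X → ℝ≥0∞) γ) :=
        (measurable_one.indicator hN).comp measurable_snd
      have h := hr.2 (fun _ γ => N.indicator 1 γ) hmeas
      have h0 : ∫⁻ γ, ∫⁻ _x, N.indicator (1 : Configuration X → ℝ≥0∞) γ ∂γ.toMeasure ∂μ = 0 := by
        rw [lintegral_congr_ae (g := 0), lintegral_zero_fun]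
        filter_upwards [measure_eq_zero_iff_ae_notMem.1 hN0] with γ hγ
        simp [hγ]
      rw [h0] at h
      have hrm : Measurable fun p : Configuration X × X =>
          r p.2 p.1 * N.indicator (1 : Configuration X → ℝ≥0∞) (p.1.insert p.2) :=
        (hr.1.comp measurable_swap).mul ((measurable_one.indicator hN).comp measurable_insert)
      have h1 := (lintegral_eq_zero_iff hrm.lintegral_prod_right').1 h.symm
      filter_upwards [h1] with γ hγ
      exact (lintegral_eq_zero_iff (hrm.comp measurable_prodMk_left)).1 hγ
    have hjump : ∀ᵐ z ∂P.withDensity (fun z => (w z : ℝ≥0∞)),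
        (z.1.1.erase z.1.2).insert z.2 ∉ N := by
      have hpre : MeasurableSet {z : (Configuration X × X) × X |
          (z.1.1.erase z.1.2).insert z.2 ∈ N} := hmi hN
      refine measure_eq_zero_iff_ae_notMem (s := {z : (Configuration X × X) × X |
          (z.1.1.erase z.1.2).insert z.2 ∈ N}).1 ?_
      rw [withDensity_apply _ hpre,
        ← lintegral_indicator hpre, hP _ (hw.coe_nnreal_ennreal.indicator hpre)]
      let G : X → Configuration X → ℝ≥0∞ := fun x γ => ∫⁻ y, {z : (Configuration X × X) × X |
          (z.1.1.erase z.1.2).insert z.2 ∈ N}.indicator (fun z => (w z : ℝ≥0∞)) ((γ, x), y) ∂ν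
      have hG : Measurable (Function.uncurry G) :=
        (hw.coe_nnreal_ennreal.indicator hpre).lintegral_prod_right'.comp measurable_swap
      change ∫⁻ γ, ∫⁻ x, G x γ ∂γ.toMeasure ∂μ = 0
      rw [hr.2 G hG, lintegral_congr_ae (g := 0), lintegral_zero_fun]
      filter_upwards [hadd] with γ hγ
      simp only [Pi.zero_apply]
      rw [lintegral_congr_ae (g := 0), Pi.zero_def, lintegral_zero]
      have hγ0 : ν γ.points = 0 := γ.countable_points.measure_zero ν
      filter_upwards [measure_eq_zero_iff_ae_notMem.1 hγ0] with x hx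
      simp only [Pi.zero_apply, G]
      rw [lintegral_congr_ae (g := 0), Pi.zero_def, lintegral_zero, mul_zero]
      filter_upwards [hγ] with y hy
      refine Set.indicator_apply_eq_zero.2 fun hmem => ?_
      simp only [Set.mem_ofPred_eq, w, erase_insert hx, ENNReal.coe_eq_zero] at hmem ⊢
      refine hcr x y γ fun h => ?_
      rw [Set.indicator_of_mem hmem] at hy
      simp at hy
      exact h.2.ne' hy
    have hstay : ∀ᵐ z ∂P.withDensity (fun z => (w z : ℝ≥0∞)), z.1.1 ∉ N := by
      refine (withDensity_absolutelyContinuous _ _).ae_le ?_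
      have h1 := ae_compProd_kernel_of_ae hN.compl (measure_eq_zero_iff_ae_notMem.1 hN0)
      exact Measure.quasiMeasurePreserving_fst.ae h1
    filter_upwards [hjump, hstay] with z h1 h2
    simpa [T, Dminusplus] using (not_not.1 h1 : Tendsto _ _ _).sub (not_not.1 h2 : Tendsto _ _ _)

end Cylinder

/-! ### Sums over tuples of distinct points -/

universe u

section Tuples

open FermionDynamics.Configuration Function

section Extension

variable {X : Type*}

/-- The function `1_B(x₁) ⋯ 1_B(x_m) g(x_{m+1}, …, x_{m+n})`. -/
noncomputable def extendTuple (B : Set X) {n : ℕ} (g : (Fin n → X) → ℝ≥0∞) :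
    (m : ℕ) → (Fin (n + m) → X) → ℝ≥0∞
  | 0 => g
  | m + 1 => fun x => B.indicator 1 (x 0) * extendTuple B g m (Fin.tail x)

lemma extendTuple_support {B : Set X} {n : ℕ} {g : (Fin n → X) → ℝ≥0∞}
    (hg : ∀ x, g x ≠ 0 → ∀ i, x i ∈ B) (m : ℕ) (x : Fin (n + m) → X)
    (hx : extendTuple B g m x ≠ 0) (i : Fin (n + m)) : x i ∈ B := by
  induction m with
  | zero => exact hg x hx i
  | succ m ih =>
    simp only [extendTuple, ne_eq, mul_eq_zero, not_or] at hx
    refine Fin.cases ?_ (fun j => ?_) i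
    · by_contra h
      exact hx.1 (Set.indicator_of_notMem h _)
    · exact ih (Fin.tail x) hx.2 j

lemma extendTuple_le {B : Set X} {n : ℕ} {g : (Fin n → X) → ℝ≥0∞} {M : ℝ≥0∞}
    (hM : ∀ x, g x ≤ M) (m : ℕ) (x : Fin (n + m) → X) : extendTuple B g m x ≤ M := by
  induction m with
  | zero => exact hM x
  | succ m ih =>
    calc B.indicator 1 (x 0) * extendTuple B g m (Fin.tail x) ≤ 1 * M :=
          mul_le_mul' (Set.indicator_le_self _ _ _) (ih _)
      _ = M := one_mul _

variable [MeasurableSpace X]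

lemma measurable_fin_cons {n : ℕ} :
    Measurable fun p : X × (Fin n → X) => (Fin.cons p.1 p.2 : Fin (n + 1) → X) := by
  refine measurable_pi_lambda _ fun i => ?_
  refine Fin.cases ?_ (fun j => ?_) i
  · simpa using measurable_fst
  · exact (measurable_pi_apply j).comp measurable_snd

lemma measurable_fin_tail {n : ℕ} : Measurable fun x : Fin (n + 1) → X => Fin.tail x :=
  measurable_pi_lambda _ fun _ => measurable_pi_apply _

lemma measurable_extendTuple {B : Set X} (hB : MeasurableSet B) {n : ℕ}
    {g : (Fin n → X) → ℝ≥0∞} (hg : Measurable g) (m : ℕ) : Measurable (extendTuple B g m) := by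
  induction m with
  | zero => exact hg
  | succ m ih =>
    exact ((measurable_one.indicator hB).comp (measurable_pi_apply 0)).mul
      (ih.comp measurable_fin_tail)

lemma lintegral_comp_perm (ν : Measure X) [SigmaFinite ν] {n : ℕ} (f : (Fin n → X) → ℝ≥0∞)
    (σ : Equiv.Perm (Fin n)) :
    ∫⁻ x, f (x ∘ σ) ∂(Measure.pi fun _ : Fin n => ν) =
      ∫⁻ x, f x ∂(Measure.pi fun _ : Fin n => ν) := by
  have h := measurePreserving_piCongrLeft (fun _ : Fin n => ν) σ
  rw [← h.lintegral_comp_emb (MeasurableEquiv.measurableEmbedding _)]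
  refine lintegral_congr fun x => ?_
  congr 1
  funext i
  rw [MeasurableEquiv.coe_piCongrLeft]
  exact Equiv.piCongrLeft_apply_apply (P := fun _ : Fin n => X) σ x i

end Extension

variable {X : Type*} [TopologicalSpace X]

/-- The sum of `f` over all `n`-tuples of distinct points of `γ`. It is written as a sum over all
tuples in `X`, so that tuples can be split with `Fin.cons`. -/
noncomputable def tupleSum (n : ℕ) (f : (Fin n → X) → ℝ≥0∞) (γ : Configuration X) : ℝ≥0∞ :=
  ∑' x : Fin n → X, {x | Injective x ∧ ∀ i, x i ∈ γ.points}.indicator f x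

lemma tupleSum_eq_tsum_embedding (n : ℕ) (f : (Fin n → X) → ℝ≥0∞) (γ : Configuration X) :
    tupleSum n f γ = ∑' x : Fin n ↪ γ.points, f fun i => (x i : X) := by
  let e : (Fin n ↪ γ.points) ≃ {x : Fin n → X | Injective x ∧ ∀ i, x i ∈ γ.points} :=
    { toFun := fun x => ⟨fun i => x i, Subtype.val_injective.comp x.injective, fun i => (x i).2⟩
      invFun := fun x => ⟨fun i => ⟨x.1 i, x.2.2 i⟩, fun i j h =>
        x.2.1 (by simpa using congrArg Subtype.val h)⟩
      left_inv := fun x => by ext; rfl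
      right_inv := fun x => by ext; rfl }
  rw [tupleSum, ← tsum_subtype, ← e.tsum_eq]
  rfl

lemma tupleSum_cons (n : ℕ) (f : (Fin (n + 1) → X) → ℝ≥0∞) (γ : Configuration X) :
    tupleSum (n + 1) f γ =
      ∑' a : γ.points, tupleSum n (fun x => f (Fin.cons (a : X) x)) (γ.erase a) := by
  classical
  rw [tupleSum, ← (Fin.consEquiv fun _ => X).tsum_eq, ENNReal.tsum_prod',
    tsum_subtype γ.points fun a => tupleSum n (fun x => f (Fin.cons (a : X) x)) (γ.erase a)]
  refine tsum_congr fun a => ?_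
  by_cases ha : a ∈ γ.points
  · rw [Set.indicator_of_mem ha, tupleSum]
    refine tsum_congr fun x => ?_
    change Set.indicator _ f (Fin.cons a x) = _
    simp only [Set.indicator_apply, Set.mem_ofPred_eq,
      Fin.cons_injective_iff, Fin.forall_fin_succ, Fin.cons_zero, Fin.cons_succ, points_erase,
      Set.mem_sdiff, Set.mem_singleton_iff, Set.mem_range, not_exists, ha, true_and]
    grind
  · rw [Set.indicator_of_notMem ha]
    refine ENNReal.tsum_eq_zero.2 fun x => Set.indicator_of_notMem (fun h => ha ?_) _
    simpa using h.2 0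

lemma tupleSum_cons' (n : ℕ) (f : (Fin (n + 1) → X) → ℝ≥0∞) (γ : Configuration X) :
    tupleSum (n + 1) f γ = tupleSum n
      (fun x => ∑' a, (γ.points \ Set.range x).indicator (fun a => f (Fin.cons (a : X) x)) a) γ := by
  classical
  rw [tupleSum, ← (Fin.consEquiv fun _ => X).tsum_eq, ENNReal.tsum_prod', ENNReal.tsum_comm,
    tupleSum]
  refine tsum_congr fun x => ?_
  by_cases hx : x ∈ {x : Fin n → X | Injective x ∧ ∀ i, x i ∈ γ.points}
  · rw [Set.indicator_of_mem hx]
    refine tsum_congr fun a => ?_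
    change Set.indicator _ f (Fin.cons a x) = _
    simp only [Set.indicator_apply, Set.mem_ofPred_eq,
      Fin.cons_injective_iff, Fin.forall_fin_succ, Fin.cons_zero, Fin.cons_succ,
      Set.mem_sdiff, Set.mem_range, not_exists]
    have h1 := hx.1
    have h2 := hx.2
    grind
  · rw [Set.indicator_of_notMem hx]
    refine ENNReal.tsum_eq_zero.2 fun a => Set.indicator_of_notMem (fun h => hx ?_) _
    change (Injective (Fin.cons a x : Fin (n + 1) → X) ∧
      ∀ i, (Fin.cons a x : Fin (n + 1) → X) i ∈ γ.points) at h
    simp only [Fin.cons_injective_iff, Fin.forall_fin_succ, Fin.cons_zero, Fin.cons_succ] at h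
    exact ⟨h.1.2, h.2.2⟩

/-- The number of points of `γ` in `B`. -/
noncomputable def pointCount (B : Set X) (γ : Configuration X) : ℕ := (γ.points ∩ B).ncard

lemma tupleSum_extend_succ {B : Set X} (hB : IsCompact (closure B)) {n : ℕ}
    {g : (Fin n → X) → ℝ≥0∞} (hg : ∀ x, g x ≠ 0 → ∀ i, x i ∈ B) (γ : Configuration X) :
    tupleSum (n + 1) (fun x => B.indicator 1 (x 0) * g (Fin.tail x)) γ =
      ((pointCount B γ - n : ℕ) : ℝ≥0∞) * tupleSum n g γ := by
  classical
  rw [tupleSum_cons', tupleSum, tupleSum, ← ENNReal.tsum_mul_left]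
  refine tsum_congr fun x => ?_
  by_cases hx : x ∈ {x : Fin n → X | Injective x ∧ ∀ i, x i ∈ γ.points}
  swap
  · rw [Set.indicator_of_notMem hx, Set.indicator_of_notMem hx, mul_zero]
  rw [Set.indicator_of_mem hx, Set.indicator_of_mem hx]
  by_cases h0 : g x = 0
  · simp [h0]
  have h1 : ∀ a, (γ.points \ Set.range x).indicator
      (fun a => B.indicator 1 ((Fin.cons a x : Fin (n + 1) → X) 0) *
        g (Fin.tail (Fin.cons a x : Fin (n + 1) → X))) a =
      ((γ.points ∩ B) \ Set.range x).indicator 1 a * g x := by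
    intro a
    simp only [Fin.cons_zero, Fin.tail_cons, Set.indicator_apply, Set.mem_sdiff, Set.mem_inter_iff,
      Pi.one_apply]
    grind
  simp_rw [h1]
  rw [ENNReal.tsum_mul_right, ← tsum_subtype]
  congr 1
  have hfin : (γ.points ∩ B).Finite := γ.finite_inter hB
  have hsub : Set.range x ⊆ γ.points ∩ B := by
    rintro _ ⟨i, rfl⟩
    exact ⟨hx.2 i, hg x h0 i⟩
  simp only [Pi.one_apply, ENNReal.tsum_one, ENat.card_coe_set_eq]
  rw [← (hfin.subset Set.sdiff_subset).cast_ncard_eq, pointCount]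
  have hcard : ((γ.points ∩ B) \ Set.range x).ncard = (γ.points ∩ B).ncard - n := by
    rw [Set.ncard_sdiff hsub, Set.ncard_range_of_injective hx.1, Nat.card_eq_fintype_card,
      Fintype.card_fin]
  rw [hcard]
  simp

lemma tupleSum_extendTuple {B : Set X} (hB : IsCompact (closure B)) {n : ℕ}
    {g : (Fin n → X) → ℝ≥0∞} (hg : ∀ x, g x ≠ 0 → ∀ i, x i ∈ B) (γ : Configuration X) (m : ℕ) :
    tupleSum (n + m) (extendTuple B g m) γ =
      ((pointCount B γ - n).descFactorial m : ℝ≥0∞) * tupleSum n g γ := by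
  induction m with
  | zero => simp [extendTuple]
  | succ m ih =>
    have := tupleSum_extend_succ hB (extendTuple_support hg m) γ
    rw [ih, ← mul_assoc] at this
    rw [Nat.descFactorial_succ, ← Nat.sub_sub] at *
    push_cast
    exact_mod_cast this

lemma tupleSum_eq_zero_of_lt {B : Set X} (hB : IsCompact (closure B)) {n : ℕ}
    {g : (Fin n → X) → ℝ≥0∞} (hg : ∀ x, g x ≠ 0 → ∀ i, x i ∈ B) {γ : Configuration X}
    (h : pointCount B γ < n) : tupleSum n g γ = 0 := by
  refine ENNReal.tsum_eq_zero.2 fun x => Set.indicator_apply_eq_zero.2 fun hx => ?_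
  by_contra h0
  have hsub : Set.range x ⊆ γ.points ∩ B := by
    rintro _ ⟨i, rfl⟩
    exact ⟨hx.2 i, hg x h0 i⟩
  have := Set.ncard_le_ncard hsub (γ.finite_inter hB)
  rw [Set.ncard_range_of_injective hx.1, Nat.card_eq_fintype_card, Fintype.card_fin] at this
  exact absurd h (not_lt.2 this)

/-- The sum of `g` over the `n`-tuples of distinct points of `γ`, if `γ` has exactly `n` points
in `B`, and `0` otherwise. -/
noncomputable def exactSum (B : Set X) (n : ℕ) (g : (Fin n → X) → ℝ≥0∞) (γ : Configuration X) :
    ℝ≥0∞ := {γ | pointCount B γ = n}.indicator (tupleSum n g) γ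

lemma hasSum_alternating_descFactorial (p : ℕ) :
    HasSum (fun m : ℕ => (-1 : ℝ) ^ m / m.factorial * p.descFactorial m)
      (if p = 0 then 1 else 0) := by
  have h1 (m : ℕ) : (-1 : ℝ) ^ m / m.factorial * p.descFactorial m = (-1) ^ m * p.choose m := by
    rw [Nat.descFactorial_eq_factorial_mul_choose]
    push_cast
    have : (m.factorial : ℝ) ≠ 0 := by positivity
    field_simp
  simp_rw [h1]
  have h2 : ∑ m ∈ Finset.range (p + 1), (-1 : ℝ) ^ m * p.choose m = if p = 0 then 1 else 0 := by
    have := Int.alternating_sum_range_choose (n := p)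
    exact_mod_cast this
  rw [← h2]
  refine hasSum_sum_of_ne_finset_zero fun m hm => ?_
  rw [Nat.choose_eq_zero_of_lt (by simpa using hm)]
  simp

lemma hasSum_exactSum {B : Set X} (hB : IsCompact (closure B)) {n : ℕ}
    {g : (Fin n → X) → ℝ≥0∞} (hg : ∀ x, g x ≠ 0 → ∀ i, x i ∈ B) (γ : Configuration X) :
    HasSum (fun m : ℕ => (-1 : ℝ) ^ m / m.factorial *
      (tupleSum (n + m) (extendTuple B g m) γ).toReal) (exactSum B n g γ).toReal := by
  simp_rw [tupleSum_extendTuple hB hg, ENNReal.toReal_mul, ENNReal.toReal_natCast, ← mul_assoc]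
  have h := (hasSum_alternating_descFactorial (pointCount B γ - n)).mul_right
    (tupleSum n g γ).toReal
  have hv : (exactSum B n g γ).toReal =
      (if pointCount B γ - n = 0 then 1 else 0) * (tupleSum n g γ).toReal := ?_
  · rwa [hv]
  change ({γ | pointCount B γ = n}.indicator (tupleSum n g) γ).toReal = _
  rcases lt_trichotomy (pointCount B γ) n with h | h | h
  · simp [tupleSum_eq_zero_of_lt hB hg h, Set.indicator]
  · simp [h]
  · have h1 : ¬ pointCount B γ = n := h.ne'
    have h2 : ¬ pointCount B γ - n = 0 := by omega
    rw [Set.indicator_of_notMem (by simpa using h1)]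
    simp [h2]

/-- A symmetric function of the points in `B` is recovered from its sum over tuples: there are
`n!` ways to enumerate `n` points. -/
lemma tupleSum_const_of_pointCount {B : Set X} (hB : IsCompact (closure B)) {n : ℕ}
    {g : (Fin n → X) → ℝ≥0∞} (hg : ∀ x, g x ≠ 0 → ∀ i, x i ∈ B) {γ : Configuration X}
    (hγ : pointCount B γ = n) {c : ℝ≥0∞}
    (hc : ∀ x, Injective x → Set.range x = γ.points ∩ B → g x = c) :
    tupleSum n g γ = n.factorial * c := by
  have hfin : (γ.points ∩ B).Finite := γ.finite_inter hB
  let S : Set (Fin n → X) := {x | Injective x ∧ ∀ i, x i ∈ γ.points ∩ B}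
  have h1 : tupleSum n g γ = ∑' x, S.indicator (fun _ => c) x := by
    refine tsum_congr fun x => ?_
    by_cases hx : x ∈ S
    · have hsub : Set.range x ⊆ γ.points ∩ B := by
        rintro _ ⟨i, rfl⟩; exact hx.2 i
      have heq : Set.range x = γ.points ∩ B := by
        refine Set.eq_of_subset_of_ncard_le hsub ?_ hfin
        rw [Set.ncard_range_of_injective hx.1, Nat.card_eq_fintype_card, Fintype.card_fin]
        exact hγ.le
      have hx' : x ∈ {x : Fin n → X | Injective x ∧ ∀ i, x i ∈ γ.points} :=
        ⟨hx.1, fun i => (hx.2 i).1⟩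
      rw [Set.indicator_of_mem hx, Set.indicator_of_mem hx', hc x hx.1 heq]
    · rw [Set.indicator_of_notMem hx]
      refine Set.indicator_apply_eq_zero.2 fun h => ?_
      by_contra h0
      exact hx ⟨h.1, fun i => ⟨h.2 i, hg x h0 i⟩⟩
  rw [h1, ← tsum_subtype S (fun _ => c), ENNReal.tsum_const]
  congr 1
  let e : S ≃ (Fin n ↪ (γ.points ∩ B : Set X)) :=
    { toFun := fun x => ⟨fun i => ⟨x.1 i, x.2.2 i⟩, fun i j h =>
        x.2.1 (by simpa using congrArg Subtype.val h)⟩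
      invFun := fun x => ⟨fun i => x i, Subtype.val_injective.comp x.injective, fun i => (x i).2⟩
      left_inv := fun x => by ext; rfl
      right_inv := fun x => by ext; rfl }
  have : Fintype (γ.points ∩ B : Set X) := hfin.fintype
  have hcard : Fintype.card (γ.points ∩ B : Set X) = n := by
    rw [← Nat.card_eq_fintype_card]
    exact hγ
  rw [ENat.card_congr e, ENat.card_eq_coe_fintype_card, Fintype.card_embedding_eq, hcard,
    Fintype.card_fin, Nat.descFactorial_self]
  simp

/-! ### Expectations of tuple sums -/

lemma tupleSum_comp_perm {n : ℕ} (f : (Fin n → X) → ℝ≥0∞) (σ : Equiv.Perm (Fin n))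
    (γ : Configuration X) : tupleSum n (fun x => f (x ∘ σ)) γ = tupleSum n f γ := by
  classical
  rw [tupleSum, tupleSum, ← (σ.arrowCongr (Equiv.refl X)).tsum_eq]
  refine tsum_congr fun x => ?_
  simp only [Set.indicator_apply, Set.mem_ofPred_eq]
  have h1 : (Injective ((σ.arrowCongr (Equiv.refl X)) x) ∧
      ∀ i, (σ.arrowCongr (Equiv.refl X)) x i ∈ γ.points) ↔
      (Injective x ∧ ∀ i, x i ∈ γ.points) := by
    change (Injective (x ∘ σ.symm) ∧ ∀ i, x (σ.symm i) ∈ γ.points) ↔ _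
    rw [σ.symm.injective_comp]
    refine and_congr_right fun _ => ?_
    exact ⟨fun h i => by simpa using h (σ i), fun h i => h _⟩
  have h2 : ((σ.arrowCongr (Equiv.refl X)) x) ∘ σ = x := by
    funext i; simp
  simp only [h1, h2]

variable [MeasurableSpace X]

/-- The defining property of correlation functions extends to functions that need not be symmetric,
by symmetrization. -/
lemma lintegral_tupleSum {ν : Measure X} [SigmaFinite ν] {μ : Measure (Configuration X)} {n : ℕ}
    {k : (Fin n → X) → ℝ≥0∞} (hk : IsCorrelationFunction ν μ n k) {f : (Fin n → X) → ℝ≥0∞}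
    (hf : Measurable f) :
    ∫⁻ γ, tupleSum n f γ ∂μ = ∫⁻ x, f x * k x ∂(Measure.pi fun _ : Fin n => ν) := by
  let fs : (Fin n → X) → ℝ≥0∞ := fun x => ∑ σ : Equiv.Perm (Fin n), f (x ∘ σ)
  have hσ (σ : Equiv.Perm (Fin n)) : Measurable fun x : Fin n → X => x ∘ σ :=
    measurable_pi_lambda _ fun i => measurable_pi_apply _
  have hfs : Measurable fs := Finset.measurable_fun_sum _ fun σ _ => hf.comp (hσ σ)
  have hsymm (σ : Equiv.Perm (Fin n)) (x : Fin n → X) : fs (x ∘ σ) = fs x := by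
    refine Fintype.sum_equiv (Equiv.mulLeft σ) _ _ fun τ => ?_
    simp [Function.comp_assoc, Equiv.Perm.coe_mul]
  have h := hk.2.2 fs hfs hsymm
  have h1 (γ : Configuration X) : ∑' x : Fin n ↪ γ.points, fs (fun i => (x i : X)) =
      (n.factorial : ℝ≥0∞) * tupleSum n f γ := by
    rw [← tupleSum_eq_tsum_embedding]
    have : tupleSum n fs γ = ∑ σ : Equiv.Perm (Fin n), tupleSum n (fun x => f (x ∘ σ)) γ := by
      simp only [tupleSum]
      rw [← Summable.tsum_finsetSum fun _ _ => ENNReal.summable]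
      refine tsum_congr fun x => ?_
      by_cases hx : x ∈ {x : Fin n → X | Injective x ∧ ∀ i, x i ∈ γ.points}
      · simp only [Set.indicator_of_mem hx, fs]
      · simp only [Set.indicator_of_notMem hx, Finset.sum_const_zero]
    rw [this]
    simp_rw [tupleSum_comp_perm]
    simp [Finset.card_univ, Fintype.card_perm]
  have h2 : ∫⁻ x, fs x * k x ∂(Measure.pi fun _ : Fin n => ν) =
      (n.factorial : ℝ≥0∞) * ∫⁻ x, f x * k x ∂(Measure.pi fun _ : Fin n => ν) := by
    simp only [fs, Finset.sum_mul]
    rw [lintegral_finsetSum _ fun (σ : Equiv.Perm (Fin n)) _ =>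
      (show Measurable fun x => f (x ∘ σ) * k x from (hf.comp (hσ σ)).mul hk.1)]
    have : ∀ σ : Equiv.Perm (Fin n), ∫⁻ x, f (x ∘ σ) * k x ∂(Measure.pi fun _ : Fin n => ν) =
        ∫⁻ x, f x * k x ∂(Measure.pi fun _ : Fin n => ν) := by
      intro σ
      rw [← lintegral_comp_perm ν (fun x => f x * k x) σ]
      simp_rw [hk.2.1 σ]
    simp [this, Finset.card_univ, Fintype.card_perm]
  have hn0 : (n.factorial : ℝ≥0∞) ≠ 0 := by exact_mod_cast n.factorial_ne_zero
  have hnt : (n.factorial : ℝ≥0∞) ≠ ∞ := ENNReal.natCast_ne_top _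
  rw [h2, ← mul_assoc, ENNReal.inv_mul_cancel hn0 hnt, one_mul] at h
  rw [← h]
  refine lintegral_congr fun γ => ?_
  rw [h1, ← mul_assoc, ENNReal.inv_mul_cancel hn0 hnt, one_mul]

variable [LocallyCompactSpace X] [SecondCountableTopology X] [T2Space X] [BorelSpace X]

/-- A parameter is included for the induction on `n`: the first point of the tuple becomes part of
it. -/
lemma measurable_tupleSum_param {X : Type u} [TopologicalSpace X] [MeasurableSpace X]
    [LocallyCompactSpace X] [SecondCountableTopology X] [T2Space X] [BorelSpace X] {n : ℕ} :
    ∀ {Y : Type u} [MeasurableSpace Y]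
    {f : Y × (Fin n → X) → ℝ≥0∞}, Measurable f →
    Measurable fun p : Y × Configuration X => tupleSum n (fun x => f (p.1, x)) p.2 := by
  induction n with
  | zero =>
    intro Y _ f hf
    have : (fun p : Y × Configuration X => tupleSum 0 (fun x => f (p.1, x)) p.2) =
        fun p => f (p.1, default) := by
      funext p
      rw [tupleSum, tsum_eq_single default]
      · refine Set.indicator_of_mem ?_ _
        exact ⟨injective_of_subsingleton _, fun i => i.elim0⟩
      · intro x hx
        exact absurd (Subsingleton.elim x _) hx
    rw [this]
    exact hf.comp (measurable_fst.prodMk measurable_const)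
  | succ n ih =>
    intro Y _ f hf
    have h1 : (fun p : Y × Configuration X => tupleSum (n + 1) (fun x => f (p.1, x)) p.2) =
        fun p => ∫⁻ a, tupleSum n (fun x => f (p.1, Fin.cons a x)) (p.2.erase a)
          ∂((kernel X).prodMkLeft Y p) := by
      funext p
      rw [tupleSum_cons, Kernel.prodMkLeft_apply, kernel_apply, lintegral_toMeasure]
    rw [h1]
    have hf' : Measurable fun q : (Y × X) × (Fin n → X) => f (q.1.1, Fin.cons q.1.2 q.2) :=
      hf.comp ((measurable_fst.comp measurable_fst).prodMk
        (measurable_fin_cons.comp ((measurable_snd.comp measurable_fst).prodMk measurable_snd)))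
    have h2 := ih hf'
    have h3 : Measurable fun q : (Y × Configuration X) × X =>
        (((q.1.1, q.2), q.1.2.erase q.2) : (Y × X) × Configuration X) :=
      ((measurable_fst.comp measurable_fst).prodMk measurable_snd).prodMk
        (measurable_erase.comp ((measurable_snd.comp measurable_fst).prodMk measurable_snd))
    exact Measurable.lintegral_kernel_prod_right' (h2.comp h3)

lemma measurable_tupleSum {n : ℕ} {f : (Fin n → X) → ℝ≥0∞} (hf : Measurable f) :
    Measurable (tupleSum n f) :=
  (measurable_tupleSum_param (Y := PUnit) (hf.comp measurable_snd)).comp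
    (measurable_const.prodMk measurable_id : Measurable fun γ => (PUnit.unit, γ))

lemma measurableSet_pointCount {B : Set X} (hB : IsBoundedBorel B) (n : ℕ) :
    MeasurableSet {γ : Configuration X | pointCount B γ = n} := by
  have h : {γ : Configuration X | pointCount B γ = n} = {γ | kernel X γ B = n} := by
    ext γ
    simp only [Set.mem_ofPred_eq, kernel_apply, toMeasure_apply γ B hB.1, pointCount]
    rw [(γ.finite_inter hB.2).encard_eq_coe, ← (γ.finite_inter hB.2).cast_ncard_eq]
    simp
  rw [h]
  exact Kernel.measurable_coe _ hB.1 (measurableSet_singleton _)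

lemma measurable_exactSum {B : Set X} (hB : IsBoundedBorel B) {n : ℕ} {f : (Fin n → X) → ℝ≥0∞}
    (hf : Measurable f) : Measurable (exactSum B n f) :=
  (measurable_tupleSum hf).indicator (measurableSet_pointCount hB n)

/-- The Janossy expansion: the expectation of an `exactSum` is an alternating series of integrals
against the correlation functions. -/
lemma hasSum_lintegral_exactSum {ν : Measure X} [SigmaFinite ν] {μ : Measure (Configuration X)}
    {k : (n : ℕ) → (Fin n → X) → ℝ≥0∞} (hk : ∀ n, IsCorrelationFunction ν μ n (k n))
    {B : Set X} (hB : IsBoundedBorel B) {n : ℕ} {g : (Fin n → X) → ℝ≥0∞} (hgm : Measurable g)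
    (hg : ∀ x, g x ≠ 0 → ∀ i, x i ∈ B)
    (hfin : ∀ m, ∫⁻ x, extendTuple B g m x * k (n + m) x ∂(Measure.pi fun _ => ν) ≠ ∞)
    (hsum : Summable fun m : ℕ => (m.factorial : ℝ)⁻¹ *
      (∫⁻ x, extendTuple B g m x * k (n + m) x ∂(Measure.pi fun _ => ν)).toReal) :
    HasSum (fun m : ℕ => (-1 : ℝ) ^ m / m.factorial *
      (∫⁻ x, extendTuple B g m x * k (n + m) x ∂(Measure.pi fun _ => ν)).toReal)
      (∫⁻ γ, exactSum B n g γ ∂μ).toReal := by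
  have hE (m : ℕ) := lintegral_tupleSum (hk (n + m)) (measurable_extendTuple hB.1 hgm m)
  have hTm (m : ℕ) := measurable_tupleSum (measurable_extendTuple hB.1 hgm m)
  simp_rw [← hE] at hfin hsum ⊢
  have hae (m : ℕ) := ae_lt_top (hTm m) (hfin m)
  have hint (m : ℕ) : Integrable (fun γ => (-1 : ℝ) ^ m / m.factorial *
      (tupleSum (n + m) (extendTuple B g m) γ).toReal) μ :=
    (integrable_toReal_of_lintegral_ne_top (hTm m).aemeasurable (hfin m)).const_mul _
  have hI (m : ℕ) : ∫ γ, (tupleSum (n + m) (extendTuple B g m) γ).toReal ∂μ =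
      (∫⁻ γ, tupleSum (n + m) (extendTuple B g m) γ ∂μ).toReal :=
    integral_toReal (hTm m).aemeasurable (hae m)
  have h := hasSum_integral_of_summable_integral_norm hint (by
    refine hsum.congr fun m => ?_
    simp_rw [norm_mul, Real.norm_of_nonneg ENNReal.toReal_nonneg]
    rw [integral_const_mul, hI]
    simp)
  simp_rw [integral_const_mul, hI] at h
  have hlim : (∫⁻ γ, exactSum B n g γ ∂μ).toReal = ∫ γ, ∑' m : ℕ, (-1 : ℝ) ^ m / m.factorial *
      (tupleSum (n + m) (extendTuple B g m) γ).toReal ∂μ := ?_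
  · rwa [hlim]
  rw [← integral_toReal (measurable_exactSum hB hgm).aemeasurable]
  · refine integral_congr_ae (Eventually.of_forall fun γ => ?_)
    exact (hasSum_exactSum hB.2 hg γ).tsum_eq.symm
  · filter_upwards [hae 0] with γ hγ
    refine lt_of_le_of_lt ?_ hγ
    exact Set.indicator_le_self _ _ _

/-! ### The Palm bound from bounds on exact sums -/

/-- The Palm bound follows from a comparison, uniform in `B`, of the expectations of exact sums. -/
lemma hasPalmBound_of_exactSum {μ : Measure (Configuration X)}
    (h : ∀ Λ : Set X, IsBoundedBorel Λ → ∃ C : ℝ≥0∞, C ≠ ∞ ∧ ∀ B : Set X, IsBoundedBorel B → Λ ⊆ B →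
      ∀ (n : ℕ) (g : (Fin n → X) → ℝ≥0∞) (M : ℝ≥0), Measurable g → (∀ x, g x ≤ M) →
        (∀ x, g x ≠ 0 → ∀ i, x i ∈ B) →
        ∫⁻ γ, exactSum B (n + 1) (fun x => Λ.indicator 1 (x 0) * g (Fin.tail x)) γ ∂μ ≤
          C * ∫⁻ γ, exactSum B n g γ ∂μ) :
    HasPalmBound μ := by
  intro Λ hΛ
  obtain ⟨C, hC, hCB⟩ := h Λ hΛ
  refine ⟨C, hC, fun F hF => ?_⟩
  obtain ⟨M, hM⟩ := CylinderFunctions.exists_bound hF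
  obtain ⟨N, φ, G, rfl⟩ := hF
  obtain ⟨B₀, hB₀, hφ₀⟩ := exists_tsupport_subset φ
  let B := B₀ ∪ Λ
  have hB : IsBoundedBorel B := ⟨hB₀.1.union hΛ.1, by
    simp only [B]; rw [closure_union]; exact hB₀.2.union hΛ.2⟩
  have hφ (i : Fin N) : tsupport (φ i) ⊆ B := (hφ₀ i).trans Set.subset_union_left
  have hΛB : Λ ⊆ B := Set.subset_union_right
  let F : Configuration X → ℝ := fun γ => G fun i => pairing (φ i) γ
  -- `g n` is `F²` as a function of the `n` points in `B`
  let g (n : ℕ) : (Fin n → X) → ℝ≥0∞ := (Set.univ.pi fun _ => B).indicator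
    fun x => ‖G fun i => ∑ j, φ i (x j)‖ₑ ^ 2
  have hgm (n : ℕ) : Measurable (g n) := by
    refine Measurable.indicator ?_ (MeasurableSet.univ_pi fun _ => hB.1)
    refine Measurable.pow_const (Measurable.enorm (G.continuous.measurable.comp ?_)) 2
    refine measurable_pi_lambda _ fun i => Finset.measurable_fun_sum _ fun j _ => ?_
    exact (φ i).continuous.measurable.comp (measurable_pi_apply j)
  have hgs (n : ℕ) (x : Fin n → X) (hx : g n x ≠ 0) (i : Fin n) : x i ∈ B := by
    by_contra hi
    exact hx (Set.indicator_of_notMem (fun h : x ∈ Set.univ.pi fun _ => B => hi (h i trivial)) _)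
  have hgM (n : ℕ) (x : Fin n → X) : g n x ≤ ((‖G‖₊ ^ 2 : ℝ≥0) : ℝ≥0∞) := by
    refine (Set.indicator_le_self _ _ x).trans ?_
    push_cast
    gcongr
    rw [← enorm_eq_nnnorm, enorm_le_iff_norm_le]
    exact G.norm_coe_le_norm _
  have hval (n : ℕ) (γ : Configuration X) (hγ : pointCount B γ = n) :
      tupleSum n (g n) γ = n.factorial * ‖F γ‖ₑ ^ 2 := by
    refine tupleSum_const_of_pointCount hB.2 (hgs n) hγ fun x hx hr => ?_
    have hmem : x ∈ Set.univ.pi fun _ => B := fun i _ =>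
      (hr.subset (Set.mem_range_self i)).2
    change (Set.univ.pi fun _ => B).indicator _ x = _
    rw [Set.indicator_of_mem hmem]
    congr 4
    funext i
    classical
    rw [pairing_eq_sum _ γ (Finset.univ.map ⟨x, hx⟩), Finset.sum_map]
    · rfl
    · rw [Finset.coe_map]
      simp only [Embedding.coeFn_mk, Finset.coe_univ, Set.image_univ, hr]
      exact Set.inter_subset_left
    · intro y hy hys
      refine image_eq_zero_of_notMem_tsupport fun hyφ => hys ?_
      have : y ∈ Set.range x := hr.superset ⟨hy, hφ i hyφ⟩
      simpa using this
  have hn0 (n : ℕ) : (n.factorial : ℝ≥0∞) ≠ 0 := by exact_mod_cast n.factorial_ne_zero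
  have hnt (n : ℕ) : (n.factorial : ℝ≥0∞) ≠ ∞ := ENNReal.natCast_ne_top _
  -- split according to the number of points in `B`; each set of `n` points is counted `n!` times
  have hF (γ : Configuration X) :
      ‖F γ‖ₑ ^ 2 = ∑' n : ℕ, (n.factorial : ℝ≥0∞)⁻¹ * exactSum B n (g n) γ := by
    rw [tsum_eq_single (pointCount B γ)]
    · rw [exactSum, Set.indicator_of_mem
        (show γ ∈ {η | pointCount B η = pointCount B γ} from rfl), hval _ γ rfl, ← mul_assoc,
        ENNReal.inv_mul_cancel (hn0 _) (hnt _), one_mul]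
    · intro n hn
      rw [exactSum, Set.indicator_of_notMem (fun h => hn h.symm), mul_zero]
  have hcount (γ : Configuration X) (a : X) (ha : a ∈ γ.points) (haB : a ∈ B) :
      pointCount B γ = pointCount B (γ.erase a) + 1 := by
    have hs : (γ.erase a).points ∩ B = (γ.points ∩ B) \ {a} := by
      ext y; simp only [points_erase, Set.mem_inter_iff, Set.mem_sdiff]; tauto
    rw [pointCount, pointCount, hs, Set.ncard_sdiff_singleton_add_one
      (show a ∈ γ.points ∩ B from ⟨ha, haB⟩) (γ.finite_inter hB.2)]
  -- if `γ` has `n + 1` points in `B`, then `γ \ a` has `n` of them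
  have hF' (γ : Configuration X) : ∫⁻ a in Λ, ‖F (γ.erase a)‖ₑ ^ 2 ∂γ.toMeasure ≤
      ∑' n : ℕ, (n.factorial : ℝ≥0∞)⁻¹ *
        exactSum B (n + 1) (fun x => Λ.indicator 1 (x 0) * g n (Fin.tail x)) γ := by
    rw [← lintegral_indicator hΛ.1, lintegral_toMeasure]
    rcases hp : pointCount B γ with _ | p
    · refine le_of_eq_of_le (ENNReal.tsum_eq_zero.2 fun a => ?_) zero_le
      refine Set.indicator_of_notMem (fun ha => ?_) _
      have := hcount γ a a.2 (hΛB ha)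
      omega
    · refine le_trans ?_ (ENNReal.le_tsum p)
      rw [exactSum, Set.indicator_of_mem (show γ ∈ {γ | pointCount B γ = p + 1} from hp),
        tupleSum_cons, ← ENNReal.tsum_mul_left]
      refine ENNReal.tsum_le_tsum fun a => ?_
      by_cases ha : (a : X) ∈ Λ
      · have hc : pointCount B (γ.erase a) = p := by
          have := hcount γ a a.2 (hΛB ha)
          omega
        simp only [Fin.cons_zero, Fin.tail_cons, Set.indicator_of_mem ha, Pi.one_apply, one_mul]
        rw [hval p _ hc, ← mul_assoc, ENNReal.inv_mul_cancel (hn0 _) (hnt _), one_mul]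
      · rw [Set.indicator_of_notMem ha]
        exact zero_le
  have hg1m (n : ℕ) : Measurable fun x : Fin (n + 1) → X =>
      Λ.indicator 1 (x 0) * g n (Fin.tail x) :=
    ((measurable_one.indicator hΛ.1).comp (measurable_pi_apply 0)).mul
      ((hgm n).comp measurable_fin_tail)
  calc ∫⁻ γ, ∫⁻ x in Λ, ‖F (γ.erase x)‖ₑ ^ 2 ∂γ.toMeasure ∂μ
      ≤ ∫⁻ γ, ∑' n : ℕ, (n.factorial : ℝ≥0∞)⁻¹ *
        exactSum B (n + 1) (fun x => Λ.indicator 1 (x 0) * g n (Fin.tail x)) γ ∂μ :=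
        lintegral_mono hF'
    _ = ∑' n : ℕ, (n.factorial : ℝ≥0∞)⁻¹ *
        ∫⁻ γ, exactSum B (n + 1) (fun x => Λ.indicator 1 (x 0) * g n (Fin.tail x)) γ ∂μ := by
        rw [lintegral_tsum fun n =>
          ((measurable_exactSum hB (hg1m n)).const_mul _).aemeasurable]
        simp_rw [lintegral_const_mul _ (measurable_exactSum hB (hg1m _))]
    _ ≤ ∑' n : ℕ, (n.factorial : ℝ≥0∞)⁻¹ * (C * ∫⁻ γ, exactSum B n (g n) γ ∂μ) := by
        refine ENNReal.tsum_le_tsum fun n => mul_le_mul_right ?_ _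
        exact hCB B hB hΛB n (g n) _ (hgm n) (hgM n) (hgs n)
    _ = C * ∫⁻ γ, ‖F γ‖ₑ ^ 2 ∂μ := by
        simp_rw [hF]
        rw [lintegral_tsum fun n => ((measurable_exactSum hB (hgm n)).const_mul _).aemeasurable]
        simp_rw [lintegral_const_mul _ (measurable_exactSum hB (hgm _))]
        rw [← ENNReal.tsum_mul_left]
        refine tsum_congr fun n => ?_
        ring

end Tuples

/-! ### Determinant inequalities -/

section Fischer

open scoped ComplexOrder
open Matrix

variable {𝕜 : Type*} [RCLike 𝕜]

/-- The Schur complement of a block of a positive semidefinite matrix is at most the diagonal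
entry. -/
lemma det_le_mul_det_toBlocks {m : Type*} [Fintype m] [DecidableEq m]
    {M : Matrix (m ⊕ Unit) (m ⊕ Unit) 𝕜} (hM : M.PosSemidef) :
    M.det ≤ M (.inr ()) (.inr ()) * M.toBlocks₁₁.det := by
  have hD : M.toBlocks₁₁.PosSemidef := hM.submatrix Sum.inl
  by_cases h0 : M.toBlocks₁₁.det = 0
  · -- a null vector of the block is a null vector of `M`
    obtain ⟨x, hx, hDx⟩ := Matrix.exists_mulVec_eq_zero_iff.2 h0
    have hy : M *ᵥ (Sum.elim x 0) = 0 := by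
      rw [← hM.dotProduct_mulVec_zero_iff]
      have h1 : ∀ i : m, (M *ᵥ (Sum.elim x 0)) (.inl i) = 0 := by
        intro i
        have := congrFun hDx i
        simpa [Matrix.mulVec, dotProduct, Fintype.sum_sum_type, toBlocks₁₁] using this
      simp [dotProduct, Fintype.sum_sum_type, h1]
    have hM0 : M.det = 0 := Matrix.exists_mulVec_eq_zero_iff.1
      ⟨Sum.elim x 0, fun h => hx (by funext i; simpa using congrFun h (.inl i)), hy⟩
    rw [hM0, h0, mul_zero]
  · have hpd := hD.posDef_iff_det_ne_zero.2 h0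
    have hinv : Invertible M.toBlocks₁₁ := hpd.isUnit.invertible
    have hC : M.toBlocks₂₁ = M.toBlocks₁₂ᴴ := by
      ext i j
      simpa [toBlocks₂₁, toBlocks₁₂] using (hM.isHermitian.apply (.inr i) (.inl j)).symm
    have hdet : M.det = M.toBlocks₁₁.det *
        (M (.inr ()) (.inr ()) - (M.toBlocks₁₂ᴴ * M.toBlocks₁₁⁻¹ * M.toBlocks₁₂) () ()) := by
      conv_lhs => rw [← fromBlocks_toBlocks M]
      rw [det_fromBlocks₁₁, invOf_eq_nonsing_inv, hC, det_unique (n := Unit)]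
      rfl
    have hs : 0 ≤ (M.toBlocks₁₂ᴴ * M.toBlocks₁₁⁻¹ * M.toBlocks₁₂) () () :=
      (hpd.inv.posSemidef.conjTranspose_mul_mul_same M.toBlocks₁₂).diag_nonneg
    rw [hdet, mul_comm (M (.inr ()) (.inr ()))]
    exact mul_le_mul_of_nonneg_left (sub_le_self _ hs) hD.det_nonneg

/-- **Fischer's inequality** for splitting off one row and column. -/
lemma det_le_mul_det_submatrix_succ {n : ℕ} {M : Matrix (Fin (n + 1)) (Fin (n + 1)) 𝕜}
    (hM : M.PosSemidef) : M.det ≤ M 0 0 * (M.submatrix Fin.succ Fin.succ).det := by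
  let e : Fin n ⊕ Unit ≃ Fin (n + 1) :=
    ((finSuccEquiv n).trans (Equiv.optionEquivSumPUnit (Fin n))).symm
  have h := det_le_mul_det_toBlocks (hM.submatrix e)
  rw [det_submatrix_equiv_self] at h
  have he0 : e (.inr ()) = 0 := by simp [e]
  have hes (i : Fin n) : e (.inl i) = i.succ := by simp [e]
  have h1 : (M.submatrix e e).toBlocks₁₁ = M.submatrix Fin.succ Fin.succ := by
    ext i j
    simp [toBlocks₁₁, hes]
  rw [h1] at h
  simpa [he0] using h

end Fischer

/-! ### Gram determinants of finitely many functions -/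

section Gram

open scoped ComplexOrder
open Matrix

variable {𝕜 : Type*} [RCLike 𝕜] {X ι : Type*}

/-- The summand of the Cauchy–Binet expansion of a Gram determinant that belongs to the rows
`f`. -/
noncomputable def cauchyBinetTerm (v : ι → X → 𝕜) {n : ℕ} (f : Fin n → ι) (x : Fin n → X) : 𝕜 :=
  (∏ i, star (v (f i) (x i))) * (Matrix.of fun i j => v (f i) (x j)).det

lemma cauchyBinetTerm_eq_zero (v : ι → X → 𝕜) {n : ℕ} {f : Fin n → ι} (x : Fin n → X)
    (hf : ¬ Function.Injective f) : cauchyBinetTerm v f x = 0 := by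
  obtain ⟨i, j, hij, hne⟩ := Function.not_injective_iff.1 hf
  rw [cauchyBinetTerm, Matrix.det_zero_of_row_eq hne (by funext l; simp [hij]), mul_zero]

/-- The determinant in the new variable, by Laplace expansion. -/
lemma cauchyBinetTerm_cons (v : ι → X → 𝕜) {n : ℕ} (k : ι) (f : Fin n → ι) (y : X) (x : Fin n → X) :
    cauchyBinetTerm v (Fin.cons k f : Fin (n + 1) → ι) (Fin.cons y x) =
      ∑ i : Fin (n + 1), (v ((Fin.cons k f : Fin (n + 1) → ι) i) y * star (v k y)) *
        ((-1) ^ (i : ℕ) * (∏ j, star (v (f j) (x j))) *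
          (Matrix.of fun a b => v ((Fin.cons k f : Fin (n + 1) → ι) (i.succAbove a)) (x b)).det) := by
  rw [cauchyBinetTerm, Fin.prod_univ_succ, Matrix.det_succ_column_zero, Finset.mul_sum]
  refine Finset.sum_congr rfl fun i _ => ?_
  have : (Matrix.of fun a b => v ((Fin.cons k f : Fin (n + 1) → ι) a)
      ((Fin.cons y x : Fin (n + 1) → X) b)).submatrix i.succAbove Fin.succ =
      Matrix.of fun a b => v ((Fin.cons k f : Fin (n + 1) → ι) (i.succAbove a)) (x b) := by
    ext a b; simp
  rw [this]
  simp only [Fin.cons_zero, Fin.cons_succ, Matrix.of_apply]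
  ring

variable [Fintype ι]

/-- The matrix `∑ₖ vₖ(xᵢ) conj(vₖ(xⱼ))`. -/
noncomputable def gramMatrix (v : ι → X → 𝕜) {n : ℕ} (x : Fin n → X) : Matrix (Fin n) (Fin n) 𝕜 :=
  Matrix.of fun i j => ∑ k, v k (x i) * star (v k (x j))

lemma posSemidef_gramMatrix (v : ι → X → 𝕜) {n : ℕ} (x : Fin n → X) :
    (gramMatrix v x).PosSemidef := by
  have : gramMatrix v x =
      (Matrix.of fun (i : Fin n) k => v k (x i)) * (Matrix.of fun (i : Fin n) k => v k (x i))ᴴ := by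
    ext i j
    simp [gramMatrix, Matrix.mul_apply]
  rw [this]
  exact posSemidef_self_mul_conjTranspose _

lemma gramMatrix_diag (v : ι → X → 𝕜) {n : ℕ} (x : Fin n → X) (i : Fin n) :
    gramMatrix v x i i = ((∑ k, ‖v k (x i)‖ ^ 2 : ℝ) : 𝕜) := by
  simp [gramMatrix, RCLike.mul_conj]

lemma re_det_gramMatrix_nonneg (v : ι → X → 𝕜) {n : ℕ} (x : Fin n → X) :
    0 ≤ RCLike.re (gramMatrix v x).det :=
  (RCLike.nonneg_iff.1 (posSemidef_gramMatrix v x).det_nonneg).1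

lemma re_det_gramMatrix_cons_le (v : ι → X → 𝕜) {n : ℕ} (y : X) (x : Fin n → X) :
    RCLike.re (gramMatrix v (Fin.cons y x : Fin (n + 1) → X)).det ≤
      (∑ k, ‖v k y‖ ^ 2) * RCLike.re (gramMatrix v x).det := by
  have h := det_le_mul_det_submatrix_succ
    (posSemidef_gramMatrix v (Fin.cons y x : Fin (n + 1) → X))
  have h1 : (gramMatrix v (Fin.cons y x : Fin (n + 1) → X)).submatrix Fin.succ Fin.succ =
      gramMatrix v x := by
    ext i j; simp [gramMatrix]
  rw [h1, gramMatrix_diag] at h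
  have h2 := (RCLike.le_iff_re_im.1 h).1
  rwa [RCLike.re_ofReal_mul] at h2

/-- **Hadamard's inequality** for Gram determinants. -/
lemma re_det_gramMatrix_le_prod (v : ι → X → 𝕜) {n : ℕ} (x : Fin n → X) :
    RCLike.re (gramMatrix v x).det ≤ ∏ i, ∑ k, ‖v k (x i)‖ ^ 2 := by
  induction n with
  | zero => simp
  | succ n ih =>
    rw [← Fin.cons_self_tail x, Fin.prod_univ_succ]
    refine (re_det_gramMatrix_cons_le v (x 0) (Fin.tail x)).trans ?_
    simp only [Fin.cons_zero, Fin.cons_succ]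
    exact mul_le_mul_of_nonneg_left (ih _) (Finset.sum_nonneg fun _ _ => by positivity)

lemma det_gramMatrix_eq_sum [DecidableEq ι] (v : ι → X → 𝕜) {n : ℕ} (x : Fin n → X) :
    (gramMatrix v x).det = ∑ f : Fin n → ι, cauchyBinetTerm v f x := by
  rw [← Matrix.det_transpose]
  have h1 : (gramMatrix v x)ᵀ = fun i => ∑ k, star (v k (x i)) • fun j => v k (x j) := by
    ext i j
    simp [gramMatrix, mul_comm]
  have h2 := (Matrix.detRowAlternating (n := Fin n) (R := 𝕜)).toMultilinearMap.map_sum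
    (fun i (k : ι) => star (v k (x i)) • fun j => v k (x j))
  rw [h1]
  refine h2.trans (Finset.sum_congr rfl fun f _ => ?_)
  rw [MultilinearMap.map_smul_univ]
  rfl

variable [DecidableEq ι]

/-- The Cauchy–Binet sum in which the summand of `f` carries the weight `θ (range f)`. -/
noncomputable def weightedGram (v : ι → X → 𝕜) (θ : Finset ι → ℝ) {n : ℕ} (x : Fin n → X) : 𝕜 :=
  ∑ f : Fin n → ι, ((θ (Finset.univ.image f) : ℝ) : 𝕜) * cauchyBinetTerm v f x

lemma weightedGram_one (v : ι → X → 𝕜) {n : ℕ} (x : Fin n → X) :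
    weightedGram v (fun _ => 1) x = (gramMatrix v x).det := by
  simp [weightedGram, det_gramMatrix_eq_sum]

/-- The effect on the weights of integrating out one variable. -/
def weightStep (lam : ι → ℝ) (θ : Finset ι → ℝ) (S : Finset ι) : ℝ :=
  ∑ k ∈ Sᶜ, lam k * θ (insert k S)

/-- The weights obtained from the constant weight by integrating out `m` variables, up to the
factor `m!`: the elementary symmetric polynomial in the `lam k`, `k ∉ S`. -/
def esymmWeight (lam : ι → ℝ) (m : ℕ) (S : Finset ι) : ℝ :=
  ∑ R ∈ Sᶜ.powersetCard m, ∏ k ∈ R, lam k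

lemma weightStep_esymmWeight (lam : ι → ℝ) (m : ℕ) (S : Finset ι) :
    weightStep lam (esymmWeight lam m) S = (m + 1) * esymmWeight lam (m + 1) S := by
  simp only [weightStep, esymmWeight, Finset.mul_sum]
  have h1 : ∀ R ∈ Sᶜ.powersetCard (m + 1), (m + 1 : ℝ) * ∏ k ∈ R, lam k =
      ∑ _k ∈ R, ∏ k ∈ R, lam k := by
    intro R hR
    rw [Finset.sum_const, (Finset.mem_powersetCard.1 hR).2]
    simp
  rw [Finset.sum_congr rfl h1, Finset.sum_sigma', Finset.sum_sigma']
  refine Finset.sum_bij' (fun p _ => ⟨insert p.1 p.2, p.1⟩) (fun p _ => ⟨p.2, p.1.erase p.2⟩)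
    ?_ ?_ ?_ ?_ ?_
  · rintro ⟨k, R⟩ h
    simp only [Finset.mem_sigma, Finset.mem_compl, Finset.mem_powersetCard] at h ⊢
    obtain ⟨hk, hR, hc⟩ := h
    have hkR : k ∉ R := fun h => by simpa using hR h
    refine ⟨⟨?_, by rw [Finset.card_insert_of_notMem hkR, hc]⟩, Finset.mem_insert_self _ _⟩
    intro j hj
    rcases Finset.mem_insert.1 hj with rfl | hj
    · simpa using hk
    · have := hR hj
      simp only [Finset.mem_compl, Finset.mem_insert, not_or] at this ⊢
      exact this.2
  · rintro ⟨R, k⟩ h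
    simp only [Finset.mem_sigma, Finset.mem_compl, Finset.mem_powersetCard] at h ⊢
    obtain ⟨⟨hR, hc⟩, hk⟩ := h
    refine ⟨by simpa using hR hk, ?_, by rw [Finset.card_erase_of_mem hk, hc]; rfl⟩
    intro j hj
    have hj' := Finset.mem_erase.1 hj
    have := hR hj'.2
    simp only [Finset.mem_compl, Finset.mem_insert, not_or] at this ⊢
    exact ⟨hj'.1, this⟩
  · rintro ⟨k, R⟩ h
    simp only [Finset.mem_sigma, Finset.mem_compl, Finset.mem_powersetCard] at h
    have hkR : k ∉ R := fun hh => by simpa using h.2.1 hh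
    simp [Finset.erase_insert hkR]
  · rintro ⟨R, k⟩ h
    simp only [Finset.mem_sigma] at h
    simp [Finset.insert_erase h.2]
  · rintro ⟨k, R⟩ h
    simp only [Finset.mem_sigma, Finset.mem_compl, Finset.mem_powersetCard] at h
    have hkR : k ∉ R := fun hh => by simpa using h.2.1 hh
    simp [Finset.prod_insert hkR]

lemma weightStep_const_mul (lam : ι → ℝ) (c : ℝ) (θ : Finset ι → ℝ) :
    weightStep lam (fun S => c * θ S) = fun S => c * weightStep lam θ S := by
  funext S
  simp only [weightStep, Finset.mul_sum]
  exact Finset.sum_congr rfl fun _ _ => by ring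

lemma iterate_weightStep_one (lam : ι → ℝ) (m : ℕ) :
    (weightStep lam)^[m] (fun _ => 1) = fun S => m.factorial * esymmWeight lam m S := by
  induction m with
  | zero => funext S; simp [esymmWeight]
  | succ m ih =>
    rw [Function.iterate_succ_apply', ih, weightStep_const_mul]
    funext S
    rw [weightStep_esymmWeight, Nat.factorial_succ]
    push_cast
    ring

/-- The generating function of the elementary symmetric polynomials at `-1`. -/
lemma hasSum_esymmWeight (lam : ι → ℝ) (S : Finset ι) :
    HasSum (fun m : ℕ => (-1 : ℝ) ^ m * esymmWeight lam m S) (∏ k ∈ Sᶜ, (1 - lam k)) := by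
  have h1 : ∏ k ∈ Sᶜ, (1 - lam k) =
      ∑ m ∈ Finset.range (Sᶜ.card + 1), (-1 : ℝ) ^ m * esymmWeight lam m S := by
    simp_rw [sub_eq_add_neg]
    rw [Finset.prod_one_add, Finset.sum_powerset]
    refine Finset.sum_congr rfl fun m _ => ?_
    rw [esymmWeight, Finset.mul_sum]
    refine Finset.sum_congr rfl fun R hR => ?_
    rw [Finset.prod_neg, (Finset.mem_powersetCard.1 hR).2]
  rw [h1]
  refine hasSum_sum_of_ne_finset_zero fun m hm => ?_
  rw [esymmWeight, Finset.powersetCard_eq_empty.2 (by simpa using hm)]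
  simp

/-- With the weights that remain after integrating out all further points, the Cauchy–Binet sum is
again a Gram determinant, of rescaled functions; only injective `f` contribute. -/
lemma weightedGram_prod (v : ι → X → 𝕜) {lam : ι → ℝ} (hlam : ∀ k, lam k < 1) {n : ℕ}
    (x : Fin n → X) :
    weightedGram v (fun S => ∏ k ∈ Sᶜ, (1 - lam k)) x = ((∏ k, (1 - lam k) : ℝ) : 𝕜) *
      (gramMatrix (fun k y => (((√(1 - lam k))⁻¹ : ℝ) : 𝕜) * v k y) x).det := by
  rw [det_gramMatrix_eq_sum, weightedGram, Finset.mul_sum]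
  refine Finset.sum_congr rfl fun f _ => ?_
  by_cases hf : Function.Injective f
  swap
  · rw [cauchyBinetTerm_eq_zero _ _ hf, cauchyBinetTerm_eq_zero _ _ hf]; simp
  have h1 : (Matrix.of fun i j => (((√(1 - lam (f i)))⁻¹ : ℝ) : 𝕜) * v (f i) (x j)).det =
      (∏ i, (((√(1 - lam (f i)))⁻¹ : ℝ) : 𝕜)) * (Matrix.of fun i j => v (f i) (x j)).det :=
    Matrix.det_mul_column _ _
  have h2 : (∏ k, (1 - lam k)) =
      (∏ k ∈ (Finset.univ.image f)ᶜ, (1 - lam k)) * ∏ i, (1 - lam (f i)) := by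
    rw [← Finset.prod_compl_mul_prod (Finset.univ.image f), Finset.prod_image fun i _ j _ h => hf h]
  have h3 : (∏ i, (1 - lam (f i))) * ((∏ i, (√(1 - lam (f i)))⁻¹) * ∏ i, (√(1 - lam (f i)))⁻¹)
      = 1 := by
    rw [← Finset.prod_mul_distrib, ← Finset.prod_mul_distrib]
    refine Finset.prod_eq_one fun i _ => ?_
    have hpos : 0 < 1 - lam (f i) := by linarith [hlam (f i)]
    rw [← mul_inv, Real.mul_self_sqrt hpos.le, mul_inv_cancel₀ hpos.ne']
  have h4 : ((∏ k, (1 - lam k) : ℝ) : 𝕜) *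
      ((∏ i, (((√(1 - lam (f i)))⁻¹ : ℝ) : 𝕜)) * ∏ i, (((√(1 - lam (f i)))⁻¹ : ℝ) : 𝕜)) =
      ((∏ k ∈ (Finset.univ.image f)ᶜ, (1 - lam k) : ℝ) : 𝕜) := by
    rw [h2]
    have := congrArg (fun t : ℝ => (t : 𝕜)) h3
    simp only [RCLike.ofReal_mul, RCLike.ofReal_prod, RCLike.ofReal_one] at this ⊢
    rw [mul_assoc, this, mul_one]
  simp only [cauchyBinetTerm, h1, star_mul', Finset.prod_mul_distrib, RCLike.star_def,
    RCLike.conj_ofReal]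
  rw [← h4]
  ring

end Gram

/-! ### Integrating Gram determinants -/

section FiniteRank

open scoped Matrix

variable {𝕜 : Type*} [RCLike 𝕜] {X : Type*} [MeasurableSpace X]

lemma measurePreserving_fin_cons (ρ : Measure X) [SigmaFinite ρ] (n : ℕ) :
    MeasurePreserving (fun p : X × (Fin n → X) => (Fin.cons p.1 p.2 : Fin (n + 1) → X))
      (ρ.prod (Measure.pi fun _ => ρ)) (Measure.pi fun _ => ρ) := by
  have h := (measurePreserving_piFinSuccAbove (fun _ : Fin (n + 1) => ρ) 0).symm
  convert h using 1
  funext p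
  simp only [MeasurableEquiv.piFinSuccAbove, MeasurableEquiv.symm_mk, MeasurableEquiv.coe_mk,
    Fin.insertNthEquiv_zero, Equiv.symm_symm]
  rfl

lemma measurableEmbedding_fin_cons (n : ℕ) : MeasurableEmbedding
    (fun p : X × (Fin n → X) => (Fin.cons p.1 p.2 : Fin (n + 1) → X)) := by
  have h := (MeasurableEquiv.piFinSuccAbove (fun _ : Fin (n + 1) => X) 0).symm.measurableEmbedding
  convert h using 1
  funext p
  simp only [MeasurableEquiv.piFinSuccAbove, MeasurableEquiv.symm_mk, MeasurableEquiv.coe_mk,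
    Fin.insertNthEquiv_zero, Equiv.symm_symm]
  rfl

lemma integral_fin_cons {ρ : Measure X} [SigmaFinite ρ] {n : ℕ} {E : Type*} [NormedAddCommGroup E]
    [NormedSpace ℝ E] {F : (Fin (n + 1) → X) → E} (hF : Integrable F (Measure.pi fun _ => ρ)) :
    ∫ x, F x ∂(Measure.pi fun _ => ρ) =
      ∫ x, ∫ y, F (Fin.cons y x) ∂ρ ∂(Measure.pi fun _ : Fin n => ρ) := by
  rw [← (measurePreserving_fin_cons ρ n).integral_comp (measurableEmbedding_fin_cons n)]
  exact integral_prod_symm _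
    ((measurePreserving_fin_cons ρ n).integrable_comp_of_integrable hF)

lemma ae_pi_apply {ρ : Measure X} [SigmaFinite ρ] {n : ℕ} (i : Fin n) {p : X → Prop}
    (h : ∀ᵐ y ∂ρ, p y) : ∀ᵐ x ∂(Measure.pi fun _ : Fin n => ρ), p (x i) :=
  (Measure.tendsto_eval_ae_ae (μ := fun _ : Fin n => ρ) (i := i)).eventually h

variable {ρ : Measure X}

lemma integrable_mul_star {f g : X → 𝕜} (hf : MemLp f 2 ρ) (hg : MemLp g 2 ρ) :
    Integrable (fun y => f y * star (g y)) ρ :=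
  hf.integrable_mul hg.star

variable {ι : Type*} {v : ι → X → 𝕜}

lemma integral_cauchyBinetTerm_cons [DecidableEq ι] {lam : ι → ℝ} (hv : ∀ k, MemLp (v k) 2 ρ)
    (horth : ∀ k l, ∫ y, v k y * star (v l y) ∂ρ = if k = l then ((lam k : ℝ) : 𝕜) else 0)
    {n : ℕ} (k : ι) (f : Fin n → ι) (x : Fin n → X) :
    ∫ y, cauchyBinetTerm v (Fin.cons k f : Fin (n + 1) → ι) (Fin.cons y x) ∂ρ =
      if k ∈ Finset.univ.image f then 0 else ((lam k : ℝ) : 𝕜) * cauchyBinetTerm v f x := by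
  by_cases hk : k ∈ Finset.univ.image f
  · rw [if_pos hk]
    refine integral_eq_zero_of_ae (Eventually.of_forall fun y => ?_)
    refine cauchyBinetTerm_eq_zero _ _ fun hinj => ?_
    obtain ⟨j, -, hj⟩ := Finset.mem_image.1 hk
    exact (Fin.cons_injective_iff.1 hinj).1 ⟨j, hj⟩
  · rw [if_neg hk]
    simp_rw [cauchyBinetTerm_cons]
    rw [integral_finsetSum _ fun i _ => (integrable_mul_star (hv _) (hv _)).mul_const _]
    simp_rw [integral_mul_const, horth]
    rw [Fin.sum_univ_succ, Finset.sum_eq_zero, add_zero]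
    · simp [cauchyBinetTerm]
    · intro i _
      rw [if_neg, zero_mul]
      rw [Fin.cons_succ]
      exact fun h => hk (Finset.mem_image.2 ⟨i, Finset.mem_univ _, h⟩)

/-- A finite family in `L²` can be rotated into an orthogonal family with the same Gram kernel. The
squared norms of the new family are the eigenvalues of the matrix of inner products of the old
one. -/
lemma exists_orthogonal_gramMatrix_eq [Fintype ι] [DecidableEq ι] {f : ι → X → 𝕜} (hf : ∀ k, MemLp (f k) 2 ρ) {q : ℝ}
    (hq : ∀ c : ι → 𝕜, ∫ y, ‖∑ k, c k * f k y‖ ^ 2 ∂ρ ≤ q * ∑ k, ‖c k‖ ^ 2) :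
    ∃ (v : ι → X → 𝕜) (lam : ι → ℝ), (∀ k, MemLp (v k) 2 ρ) ∧
      (∀ k l, ∫ y, v k y * star (v l y) ∂ρ = if k = l then ((lam k : ℝ) : 𝕜) else 0) ∧
      (∀ k, lam k ≤ q) ∧
      ∀ {n : ℕ} (x : Fin n → X), gramMatrix v x = gramMatrix f x := by
  let G : Matrix ι ι 𝕜 := Matrix.of fun k l => ∫ y, f k y * star (f l y) ∂ρ
  have hG : G.IsHermitian := by
    ext k l
    simp only [G, Matrix.conjTranspose_apply, Matrix.of_apply]
    rw [RCLike.star_def, ← integral_conj]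
    simp [mul_comm]
  let U : Matrix ι ι 𝕜 := hG.eigenvectorUnitary
  have hU1 : U * Uᴴ = 1 := Matrix.mem_unitaryGroup_iff.1 hG.eigenvectorUnitary.2
  have hU2 : Uᴴ * U = 1 := Matrix.mem_unitaryGroup_iff'.1 hG.eigenvectorUnitary.2
  have hdiag : Uᴴ * G * U = Matrix.diagonal (fun k => ((hG.eigenvalues k : ℝ) : 𝕜)) := by
    have h := hG.spectral_theorem
    have h' : G = U * Matrix.diagonal (fun k => ((hG.eigenvalues k : ℝ) : 𝕜)) * Uᴴ := h
    calc Uᴴ * G * U = Uᴴ * (U * Matrix.diagonal (fun k => ((hG.eigenvalues k : ℝ) : 𝕜)) * Uᴴ) * U :=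
          congrArg (fun A => Uᴴ * A * U) h'
      _ = (Uᴴ * U) * Matrix.diagonal (fun k => ((hG.eigenvalues k : ℝ) : 𝕜)) * (Uᴴ * U) := by
          simp only [Matrix.mul_assoc]
      _ = _ := by rw [hU2, Matrix.one_mul, Matrix.mul_one]
  let v (a : ι) (y : X) : 𝕜 := ∑ k, star (U k a) * f k y
  have hv (a) : MemLp (v a) 2 ρ := memLp_finsetSum _ fun k _ => (hf k).const_mul _
  have horth (a b) : ∫ y, v a y * star (v b y) ∂ρ =
      if a = b then ((hG.eigenvalues a : ℝ) : 𝕜) else 0 := by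
    have h1 (y) : v a y * star (v b y) =
        ∑ k, ∑ l, star (U k a) * (f k y * star (f l y)) * U l b := by
      simp only [v, star_sum, Finset.sum_mul_sum, star_mul', star_star]
      exact Finset.sum_congr rfl fun _ _ => Finset.sum_congr rfl fun _ _ => by ring
    have hi (k l) : Integrable (fun y => star (U k a) * (f k y * star (f l y)) * U l b) ρ :=
      ((integrable_mul_star (hf k) (hf l)).const_mul _).mul_const _
    simp_rw [h1]
    rw [integral_finsetSum _ fun k _ => integrable_finsetSum _ fun l _ => hi k l]
    simp_rw [integral_finsetSum _ fun l _ => hi _ l, integral_mul_const, integral_const_mul]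
    have h2 := congrFun (congrFun hdiag a) b
    rw [Matrix.diagonal_apply] at h2
    rw [← h2, Matrix.mul_assoc, Matrix.mul_apply]
    refine Finset.sum_congr rfl fun k _ => ?_
    rw [Matrix.mul_apply, Finset.mul_sum, Matrix.conjTranspose_apply]
    exact Finset.sum_congr rfl fun l _ => by simp only [G, Matrix.of_apply]; ring
  have hnorm (a) : ∫ y, ‖v a y‖ ^ 2 ∂ρ = hG.eigenvalues a := by
    have h := horth a a
    rw [if_pos rfl] at h
    have h1 (y) : v a y * star (v a y) = ((‖v a y‖ ^ 2 : ℝ) : 𝕜) := by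
      rw [RCLike.star_def, RCLike.mul_conj, RCLike.ofReal_pow]
    simp_rw [h1] at h
    rw [integral_ofReal] at h
    exact_mod_cast h
  refine ⟨v, hG.eigenvalues, hv, horth, fun a => ?_, fun {n} x => ?_⟩
  · have h := hq fun k => star (U k a)
    have h1 : ∑ k, ‖star (U k a)‖ ^ 2 = 1 := by
      have h2 := congrFun (congrFun hU2 a) a
      rw [Matrix.mul_apply, Matrix.one_apply_eq] at h2
      have h3 : ((∑ k, ‖star (U k a)‖ ^ 2 : ℝ) : 𝕜) = 1 := by
        rw [← h2]
        push_cast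
        refine Finset.sum_congr rfl fun k _ => ?_
        rw [Matrix.conjTranspose_apply, norm_star, RCLike.star_def, RCLike.conj_mul]
      exact_mod_cast h3
    rw [h1, mul_one] at h
    rwa [← hnorm]
  · ext i j
    simp only [gramMatrix, Matrix.of_apply, v, star_sum, star_mul', star_star,
      Finset.sum_mul_sum]
    rw [Finset.sum_comm]
    refine Finset.sum_congr rfl fun k _ => ?_
    rw [Finset.sum_comm]
    have h1 (l : ι) : ∑ a, star (U k a) * f k (x i) * (U l a * star (f l (x j))) =
        (if l = k then 1 else 0) * (f k (x i) * star (f l (x j))) := by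
      have h2 := congrFun (congrFun hU1 l) k
      rw [Matrix.mul_apply, Matrix.one_apply] at h2
      rw [← h2, Finset.sum_mul]
      exact Finset.sum_congr rfl fun a _ => by rw [Matrix.conjTranspose_apply]; ring
    simp_rw [h1]
    simp

/-- Integrating out one variable replaces the weight `θ` by `weightStep lam θ`. -/
lemma integral_weightedGram_cons [Fintype ι] [DecidableEq ι] {lam : ι → ℝ} (hv : ∀ k, MemLp (v k) 2 ρ)
    (horth : ∀ k l, ∫ y, v k y * star (v l y) ∂ρ = if k = l then ((lam k : ℝ) : 𝕜) else 0)
    (θ : Finset ι → ℝ) {n : ℕ} (x : Fin n → X) :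
    ∫ y, weightedGram v θ (Fin.cons y x : Fin (n + 1) → X) ∂ρ =
      weightedGram v (weightStep lam θ) x := by
  have hint (k : ι) (f : Fin n → ι) : Integrable (fun y =>
      cauchyBinetTerm v (Fin.cons k f : Fin (n + 1) → ι) (Fin.cons y x)) ρ := by
    simp_rw [cauchyBinetTerm_cons]
    exact integrable_finsetSum _ fun i _ => (integrable_mul_star (hv _) (hv _)).mul_const _
  have himage (k : ι) (f : Fin n → ι) :
      Finset.univ.image (Fin.cons k f : Fin (n + 1) → ι) = insert k (Finset.univ.image f) := by
    ext j
    simp [Fin.exists_fin_succ, eq_comm]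
  have h1 (y : X) : weightedGram v θ (Fin.cons y x : Fin (n + 1) → X) =
      ∑ k, ∑ f : Fin n → ι, ((θ (insert k (Finset.univ.image f)) : ℝ) : 𝕜) *
        cauchyBinetTerm v (Fin.cons k f : Fin (n + 1) → ι) (Fin.cons y x) := by
    rw [weightedGram, ← (Fin.consEquiv fun _ => ι).sum_comp, Fintype.sum_prod_type]
    refine Finset.sum_congr rfl fun k _ => Finset.sum_congr rfl fun f _ => ?_
    rw [← himage]
    rfl
  simp_rw [h1]
  rw [integral_finsetSum _ fun k _ => integrable_finsetSum _ fun f _ => (hint k f).const_mul _]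
  simp_rw [integral_finsetSum _ fun f _ => (hint _ f).const_mul _, integral_const_mul,
    integral_cauchyBinetTerm_cons hv horth]
  rw [Finset.sum_comm, weightedGram]
  refine Finset.sum_congr rfl fun f _ => ?_
  simp only [weightStep, mul_ite, mul_zero]
  rw [← Finset.sum_compl_add_sum (Finset.univ.image f),
    Finset.sum_eq_zero (s := Finset.univ.image f) fun k hk => if_pos hk, add_zero]
  push_cast
  rw [Finset.sum_mul]
  refine Finset.sum_congr rfl fun k hk => ?_
  rw [if_neg (Finset.mem_compl.1 hk)]
  ring

variable [SigmaFinite ρ]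

lemma integrable_cauchyBinetTerm (hv : ∀ k, MemLp (v k) 2 ρ) {n : ℕ} (f : Fin n → ι) :
    Integrable (cauchyBinetTerm v f) (Measure.pi fun _ => ρ) := by
  have h1 : cauchyBinetTerm v f = fun x => ∑ σ : Equiv.Perm (Fin n),
      ((Equiv.Perm.sign σ : ℤ) : 𝕜) * ∏ i, (v (f (σ i)) (x i) * star (v (f i) (x i))) := by
    funext x
    rw [cauchyBinetTerm, Matrix.det_apply', Finset.mul_sum]
    refine Finset.sum_congr rfl fun σ _ => ?_
    rw [Finset.prod_mul_distrib]
    simp only [Matrix.of_apply]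
    ring
  rw [h1]
  refine integrable_finsetSum _ fun σ _ => Integrable.const_mul ?_ _
  exact Integrable.fintype_prod (f := fun i y => v (f (σ i)) y * star (v (f i) y))
    fun i => integrable_mul_star (hv _) (hv _)

lemma integrable_bdd_mul_cauchyBinetTerm (hv : ∀ k, MemLp (v k) 2 ρ) {n : ℕ} (f : Fin n → ι)
    {g : (Fin n → X) → ℝ} (hg : Measurable g) {M : ℝ} (hM : ∀ x, |g x| ≤ M) :
    Integrable (fun x => ((g x : ℝ) : 𝕜) * cauchyBinetTerm v f x) (Measure.pi fun _ => ρ) := by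
  refine (integrable_cauchyBinetTerm hv f).bdd_mul
    (RCLike.measurable_ofReal.comp hg).aestronglyMeasurable (c := M) ?_
  exact Eventually.of_forall fun x => by simpa using hM x

variable [Fintype ι] [DecidableEq ι] {lam : ι → ℝ}

lemma integrable_bdd_mul_weightedGram (hv : ∀ k, MemLp (v k) 2 ρ) (θ : Finset ι → ℝ) {n : ℕ}
    {g : (Fin n → X) → ℝ} (hg : Measurable g) {M : ℝ} (hM : ∀ x, |g x| ≤ M) :
    Integrable (fun x => ((g x : ℝ) : 𝕜) * weightedGram v θ x) (Measure.pi fun _ => ρ) := by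
  simp only [weightedGram, Finset.mul_sum]
  refine integrable_finsetSum _ fun f _ => ?_
  have := (integrable_bdd_mul_cauchyBinetTerm hv f hg hM).const_mul
    ((θ (Finset.univ.image f) : ℝ) : 𝕜)
  refine this.congr (Eventually.of_forall fun x => ?_)
  simp only
  ring

lemma integral_bdd_mul_weightedGram (hv : ∀ k, MemLp (v k) 2 ρ) (θ : Finset ι → ℝ) {n : ℕ}
    {g : (Fin n → X) → ℝ} (hg : Measurable g) {M : ℝ} (hM : ∀ x, |g x| ≤ M) :
    ∫ x, ((g x : ℝ) : 𝕜) * weightedGram v θ x ∂(Measure.pi fun _ => ρ) =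
      ∑ f : Fin n → ι, ((θ (Finset.univ.image f) : ℝ) : 𝕜) *
        ∫ x, ((g x : ℝ) : 𝕜) * cauchyBinetTerm v f x ∂(Measure.pi fun _ => ρ) := by
  simp only [weightedGram, Finset.mul_sum]
  rw [integral_finsetSum]
  · refine Finset.sum_congr rfl fun f _ => ?_
    rw [← integral_const_mul]
    refine integral_congr_ae (Eventually.of_forall fun x => ?_)
    simp only
    ring
  · intro f _
    have := (integrable_bdd_mul_cauchyBinetTerm hv f hg hM).const_mul
      ((θ (Finset.univ.image f) : ℝ) : 𝕜)
    refine this.congr (Eventually.of_forall fun x => ?_)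
    simp only
    ring

/-- Integrating out `m` variables. Here `ρ` is carried by `B`, so that the indicator functions in
`extendTuple` equal `1`. -/
lemma integral_extendTuple_weightedGram (hv : ∀ k, MemLp (v k) 2 ρ)
    (horth : ∀ k l, ∫ y, v k y * star (v l y) ∂ρ = if k = l then ((lam k : ℝ) : 𝕜) else 0)
    {B : Set X} (hB : MeasurableSet B) (hρ : ∀ᵐ y ∂ρ, y ∈ B) {n : ℕ} {g : (Fin n → X) → ℝ≥0∞}
    (hg : Measurable g) {M : ℝ≥0} (hM : ∀ x, g x ≤ M) (m : ℕ) (θ : Finset ι → ℝ) :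
    ∫ x, (((extendTuple B g m x).toReal : ℝ) : 𝕜) * weightedGram v θ x ∂(Measure.pi fun _ => ρ) =
      ∫ x, (((g x).toReal : ℝ) : 𝕜) * weightedGram v ((weightStep lam)^[m] θ) x
        ∂(Measure.pi fun _ => ρ) := by
  induction m generalizing θ with
  | zero => rfl
  | succ m ih =>
    rw [Function.iterate_succ_apply, ← ih]
    have hext := measurable_extendTuple hB hg
    have hb (m : ℕ) (x) : |(extendTuple B g m x).toReal| ≤ M := by
      rw [abs_of_nonneg ENNReal.toReal_nonneg]
      exact ENNReal.toReal_le_coe_of_le_coe (extendTuple_le hM m x)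
    have h1 : ∫ x, (((extendTuple B g (m + 1) x).toReal : ℝ) : 𝕜) * weightedGram v θ x
        ∂(Measure.pi fun _ => ρ) = ∫ x : Fin (n + m + 1) → X,
          (((extendTuple B g m (Fin.tail x)).toReal : ℝ) : 𝕜) * weightedGram v θ x
        ∂(Measure.pi fun _ => ρ) := by
      refine integral_congr_ae ?_
      filter_upwards [ae_pi_apply (ρ := ρ) (0 : Fin (n + m + 1)) hρ] with x hx
      have : extendTuple B g (m + 1) x = extendTuple B g m (Fin.tail x) := by
        simp only [extendTuple]
        rw [Set.indicator_of_mem (show x 0 ∈ B from hx), Pi.one_apply, one_mul]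
      simp only [this]
    have hi : Integrable (fun x : Fin (n + m + 1) → X =>
        (((extendTuple B g m (Fin.tail x)).toReal : ℝ) : 𝕜) * weightedGram v θ x)
        (Measure.pi fun _ => ρ) :=
      integrable_bdd_mul_weightedGram hv θ
        ((hext m).comp measurable_fin_tail).ennreal_toReal (M := M) fun x => hb m _
    rw [h1, integral_fin_cons hi]
    refine integral_congr_ae (Eventually.of_forall fun x => ?_)
    simp only [Fin.tail_cons]
    rw [integral_const_mul, integral_weightedGram_cons hv horth]

/-- The Janossy series of a Gram kernel of finite rank. If `K` has the eigenvalues `lam k` with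
eigenfunctions `v k`, the sum is `det(1 - K)` times the integral against the determinant of the
kernel of `K (1 - K)⁻¹`. -/
lemma hasSum_integral_gramMatrix (hv : ∀ k, MemLp (v k) 2 ρ)
    (horth : ∀ k l, ∫ y, v k y * star (v l y) ∂ρ = if k = l then ((lam k : ℝ) : 𝕜) else 0)
    (hlam : ∀ k, lam k < 1)
    {B : Set X} (hB : MeasurableSet B) (hρ : ∀ᵐ y ∂ρ, y ∈ B) {n : ℕ} {g : (Fin n → X) → ℝ≥0∞}
    (hg : Measurable g) {M : ℝ≥0} (hM : ∀ x, g x ≤ M) :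
    HasSum (fun m : ℕ => (-1 : ℝ) ^ m / m.factorial * ∫ x, (extendTuple B g m x).toReal *
        RCLike.re (gramMatrix v x).det ∂(Measure.pi fun _ => ρ))
      ((∏ k, (1 - lam k)) * ∫ x, (g x).toReal * RCLike.re (gramMatrix
        (fun k y => (((√(1 - lam k))⁻¹ : ℝ) : 𝕜) * v k y) x).det ∂(Measure.pi fun _ => ρ)) := by
  let a (f : Fin n → ι) : ℝ := RCLike.re
    (∫ x, (((g x).toReal : ℝ) : 𝕜) * cauchyBinetTerm v f x ∂(Measure.pi fun _ => ρ))
  have hext := measurable_extendTuple hB hg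
  have hb (m : ℕ) (x) : |(extendTuple B g m x).toReal| ≤ M := by
    rw [abs_of_nonneg ENNReal.toReal_nonneg]
    exact ENNReal.toReal_le_coe_of_le_coe (extendTuple_le hM m x)
  have hre (θ : Finset ι → ℝ) : RCLike.re (∫ x, (((g x).toReal : ℝ) : 𝕜) * weightedGram v θ x
      ∂(Measure.pi fun _ => ρ)) = ∑ f : Fin n → ι, θ (Finset.univ.image f) * a f := by
    rw [integral_bdd_mul_weightedGram hv θ hg.ennreal_toReal (M := M) (hb 0), map_sum]
    simp only [RCLike.re_ofReal_mul, a]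
  have h1 (m : ℕ) : (-1 : ℝ) ^ m / m.factorial * ∫ x, (extendTuple B g m x).toReal *
      RCLike.re (gramMatrix v x).det ∂(Measure.pi fun _ => ρ) =
      ∑ f : Fin n → ι, ((-1 : ℝ) ^ m * esymmWeight lam m (Finset.univ.image f)) * a f := by
    have h2 : ∫ x, (extendTuple B g m x).toReal * RCLike.re (gramMatrix v x).det
        ∂(Measure.pi fun _ => ρ) = RCLike.re (∫ x, (((extendTuple B g m x).toReal : ℝ) : 𝕜) *
          weightedGram v (fun _ => 1) x ∂(Measure.pi fun _ => ρ)) := by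
      rw [← integral_re (integrable_bdd_mul_weightedGram hv _ (hext m).ennreal_toReal (M := M)
        (hb m))]
      simp only [RCLike.re_ofReal_mul, weightedGram_one]
    rw [h2, integral_extendTuple_weightedGram hv horth hB hρ hg hM, iterate_weightStep_one, hre,
      Finset.mul_sum]
    refine Finset.sum_congr rfl fun f _ => ?_
    have : (m.factorial : ℝ) ≠ 0 := by positivity
    field_simp
  simp_rw [h1]
  have h3 := hasSum_sum (s := Finset.univ) fun (f : Fin n → ι) _ =>
    (hasSum_esymmWeight lam (Finset.univ.image f)).mul_right (a f)
  have h4 : (∏ k, (1 - lam k)) * ∫ x, (g x).toReal * RCLike.re (gramMatrix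
        (fun k y => (((√(1 - lam k))⁻¹ : ℝ) : 𝕜) * v k y) x).det ∂(Measure.pi fun _ => ρ) =
      ∑ f : Fin n → ι, (∏ k ∈ (Finset.univ.image f)ᶜ, (1 - lam k)) * a f := by
    rw [← hre (fun S => ∏ k ∈ Sᶜ, (1 - lam k)), ← integral_const_mul, ← integral_re
      (integrable_bdd_mul_weightedGram hv _ hg.ennreal_toReal (M := M) (hb 0))]
    refine integral_congr_ae (Eventually.of_forall fun x => ?_)
    simp only
    rw [weightedGram_prod v hlam, RCLike.re_ofReal_mul, RCLike.re_ofReal_mul]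
    ring
  rw [h4]
  exact h3

/-- Adding a point in `Λ`: by Fischer's inequality this costs at most a factor
`∫_Λ ∑ₖ |vₖ|² dρ`. -/
lemma integral_cons_gramMatrix_le (hv : ∀ k, MemLp (v k) 2 ρ) {Λ : Set X} (hΛ : MeasurableSet Λ)
    {n : ℕ} {g : (Fin n → X) → ℝ≥0∞} (hg : Measurable g) {M : ℝ≥0} (hM : ∀ x, g x ≤ M) :
    ∫ x : Fin (n + 1) → X, (Λ.indicator 1 (x 0) * g (Fin.tail x)).toReal *
        RCLike.re (gramMatrix v x).det ∂(Measure.pi fun _ => ρ) ≤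
      (∫ y in Λ, ∑ k, ‖v k y‖ ^ 2 ∂ρ) *
        ∫ x, (g x).toReal * RCLike.re (gramMatrix v x).det ∂(Measure.pi fun _ => ρ) := by
  have hb (x) : |(g x).toReal| ≤ M := by
    rw [abs_of_nonneg ENNReal.toReal_nonneg]
    exact ENNReal.toReal_le_coe_of_le_coe (hM x)
  have hint {n : ℕ} {h : (Fin n → X) → ℝ} (hh : Measurable h) (hM : ∀ x, |h x| ≤ M) :
      Integrable (fun x => h x * RCLike.re (gramMatrix v x).det) (Measure.pi fun _ => ρ) := by
    have := (integrable_bdd_mul_weightedGram hv (fun _ => 1) hh hM).re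
    simpa only [RCLike.re_ofReal_mul, weightedGram_one] using this
  have hm : Measurable fun x : Fin (n + 1) → X => (Λ.indicator 1 (x 0) * g (Fin.tail x)).toReal :=
    (((measurable_one.indicator hΛ).comp (measurable_pi_apply 0)).mul
      (hg.comp measurable_fin_tail)).ennreal_toReal
  have hle (y : X) : (Λ.indicator 1 y : ℝ≥0∞) ≤ 1 := Set.indicator_le_self _ _ y
  have hI1 := hint hm fun x => by
    rw [abs_of_nonneg ENNReal.toReal_nonneg]
    refine ENNReal.toReal_le_coe_of_le_coe ?_
    calc Λ.indicator 1 (x 0) * g (Fin.tail x) ≤ 1 * M := mul_le_mul' (hle _) (hM _)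
      _ = M := one_mul _
  have hI2 := hint hg.ennreal_toReal hb
  have hsq : Integrable (fun y => ∑ k, ‖v k y‖ ^ 2) ρ :=
    integrable_finsetSum _ fun k _ => (hv k).integrable_norm_pow (by norm_num)
  have hsqΛ : Integrable (Λ.indicator fun y => ∑ k, ‖v k y‖ ^ 2) ρ := hsq.indicator hΛ
  rw [← (measurePreserving_fin_cons ρ n).integral_comp (measurableEmbedding_fin_cons n),
    ← integral_indicator hΛ, ← integral_prod_mul]
  refine integral_mono ((measurePreserving_fin_cons ρ n).integrable_comp_of_integrable hI1)
    (hsqΛ.mul_prod hI2) fun p => ?_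
  simp only [Fin.cons_zero, Fin.tail_cons]
  by_cases hp : p.1 ∈ Λ
  · rw [Set.indicator_of_mem hp, Set.indicator_of_mem hp, Pi.one_apply, one_mul]
    calc (g p.2).toReal * RCLike.re (gramMatrix v (Fin.cons p.1 p.2 : Fin (n + 1) → X)).det
        ≤ (g p.2).toReal * ((∑ k, ‖v k p.1‖ ^ 2) * RCLike.re (gramMatrix v p.2).det) :=
          mul_le_mul_of_nonneg_left (re_det_gramMatrix_cons_le v _ _) ENNReal.toReal_nonneg
      _ = _ := by ring
  · rw [Set.indicator_of_notMem hp, Set.indicator_of_notMem hp]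
    simp

end FiniteRank

/-! ### The operator `K` and its square root -/

section Hilbert

variable {𝕜 : Type*} [RCLike 𝕜] {H : Type*} [NormedAddCommGroup H] [InnerProductSpace 𝕜 H]

lemma countable_of_orthonormal [SecondCountableTopology H] {ι : Type*} {b : ι → H}
    (hb : Orthonormal 𝕜 b) : Countable ι := by
  have hd {i j : ι} (hij : i ≠ j) : 1 ≤ dist (b i) (b j) := by
    have h := @norm_sub_sq 𝕜 H _ _ _ (b i) (b j)
    rw [hb.2 hij, hb.1, hb.1] at h
    rw [dist_eq_norm]
    simp only [map_zero, mul_zero] at h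
    nlinarith [norm_nonneg (b i - b j)]
  have h := Set.PairwiseDisjoint.countable_of_isOpen (a := Set.univ)
    (s := fun i => Metric.ball (b i) (1 / 2)) (fun i _ j _ hij => by
      refine Metric.ball_disjoint_ball ?_
      have := hd hij
      linarith) (fun _ _ => Metric.isOpen_ball)
    (fun i _ => ⟨b i, Metric.mem_ball_self (by norm_num)⟩)
  exact Set.countable_univ_iff.1 h

open ContinuousLinearMap in
/-- A positive invertible operator is bounded below by a positive constant. -/
lemma exists_pos_le_re_inner_of_isUnit {T : H →L[𝕜] H} (hT : 0 ≤ T) (hu : IsUnit T) :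
    ∃ c > 0, ∀ f, c * ‖f‖ ^ 2 ≤ RCLike.re (inner 𝕜 f (T f)) := by
  rw [nonneg_iff_isPositive] at hT
  obtain ⟨U, rfl⟩ := hu
  set T : H →L[𝕜] H := (U : H →L[𝕜] H)
  set R : H →L[𝕜] H := ((U⁻¹ : (H →L[𝕜] H)ˣ) : H →L[𝕜] H)
  set M := ‖T‖ + 1
  set C := ‖R‖ + 1
  have hM : 0 < M := by positivity
  have hC : 0 < C := by positivity
  refine ⟨(M * C ^ 2)⁻¹, by positivity, fun f => ?_⟩
  have h1 : ‖f‖ ≤ C * ‖T f‖ := by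
    have : R (T f) = f := by
      have h : R * T = 1 := U.inv_mul
      exact congrArg (fun A : H →L[𝕜] H => A f) h
    calc ‖f‖ = ‖R (T f)‖ := by rw [this]
      _ ≤ ‖R‖ * ‖T f‖ := R.le_opNorm _
      _ ≤ C * ‖T f‖ := by gcongr; simp [C]
  -- `‖T f‖² ≤ M ⟨f, T f⟩`, from `⟨h, T h⟩ ≥ 0` for `h = f - M⁻¹ T f`
  have h2 : ‖T f‖ ^ 2 ≤ M * RCLike.re (inner 𝕜 f (T f)) := by
    have h := hT.re_inner_nonneg_right (f - ((M⁻¹ : ℝ) : 𝕜) • T f)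
    simp only [map_sub, map_smul, inner_sub_left, inner_sub_right, inner_smul_left,
      inner_smul_right, RCLike.conj_ofReal, RCLike.re_ofReal_mul] at h
    rw [← hT.inner_left_eq_inner_right f (T f), inner_self_eq_norm_sq] at h
    have h3 : RCLike.re (inner 𝕜 (T f) (T (T f))) ≤ M * ‖T f‖ ^ 2 := by
      calc _ ≤ ‖T f‖ * ‖T (T f)‖ := re_inner_le_norm _ _
        _ ≤ ‖T f‖ * (‖T‖ * ‖T f‖) := by gcongr; exact T.le_opNorm _
        _ ≤ ‖T f‖ * (M * ‖T f‖) := by gcongr; simp [M]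
        _ = _ := by ring
    have h4 : M⁻¹ * (M⁻¹ * RCLike.re (inner 𝕜 (T f) (T (T f)))) ≤ M⁻¹ * ‖T f‖ ^ 2 := by
      have : M⁻¹ * RCLike.re (inner 𝕜 (T f) (T (T f))) ≤ ‖T f‖ ^ 2 := by
        rw [inv_mul_le_iff₀ hM]; exact h3
      gcongr
    have h5 : M⁻¹ * ‖T f‖ ^ 2 ≤ RCLike.re (inner 𝕜 f (T f)) := by linarith
    rwa [inv_mul_le_iff₀ hM] at h5
  rw [inv_mul_le_iff₀ (by positivity)]
  calc ‖f‖ ^ 2 ≤ (C * ‖T f‖) ^ 2 := by gcongr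
    _ = C ^ 2 * ‖T f‖ ^ 2 := by ring
    _ ≤ C ^ 2 * (M * RCLike.re (inner 𝕜 f (T f))) := by gcongr
    _ = _ := by ring

open ContinuousLinearMap in
/-- If `0 ≤ S`, `S² = K ≤ 1` and `1` is not in the spectrum of `K`, then `S` is a strict
contraction. -/
lemma exists_lt_one_norm_sq_le {K S : H →L[𝕜] H} (hS : 0 ≤ S) (hSK : S ∘L S = K) (hK : K ≤ 1)
    (h1 : (1 : 𝕜) ∉ spectrum 𝕜 K) : ∃ q < 1, ∀ f, ‖S f‖ ^ 2 ≤ q * ‖f‖ ^ 2 := by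
  rw [spectrum.notMem_iff, map_one] at h1
  obtain ⟨c, hc, h⟩ := exists_pos_le_re_inner_of_isUnit
    ((nonneg_iff_isPositive _).2 ((le_def _ _).1 hK)) h1
  refine ⟨1 - c, by linarith, fun f => ?_⟩
  have h2 := h f
  have h3 : RCLike.re (inner 𝕜 f (K f)) = ‖S f‖ ^ 2 := by
    rw [← hSK, comp_apply, ← ((nonneg_iff_isPositive _).1 hS).inner_left_eq_inner_right,
      inner_self_eq_norm_sq]
  rw [sub_apply, show (1 : H →L[𝕜] H) f = f from rfl, inner_sub_right, map_sub, h3, inner_self_eq_norm_sq] at h2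
  linarith

/-- Parseval's identity with values in `[0, ∞]`. -/
lemma tsum_enorm_inner_sq {ι : Type*} (b : HilbertBasis ι 𝕜 H) (f : H) :
    ∑' i, ‖inner 𝕜 (b i) f‖ₑ ^ 2 = ‖f‖ₑ ^ 2 := by
  have h := b.hasSum_inner_mul_inner f f
  have h1 (i) : inner 𝕜 f (b i) * inner 𝕜 (b i) f = ((‖inner 𝕜 (b i) f‖ ^ 2 : ℝ) : 𝕜) := by
    rw [← inner_conj_symm, RCLike.conj_mul, RCLike.ofReal_pow]
  simp_rw [h1] at h
  rw [inner_self_eq_norm_sq_to_K, ← RCLike.ofReal_pow, RCLike.hasSum_ofReal] at h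
  have h2 (x : ℝ) (hx : 0 ≤ x) : ENNReal.ofReal (x ^ 2) = ENNReal.ofReal x ^ 2 :=
    ENNReal.ofReal_pow hx 2
  have h3 := ENNReal.ofReal_tsum_of_nonneg (fun i => by positivity) h.summable
  rw [h.tsum_eq, h2 _ (norm_nonneg _)] at h3
  simp_rw [h2 _ (norm_nonneg _), ofReal_norm] at h3
  exact h3.symm

end Hilbert

section LocalTrace

variable {𝕜 : Type*} [RCLike 𝕜] {X : Type*} [MeasurableSpace X] {ν : Measure X}

lemma coeFn_mulIndicatorL2 {Λ : Set X} (hΛ : MeasurableSet Λ) (f : Lp 𝕜 2 ν) :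
    mulIndicatorL2 𝕜 ν hΛ f =ᵐ[ν] Λ.indicator f :=
  ((Lp.memLp f).indicator hΛ).coeFn_toLp

lemma inner_mulIndicatorL2_left {Λ : Set X} (hΛ : MeasurableSet Λ) (f g : Lp 𝕜 2 ν) :
    inner 𝕜 (mulIndicatorL2 𝕜 ν hΛ f) g = inner 𝕜 f (mulIndicatorL2 𝕜 ν hΛ g) := by
  rw [L2.inner_def, L2.inner_def]
  refine integral_congr_ae ?_
  filter_upwards [coeFn_mulIndicatorL2 hΛ f, coeFn_mulIndicatorL2 hΛ g] with x h1 h2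
  rw [h1, h2]
  by_cases h : x ∈ Λ <;> simp [h]

lemma enorm_sq_eq_lintegral (f : Lp 𝕜 2 ν) : ‖f‖ₑ ^ 2 = ∫⁻ x, ‖f x‖ₑ ^ 2 ∂ν := by
  rw [Lp.enorm_def, eLpNorm_eq_lintegral_rpow_enorm_toReal (by norm_num) (by norm_num)]
  rw [← ENNReal.rpow_natCast, ← ENNReal.rpow_mul]
  norm_num

lemma enorm_mulIndicatorL2_sq {Λ : Set X} (hΛ : MeasurableSet Λ) (f : Lp 𝕜 2 ν) :
    ‖mulIndicatorL2 𝕜 ν hΛ f‖ₑ ^ 2 = ∫⁻ x in Λ, ‖f x‖ₑ ^ 2 ∂ν := by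
  rw [enorm_sq_eq_lintegral, ← lintegral_indicator hΛ]
  refine lintegral_congr_ae ?_
  filter_upwards [coeFn_mulIndicatorL2 hΛ f] with x hx
  rw [hx]
  by_cases h : x ∈ Λ <;> simp [h]

open ContinuousLinearMap in
/-- The trace of `P_Λ S² P_Λ` is `∫_Λ ∑ₖ |S bₖ|² dν`. -/
lemma tsum_setLIntegral_ne_top {S : Lp 𝕜 2 ν →L[𝕜] Lp 𝕜 2 ν} (hS : 0 ≤ S)
    {w : Set (Lp 𝕜 2 ν)} (b : HilbertBasis w 𝕜 (Lp 𝕜 2 ν)) {Λ : Set X} (hΛ : MeasurableSet Λ)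
    (h : HasFiniteTrace (mulIndicatorL2 𝕜 ν hΛ ∘L (S ∘L S) ∘L mulIndicatorL2 𝕜 ν hΛ)) :
    ∑' k, ∫⁻ x in Λ, ‖S (b k) x‖ₑ ^ 2 ∂ν ≠ ∞ := by
  have hS' := (nonneg_iff_isPositive _).1 hS
  set P := mulIndicatorL2 𝕜 ν hΛ
  have h1 (k l) : ‖inner 𝕜 (b l) (P (S (b k)))‖ₑ = ‖inner 𝕜 (b k) (S (P (b l)))‖ₑ := by
    rw [← inner_mulIndicatorL2_left, ← hS'.inner_left_eq_inner_right, ← inner_conj_symm,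
      RCLike.enorm_conj]
  have h2 (l) : ENNReal.ofReal (RCLike.re (inner 𝕜 (b l) ((P ∘L (S ∘L S) ∘L P) (b l)))) =
      ‖S (P (b l))‖ₑ ^ 2 := by
    simp only [comp_apply]
    rw [← inner_mulIndicatorL2_left, ← hS'.inner_left_eq_inner_right, inner_self_eq_norm_sq,
      ENNReal.ofReal_pow (norm_nonneg _), ofReal_norm]
  calc ∑' k, ∫⁻ x in Λ, ‖S (b k) x‖ₑ ^ 2 ∂ν = ∑' k, ∑' l, ‖inner 𝕜 (b l) (P (S (b k)))‖ₑ ^ 2 := by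
        simp_rw [tsum_enorm_inner_sq, P, enorm_mulIndicatorL2_sq]
    _ = ∑' l, ∑' k, ‖inner 𝕜 (b k) (S (P (b l)))‖ₑ ^ 2 := by
        rw [ENNReal.tsum_comm]
        simp_rw [h1]
    _ = ∑' l, ENNReal.ofReal (RCLike.re (inner 𝕜 (b l) ((P ∘L (S ∘L S) ∘L P) (b l)))) := by
        simp_rw [tsum_enorm_inner_sq, h2]
    _ ≠ ∞ := (h w b).tsum_ofReal_ne_top

end LocalTrace

/-! ### The kernel of `√K` -/

section Kernel

variable {𝕜 : Type*} [RCLike 𝕜] {X : Type*} [MeasurableSpace X] {ν : Measure X}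

/-- A countable family of sets of finite measure that covers the space and detects whether a
function, integrable on each of its members, vanishes almost everywhere. -/
structure IsTestFamily (𝕜 : Type*) [RCLike 𝕜] (ν : Measure X) (T : Set (Set X)) : Prop where
  countable : T.Countable
  measurableSet : ∀ t ∈ T, MeasurableSet t
  measure_ne_top : ∀ t ∈ T, ν t ≠ ∞
  sUnion_eq : ⋃₀ T = Set.univ
  ae_eq_zero : ∀ u : X → 𝕜, (∀ t ∈ T, IntegrableOn u t ν) → (∀ t ∈ T, ∫ x in t, u x ∂ν = 0) →
    u =ᵐ[ν] 0

lemma IsTestFamily.ae_of_forall_ae_restrict {T : Set (Set X)} (hT : IsTestFamily 𝕜 ν T)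
    {p : X → Prop} (h : ∀ t ∈ T, ∀ᵐ x ∂(ν.restrict t), p x) : ∀ᵐ x ∂ν, p x := by
  rw [← Measure.restrict_univ (μ := ν), ← hT.sUnion_eq, Set.sUnion_eq_biUnion,
    ae_restrict_biUnion_iff _ hT.countable]
  exact h

lemma exists_isTestFamily [MeasurableSpace.CountablyGenerated X] (𝕜 : Type*) [RCLike 𝕜]
    (ν : Measure X) {B : ℕ → Set X} (hB : ∀ n, MeasurableSet (B n)) (hfin : ∀ n, ν (B n) ≠ ∞)
    (hcover : ⋃ n, B n = Set.univ) :
    ∃ T : Set (Set X), IsTestFamily 𝕜 ν T ∧ ∀ t ∈ T, ∃ n, t ⊆ B n := by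
  let 𝒜 := generateSetAlgebra (MeasurableSpace.countableGeneratingSet X)
  have halg : IsSetAlgebra 𝒜 := isSetAlgebra_generateSetAlgebra
  have hgen : ‹MeasurableSpace X› = MeasurableSpace.generateFrom 𝒜 := by
    rw [generateFrom_generateSetAlgebra_eq, MeasurableSpace.generateFrom_countableGeneratingSet]
  have hm (A) (hA : A ∈ 𝒜) : MeasurableSet A := by
    rw [hgen]; exact MeasurableSpace.measurableSet_generateFrom hA
  refine ⟨Set.image2 (fun A n => A ∩ B n) 𝒜 Set.univ,
    ⟨(countable_generateSetAlgebra MeasurableSpace.countable_countableGeneratingSet).image2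
      Set.countable_univ _, ?_, ?_, ?_, fun u hint h0 => ?_⟩, ?_⟩
  · rintro _ ⟨A, hA, n, -, rfl⟩
    exact (hm A hA).inter (hB n)
  · rintro _ ⟨A, -, n, -, rfl⟩
    exact measure_ne_top_of_subset Set.inter_subset_right (hfin n)
  · rw [← Set.univ_subset_iff, ← hcover]
    refine Set.iUnion_subset fun n => Set.subset_sUnion_of_mem ?_
    exact ⟨Set.univ, halg.univ_mem, n, Set.mem_univ n, Set.univ_inter _⟩
  rotate_left
  · rintro _ ⟨A, -, n, -, rfl⟩
    exact ⟨n, Set.inter_subset_right⟩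
  rw [← Measure.restrict_univ (μ := ν), ← hcover, EventuallyEq, ae_restrict_iUnion_iff]
  intro n
  have hi : IntegrableOn u (B n) ν := by
    have := hint _ (Set.mem_image2_of_mem halg.univ_mem (Set.mem_univ n))
    rwa [Set.univ_inter] at this
  have hzero (A) (hA : A ∈ 𝒜) : ∫ x in A, u x ∂(ν.restrict (B n)) = 0 := by
    rw [Measure.restrict_restrict (hm A hA)]
    exact h0 _ (Set.mem_image2_of_mem hA (Set.mem_univ n))
  suffices h : ∀ s, MeasurableSet s → ∫ x in s, u x ∂(ν.restrict (B n)) = 0 from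
    Integrable.ae_eq_zero_of_forall_setIntegral_eq_zero hi fun s hs _ => h s hs
  intro s hs
  induction s, hs using MeasurableSpace.induction_on_inter hgen
    halg.isSetRing.isSetSemiring.isPiSystem with
  | empty => simp
  | basic A hA => exact hzero A hA
  | compl A hA ih =>
    have h1 := setIntegral_compl hA hi
    rw [← setIntegral_univ (μ := ν.restrict (B n)), hzero _ halg.univ_mem, ih, sub_zero] at h1
    exact h1
  | iUnion A hd hA ih =>
    rw [integral_iUnion hA hd hi.integrableOn]
    simp [ih]

/-- A square-summable family is the family of coefficients of some vector. -/
lemma exists_inner_eq {H : Type*} [NormedAddCommGroup H] [InnerProductSpace 𝕜 H]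
    [CompleteSpace H] {ι : Type*} (b : HilbertBasis ι 𝕜 H) {a : ι → 𝕜}
    (ha : ∑' i, ‖a i‖ₑ ^ 2 ≠ ∞) : ∃ h : H, ∀ i, inner 𝕜 h (b i) = a i := by
  have hmem : Memℓp (fun i => star (a i)) 2 := by
    refine memℓp_gen ?_
    have h := ENNReal.summable_toReal ha
    simpa using h
  refine ⟨b.repr.symm ⟨_, hmem⟩, fun i => ?_⟩
  rw [← inner_conj_symm, ← b.repr_apply_apply, LinearIsometryEquiv.apply_symm_apply]
  simp

variable {w : Set (Lp 𝕜 2 ν)} (b : HilbertBasis w 𝕜 (Lp 𝕜 2 ν))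
  (S : Lp 𝕜 2 ν →L[𝕜] Lp 𝕜 2 ν)

/-- If `S bₖ(x) = ⟨h, bₖ⟩` for all `k`, then `h` represents the functional `f ↦ S f(x)`. -/
lemma ae_apply_eq_inner [Countable w] (f : Lp 𝕜 2 ν) :
    ∀ᵐ x ∂ν, ∀ h : Lp 𝕜 2 ν, (∀ k, inner 𝕜 h (b k) = S (b k) x) → S f x = inner 𝕜 h f := by
  have h1 : HasSum (fun k => inner 𝕜 (b k) f • S (b k)) (S f) := by
    have := (b.hasSum_repr f).mapL S
    simpa only [map_smul, b.repr_apply_apply] using this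
  obtain ⟨s, hs⟩ := exists_seq_tendsto (atTop : Filter (Finset w))
  have h2 := tendstoInMeasure_of_tendsto_Lp (h1.comp hs)
  obtain ⟨ns, hns, h3⟩ := h2.exists_seq_tendsto_ae
  have h4 : ∀ᵐ x ∂ν, ∀ t : Finset w, (∑ k ∈ t, inner 𝕜 (b k) f • S (b k) : Lp 𝕜 2 ν) x =
      ∑ k ∈ t, inner 𝕜 (b k) f * S (b k) x := by
    have h5 : ∀ᵐ x ∂ν, ∀ k, (inner 𝕜 (b k) f • S (b k)) x = inner 𝕜 (b k) f * S (b k) x :=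
      ae_all_iff.2 fun k => Lp.coeFn_smul _ _
    rw [ae_all_iff]
    intro t
    filter_upwards [h5, Lp.coeFn_finsetSum t fun k => inner 𝕜 (b k) f • S (b k)] with x hx hx'
    rw [hx', Finset.sum_apply]
    exact Finset.sum_congr rfl fun k _ => hx k
  filter_upwards [h3, h4] with x hx hx' h hh
  have h6 := b.hasSum_inner_mul_inner h f
  simp_rw [hh, mul_comm (S _ x)] at h6
  refine tendsto_nhds_unique hx ?_
  refine (h6.comp (hs.comp hns.tendsto_atTop)).congr fun i => ?_
  exact (hx' _).symm

variable {S} {K₁ : X → X → 𝕜}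

lemma setIntegral_kernel (hK : IsIntegralKernel S K₁) {t : Set X} (ht : MeasurableSet t)
    (hνt : ν t ≠ ∞) : ∀ᵐ x ∂ν, IntegrableOn (K₁ x) t ν ∧
      S (indicatorConstLp 2 ht hνt 1) x = ∫ z in t, K₁ x z ∂ν := by
  have h1 := indicatorConstLp_coeFn (p := 2) (hs := ht) (hμs := hνt) (c := (1 : 𝕜))
  filter_upwards [hK.2 (indicatorConstLp 2 ht hνt 1)] with x hx
  have h2 : (fun z => K₁ x z * indicatorConstLp 2 ht hνt (1 : 𝕜) z) =ᵐ[ν]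
      t.indicator (K₁ x) := by
    filter_upwards [h1] with z hz
    rw [hz]
    by_cases h : z ∈ t <;> simp [h]
  rw [integral_congr_ae h2, integral_indicator ht] at hx
  exact ⟨(integrable_indicator_iff ht).1 (hx.1.congr h2), hx.2⟩

/-- For almost every `x`, the function `K₁(x, ·)` is the conjugate of the vector that represents
`f ↦ S f(x)`. -/
lemma ae_kernel_eq [Countable w] (hK : IsIntegralKernel S K₁) {T : Set (Set X)}
    (hT : IsTestFamily 𝕜 ν T) :
    ∀ᵐ x ∂ν, ∀ h : Lp 𝕜 2 ν, (∀ k, inner 𝕜 h (b k) = S (b k) x) →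
      ∀ᵐ z ∂ν, K₁ x z = star (h z) := by
  have h1 : ∀ᵐ x ∂ν, ∀ t (ht : t ∈ T), (IntegrableOn (K₁ x) t ν ∧
      S (indicatorConstLp 2 (hT.measurableSet t ht) (hT.measure_ne_top t ht) 1) x = ∫ z in t, K₁ x z ∂ν) ∧
      ∀ h : Lp 𝕜 2 ν, (∀ k, inner 𝕜 h (b k) = S (b k) x) →
        S (indicatorConstLp 2 (hT.measurableSet t ht) (hT.measure_ne_top t ht) 1) x =
          inner 𝕜 h (indicatorConstLp 2 (hT.measurableSet t ht) (hT.measure_ne_top t ht) 1) := by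
    rw [ae_ball_iff hT.countable]
    intro t ht
    filter_upwards [setIntegral_kernel hK (hT.measurableSet t ht) (hT.measure_ne_top t ht),
      ae_apply_eq_inner b S (indicatorConstLp 2 (hT.measurableSet t ht) (hT.measure_ne_top t ht) 1)] with x hx hx'
    exact ⟨hx, hx'⟩
  filter_upwards [h1] with x hx h hh
  have hint (t) (ht : t ∈ T) : IntegrableOn (fun z => h z) t ν :=
    integrableOn_Lp_of_measure_ne_top h (by norm_num) (hT.measure_ne_top t ht)
  have hint' (t) (ht : t ∈ T) : IntegrableOn (fun z => star (h z)) t ν :=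
    (LinearIsometryEquiv.integrable_comp_iff (RCLike.conjLIE (K := 𝕜))).2 (hint t ht)
  have h2 := hT.ae_eq_zero (fun z => K₁ x z - star (h z))
    (fun t ht => ((hx t ht).1.1).sub (hint' t ht)) fun t ht => by
      have h3 := (hx t ht).2 h hh
      rw [(hx t ht).1.2, ← inner_conj_symm, L2.inner_indicatorConstLp_one, ← integral_conj] at h3
      rw [integral_sub (hx t ht).1.1 (hint' t ht), h3]
      simp
  filter_upwards [h2] with z hz
  exact sub_eq_zero.1 hz

/-- The kernel of a self-adjoint operator is Hermitian almost everywhere. -/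
lemma ae_kernel_symm [SFinite ν] [Countable w] (hS : S.IsPositive) (hK : IsIntegralKernel S K₁)
    {T : Set (Set X)} (hT : IsTestFamily 𝕜 ν T)
    (htr : ∀ t ∈ T, ∑' k, ∫⁻ x in t, ‖S (b k) x‖ₑ ^ 2 ∂ν ≠ ∞) :
    ∀ᵐ y ∂ν, ∀ᵐ z ∂ν, K₁ z y = star (K₁ y z) := by
  have hmK (k) : Measurable fun x => ‖S (b k) x‖ₑ ^ 2 :=
    (Lp.stronglyMeasurable _).measurable.enorm.pow_const 2
  have htr' (t) (ht : t ∈ T) : ∫⁻ x in t, ∑' k, ‖S (b k) x‖ₑ ^ 2 ∂ν ≠ ∞ := by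
    rw [lintegral_tsum fun k => (hmK k).aemeasurable]
    exact htr t ht
  -- `∫_t |K₁(y, z)| dz ≤ ν(t) + ∑ₖ |S bₖ(y)|²`
  have hbound (t) (ht : t ∈ T) : ∀ᵐ y ∂ν, ∫⁻ z in t, ‖K₁ y z‖ₑ ∂ν ≤
      ν t + ∑' k, ‖S (b k) y‖ₑ ^ 2 := by
    filter_upwards [ae_kernel_eq b hK hT] with y hy
    by_cases hfin : ∑' k, ‖S (b k) y‖ₑ ^ 2 = ∞
    · simp [hfin]
    obtain ⟨h, hh⟩ := exists_inner_eq b hfin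
    have h1 : ∑' k, ‖S (b k) y‖ₑ ^ 2 = ‖h‖ₑ ^ 2 := by
      rw [← tsum_enorm_inner_sq b h]
      refine tsum_congr fun k => ?_
      rw [← hh k, ← inner_conj_symm, RCLike.enorm_conj]
    rw [h1, enorm_sq_eq_lintegral]
    have h2 (s : ℝ≥0∞) : s ≤ 1 + s ^ 2 := by
      rcases le_total s 1 with h | h
      · exact h.trans le_self_add
      · exact (le_self_pow h two_ne_zero).trans le_add_self
    calc ∫⁻ z in t, ‖K₁ y z‖ₑ ∂ν = ∫⁻ z in t, ‖h z‖ₑ ∂ν := by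
          refine lintegral_congr_ae (ae_restrict_of_ae ?_)
          filter_upwards [hy h hh] with z hz
          rw [hz, RCLike.star_def, RCLike.enorm_conj]
      _ ≤ ∫⁻ z in t, (1 + ‖h z‖ₑ ^ 2) ∂ν := lintegral_mono fun z => h2 _
      _ = ν t + ∫⁻ z in t, ‖h z‖ₑ ^ 2 ∂ν := by
          rw [lintegral_add_left measurable_const, setLIntegral_const, one_mul]
      _ ≤ ν t + ∫⁻ z, ‖h z‖ₑ ^ 2 ∂ν := by
          gcongr
          exact Measure.restrict_le_self
  have hint (s) (hs : s ∈ T) (t) (ht : t ∈ T) :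
      Integrable (Function.uncurry K₁) ((ν.restrict s).prod (ν.restrict t)) := by
    refine ⟨hK.1.aestronglyMeasurable, ?_⟩
    rw [HasFiniteIntegral, lintegral_prod _ hK.1.enorm.aemeasurable]
    calc ∫⁻ y in s, ∫⁻ z in t, ‖K₁ y z‖ₑ ∂ν ∂ν
        ≤ ∫⁻ y in s, (ν t + ∑' k, ‖S (b k) y‖ₑ ^ 2) ∂ν :=
          lintegral_mono_ae (ae_restrict_of_ae (hbound t ht))
      _ = ν t * ν s + ∫⁻ y in s, ∑' k, ‖S (b k) y‖ₑ ^ 2 ∂ν := by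
          rw [lintegral_add_left measurable_const, setLIntegral_const]
      _ < ∞ := ENNReal.add_lt_top.2 ⟨ENNReal.mul_lt_top (hT.measure_ne_top t ht).lt_top
          (hT.measure_ne_top s hs).lt_top,
          (htr' s hs).lt_top⟩
  have hint' (s) (hs : s ∈ T) (t) (ht : t ∈ T) : Integrable (fun p : X × X => star (K₁ p.2 p.1))
      ((ν.restrict s).prod (ν.restrict t)) :=
    (LinearIsometryEquiv.integrable_comp_iff (RCLike.conjLIE (K := 𝕜))).2 (hint t ht s hs).swap
  -- both sides of the symmetry relation are matrix elements `⟨1_s, S 1_t⟩`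
  have hpair (s) (hs : s ∈ T) (t) (ht : t ∈ T) :
      ∫ y in s, ∫ z in t, K₁ y z ∂ν ∂ν = inner 𝕜 (indicatorConstLp 2 (hT.measurableSet s hs) (hT.measure_ne_top s hs) 1)
        (S (indicatorConstLp 2 (hT.measurableSet t ht) (hT.measure_ne_top t ht) 1)) := by
    rw [L2.inner_indicatorConstLp_one]
    refine integral_congr_ae (ae_restrict_of_ae ?_)
    filter_upwards [setIntegral_kernel hK (hT.measurableSet t ht) (hT.measure_ne_top t ht)] with y hy
    exact hy.2.symm
  have hsymm (s) (hs : s ∈ T) (t) (ht : t ∈ T) :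
      ∫ y in s, ∫ z in t, star (K₁ z y) ∂ν ∂ν = ∫ y in s, ∫ z in t, K₁ y z ∂ν ∂ν := by
    rw [integral_integral_swap (f := fun y z => star (K₁ z y)) (hint' s hs t ht), hpair s hs t ht,
      ← hS.inner_left_eq_inner_right, ← inner_conj_symm, ← hpair t ht s hs, ← integral_conj]
    simp_rw [← integral_conj]
    rfl
  have h1 : ∀ᵐ y ∂ν, ∀ t ∈ T, IntegrableOn (fun z => K₁ y z - star (K₁ z y)) t ν ∧
      ∫ z in t, (K₁ y z - star (K₁ z y)) ∂ν = 0 := by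
    rw [ae_ball_iff hT.countable]
    intro t ht
    have hd (s) (hs : s ∈ T) : Integrable (fun p : X × X => K₁ p.1 p.2 - star (K₁ p.2 p.1))
        ((ν.restrict s).prod (ν.restrict t)) := (hint s hs t ht).sub (hint' s hs t ht)
    have hφ := hT.ae_eq_zero (fun y => ∫ z in t, (K₁ y z - star (K₁ z y)) ∂ν)
      (fun s hs => (hd s hs).integral_prod_left) fun s hs => by
        have h2 : ∫ y in s, ∫ z in t, (K₁ y z - star (K₁ z y)) ∂ν ∂ν =
            (∫ y in s, ∫ z in t, K₁ y z ∂ν ∂ν) - ∫ y in s, ∫ z in t, star (K₁ z y) ∂ν ∂ν :=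
          integral_integral_sub (hint s hs t ht) (hint' s hs t ht)
        rw [h2, hsymm s hs t ht, sub_self]
    filter_upwards [hφ, hT.ae_of_forall_ae_restrict fun s hs => (hd s hs).prod_right_ae]
      with y hy1 hy2
    exact ⟨hy2, hy1⟩
  filter_upwards [h1] with y hy
  have h2 := hT.ae_eq_zero (fun z => K₁ y z - star (K₁ z y)) (fun t ht => (hy t ht).1)
    fun t ht => (hy t ht).2
  filter_upwards [h2] with z hz
  rw [sub_eq_zero.1 hz, star_star]

variable {b}

/-- The kernel of `K` is the Gram kernel of the functions `S bₖ`. -/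
lemma ae_hasSum_kernel [Countable w] (hK : IsIntegralKernel S K₁)
    {T : Set (Set X)} (hT : IsTestFamily 𝕜 ν T)
    (hsymm : ∀ᵐ y ∂ν, ∀ᵐ z ∂ν, K₁ z y = star (K₁ y z))
    (hfin : ∀ᵐ x ∂ν, ∑' k, ‖S (b k) x‖ₑ ^ 2 ≠ ∞) :
    ∃ G : Set X, (∀ᵐ x ∂ν, x ∈ G) ∧ ∀ x ∈ G, ∀ y ∈ G,
      HasSum (fun k => S (b k) x * star (S (b k) y)) (∫ z, K₁ x z * K₁ z y ∂ν) := by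
  have h1 : ∀ᵐ x ∂ν, ∃ h : Lp 𝕜 2 ν, (∀ k, inner 𝕜 h (b k) = S (b k) x) ∧
      (∀ᵐ z ∂ν, K₁ x z = star (h z)) ∧ ∀ᵐ z ∂ν, K₁ z x = h z := by
    filter_upwards [hfin, hsymm, ae_kernel_eq b hK hT] with x hx1 hx2 hx3
    obtain ⟨h, hh⟩ := exists_inner_eq b hx1
    refine ⟨h, hh, hx3 h hh, ?_⟩
    filter_upwards [hx2, hx3 h hh] with z hz1 hz2
    rw [hz1, hz2, star_star]
  refine ⟨_, h1, ?_⟩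
  rintro x ⟨h, hh, hx, -⟩ y ⟨h', hh', -, hy⟩
  have h2 : ∫ z, K₁ x z * K₁ z y ∂ν = inner 𝕜 h h' := by
    rw [L2.inner_def]
    refine integral_congr_ae ?_
    filter_upwards [hx, hy] with z hz1 hz2
    rw [hz1, hz2, RCLike.inner_apply, mul_comm]
    rfl
  rw [h2]
  refine (b.hasSum_inner_mul_inner h h').congr_fun fun k => ?_
  rw [hh, ← inner_conj_symm, hh']
  rfl

end Kernel

/-! ### The Janossy series of a Gram kernel -/

section GramSeries

variable {𝕜 : Type*} [RCLike 𝕜] {X : Type*} [MeasurableSpace X] {ι : Type*} {ρ : Measure X}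

/-- The series `∑ₘ (-1)ᵐ/m! ∫ (1_B^{⊗m} ⊗ g) det(∑ₖ fₖ(xᵢ) conj(fₖ(xⱼ))) dρ^{⊗(n+m)}`. -/
noncomputable def gramSeries [Fintype ι] (ρ : Measure X) (f : ι → X → 𝕜) (B : Set X) (n : ℕ)
    (g : (Fin n → X) → ℝ≥0∞) : ℝ :=
  ∑' m : ℕ, (-1 : ℝ) ^ m / m.factorial * ∫ x, (extendTuple B g m x).toReal *
    RCLike.re (gramMatrix f x).det ∂(Measure.pi fun _ => ρ)

/-- If the operator with kernel `∑ₖ fₖ(x) conj(fₖ(y))` is bounded by `q < 1`, then its Janossy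
series are integrals against another Gram determinant, so that Fischer's inequality applies. -/
lemma gramSeries_nonneg_and_cons_le [SigmaFinite ρ] [Fintype ι] {f : ι → X → 𝕜} (hf : ∀ k, MemLp (f k) 2 ρ)
    {q : ℝ} (hq1 : q < 1)
    (hq : ∀ c : ι → 𝕜, ∫ y, ‖∑ k, c k * f k y‖ ^ 2 ∂ρ ≤ q * ∑ k, ‖c k‖ ^ 2)
    {B : Set X} (hB : MeasurableSet B) (hρ : ∀ᵐ y ∂ρ, y ∈ B) {Λ : Set X} (hΛ : MeasurableSet Λ)
    {n : ℕ} {g : (Fin n → X) → ℝ≥0∞} (hg : Measurable g) {M : ℝ≥0} (hM : ∀ x, g x ≤ M) :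
    0 ≤ gramSeries ρ f B n g ∧
    gramSeries ρ f B (n + 1) (fun x => Λ.indicator 1 (x 0) * g (Fin.tail x)) ≤
      ((1 - q)⁻¹ * ∫ y in Λ, ∑ k, ‖f k y‖ ^ 2 ∂ρ) * gramSeries ρ f B n g := by
  classical
  obtain ⟨v, lam, hv, horth, hlamq, hgram⟩ := exists_orthogonal_gramMatrix_eq hf hq
  have hlam (k) : lam k < 1 := (hlamq k).trans_lt hq1
  let W (k : ι) (y : X) : 𝕜 := (((√(1 - lam k))⁻¹ : ℝ) : 𝕜) * v k y
  have hW (k) : MemLp (W k) 2 ρ := (hv k).const_mul _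
  have hval {n : ℕ} {g : (Fin n → X) → ℝ≥0∞} (hg : Measurable g) (hM : ∀ x, g x ≤ M) :
      gramSeries ρ f B n g = (∏ k, (1 - lam k)) *
        ∫ x, (g x).toReal * RCLike.re (gramMatrix W x).det ∂(Measure.pi fun _ => ρ) := by
    rw [← (hasSum_integral_gramMatrix hv horth hlam hB hρ hg hM).tsum_eq, gramSeries]
    simp_rw [hgram]
  have hprod : 0 ≤ ∏ k, (1 - lam k) := Finset.prod_nonneg fun k _ => by linarith [hlam k]
  have hint0 : 0 ≤ ∫ x, (g x).toReal * RCLike.re (gramMatrix W x).det ∂(Measure.pi fun _ => ρ) :=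
    integral_nonneg fun x => mul_nonneg ENNReal.toReal_nonneg (re_det_gramMatrix_nonneg _ _)
  have hnorm (k y) : ‖W k y‖ ^ 2 ≤ (1 - q)⁻¹ * ‖v k y‖ ^ 2 := by
    have h1 : 0 < 1 - lam k := by linarith [hlam k]
    simp only [W]
    rw [norm_mul, mul_pow, RCLike.norm_ofReal, sq_abs, inv_pow, Real.sq_sqrt h1.le]
    exact mul_le_mul_of_nonneg_right (inv_anti₀ (by linarith) (by linarith [hlamq k]))
      (by positivity)
  have hdiag (y) : ∑ k, ‖v k y‖ ^ 2 = ∑ k, ‖f k y‖ ^ 2 := by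
    have h1 := congrFun (congrFun (hgram fun _ : Fin 1 => y) 0) 0
    rw [gramMatrix_diag, gramMatrix_diag] at h1
    exact_mod_cast h1
  have hsq {f : ι → X → 𝕜} (hf : ∀ k, MemLp (f k) 2 ρ) : Integrable (fun y => ∑ k, ‖f k y‖ ^ 2) ρ :=
    integrable_finsetSum _ fun k _ => (hf k).integrable_norm_pow (by norm_num)
  have hC : ∫ y in Λ, ∑ k, ‖W k y‖ ^ 2 ∂ρ ≤ (1 - q)⁻¹ * ∫ y in Λ, ∑ k, ‖f k y‖ ^ 2 ∂ρ := by
    rw [← integral_const_mul]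
    refine integral_mono (hsq hW).integrableOn ((hsq hf).integrableOn.const_mul _) fun y => ?_
    simp only
    rw [← hdiag, Finset.mul_sum]
    exact Finset.sum_le_sum fun k _ => hnorm k y
  rw [hval hg hM]
  refine ⟨mul_nonneg hprod hint0, ?_⟩
  rw [hval]
  · calc _ ≤ (∏ k, (1 - lam k)) * ((∫ y in Λ, ∑ k, ‖W k y‖ ^ 2 ∂ρ) *
          ∫ x, (g x).toReal * RCLike.re (gramMatrix W x).det ∂(Measure.pi fun _ => ρ)) :=
          mul_le_mul_of_nonneg_left (integral_cons_gramMatrix_le hW hΛ hg hM) hprod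
      _ ≤ (∏ k, (1 - lam k)) * (((1 - q)⁻¹ * ∫ y in Λ, ∑ k, ‖f k y‖ ^ 2 ∂ρ) *
          ∫ x, (g x).toReal * RCLike.re (gramMatrix W x).det ∂(Measure.pi fun _ => ρ)) := by
          gcongr
      _ = _ := by ring
  · exact ((measurable_one.indicator hΛ).comp (measurable_pi_apply 0)).mul
      (hg.comp measurable_fin_tail)
  · intro x
    calc Λ.indicator 1 (x 0) * g (Fin.tail x) ≤ 1 * M :=
          mul_le_mul' (Set.indicator_le_self _ _ _) (hM _)
      _ = M := one_mul _

/-! ### Approximation by Gram kernels of finite rank -/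

lemma measurable_re_det_gramMatrix [Fintype ι] {f : ι → X → 𝕜} (hf : ∀ k, Measurable (f k))
    {n : ℕ} : Measurable fun x : Fin n → X => RCLike.re (gramMatrix f x).det := by
  have h1 (i j : Fin n) : Measurable fun x : Fin n → X => gramMatrix f x i j :=
    Finset.measurable_fun_sum _ fun k _ => ((hf k).comp (measurable_pi_apply i)).mul
      (RCLike.continuous_conj.measurable.comp ((hf k).comp (measurable_pi_apply j)))
  simp_rw [Matrix.det_apply]
  refine RCLike.continuous_re.measurable.comp (Finset.measurable_fun_sum _ fun σ _ => ?_)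
  exact (Finset.measurable_fun_prod _ fun i _ => h1 _ _).const_smul _

/-- The expansion `kern(x, y) = ∑ₖ fₖ(x) conj(fₖ(y))` of a kernel, for all `x` and `y` in a set `G`
of full measure. Since `G` does not depend on the pair `(x, y)`, it covers the diagonal. -/
structure IsGramExpansion (ρ : Measure X) (f : ι → X → 𝕜) (kern : X → X → 𝕜) (G : Set X) :
    Prop where
  measurable : ∀ k, Measurable (f k)
  ae_mem : ∀ᵐ x ∂ρ, x ∈ G
  hasSum : ∀ x ∈ G, ∀ y ∈ G, HasSum (fun k => f k x * star (f k y)) (kern x y)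

namespace IsGramExpansion

variable {f : ι → X → 𝕜} {kern : X → X → 𝕜} {G : Set X}

lemma hasSum_norm_sq (h : IsGramExpansion ρ f kern G) {x : X} (hx : x ∈ G) :
    HasSum (fun k => ‖f k x‖ ^ 2) (RCLike.re (kern x x)) := by
  have h1 := (h.hasSum x hx x hx).mapL (RCLike.reCLM (K := 𝕜))
  refine h1.congr_fun fun k => ?_
  rw [RCLike.star_def, RCLike.mul_conj, ← RCLike.ofReal_pow]
  exact (RCLike.ofReal_re _).symm

lemma re_nonneg (h : IsGramExpansion ρ f kern G) {x : X} (hx : x ∈ G) :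
    0 ≤ RCLike.re (kern x x) :=
  (h.hasSum_norm_sq hx).nonneg fun _ => by positivity

lemma sum_norm_sq_le (h : IsGramExpansion ρ f kern G) {x : X} (hx : x ∈ G) (s : Finset ι) :
    ∑ k : s, ‖f k x‖ ^ 2 ≤ RCLike.re (kern x x) := by
  rw [Finset.sum_coe_sort s fun k => ‖f k x‖ ^ 2]
  exact sum_le_hasSum s (fun k _ => by positivity) (h.hasSum_norm_sq hx)

lemma re_det_gramMatrix_le (h : IsGramExpansion ρ f kern G) {n : ℕ} {x : Fin n → X}
    (hx : ∀ i, x i ∈ G) (s : Finset ι) :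
    RCLike.re (gramMatrix (fun k : s => f k) x).det ≤ ∏ i, RCLike.re (kern (x i) (x i)) :=
  (re_det_gramMatrix_le_prod _ x).trans <| Finset.prod_le_prod
    (fun i _ => Finset.sum_nonneg fun k _ => by positivity) fun i _ => h.sum_norm_sq_le (hx i) s

lemma tendsto_re_det_gramMatrix (h : IsGramExpansion ρ f kern G) {n : ℕ} {x : Fin n → X}
    (hx : ∀ i, x i ∈ G) :
    Tendsto (fun s : Finset ι => RCLike.re (gramMatrix (fun k : s => f k) x).det) atTop
      (𝓝 (RCLike.re (Matrix.of fun i j => kern (x i) (x j)).det)) := by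
  have h1 : Tendsto (fun s : Finset ι => gramMatrix (fun k : s => f k) x) atTop
      (𝓝 (Matrix.of fun i j => kern (x i) (x j))) := by
    refine tendsto_pi_nhds.2 fun i => tendsto_pi_nhds.2 fun j => ?_
    refine (h.hasSum _ (hx i) _ (hx j)).congr fun s => ?_
    exact (Finset.sum_coe_sort s fun k => f k (x i) * star (f k (x j))).symm
  exact (RCLike.continuous_re.tendsto _).comp ((continuous_id.matrix_det.tendsto _).comp h1)

lemma re_det_nonneg (h : IsGramExpansion ρ f kern G) {n : ℕ} {x : Fin n → X}
    (hx : ∀ i, x i ∈ G) : 0 ≤ RCLike.re (Matrix.of fun i j => kern (x i) (x j)).det :=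
  ge_of_tendsto' (h.tendsto_re_det_gramMatrix hx) fun _ => re_det_gramMatrix_nonneg _ _

lemma re_det_le (h : IsGramExpansion ρ f kern G) {n : ℕ} {x : Fin n → X} (hx : ∀ i, x i ∈ G) :
    RCLike.re (Matrix.of fun i j => kern (x i) (x j)).det ≤ ∏ i, RCLike.re (kern (x i) (x i)) :=
  le_of_tendsto' (h.tendsto_re_det_gramMatrix hx) fun s => h.re_det_gramMatrix_le hx s

lemma restrict (h : IsGramExpansion ρ f kern G) (B : Set X) :
    IsGramExpansion (ρ.restrict B) f kern G :=
  ⟨h.measurable, ae_restrict_of_ae h.ae_mem, h.hasSum⟩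

variable {n : ℕ} {φ : (Fin n → X) → ℝ} {M : ℝ≥0}

lemma norm_mul_re_det_gramMatrix_le (h : IsGramExpansion ρ f kern G) (hM : ∀ x, |φ x| ≤ M)
    {x : Fin n → X} (hx : ∀ i, x i ∈ G) (s : Finset ι) :
    ‖φ x * RCLike.re (gramMatrix (fun k : s => f k) x).det‖ ≤
      M * ∏ i, RCLike.re (kern (x i) (x i)) := by
  rw [norm_mul, Real.norm_eq_abs, Real.norm_of_nonneg (re_det_gramMatrix_nonneg _ _)]
  exact mul_le_mul (hM x) (h.re_det_gramMatrix_le hx s) (re_det_gramMatrix_nonneg _ _) M.2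

variable [SigmaFinite ρ]

lemma ae_forall_mem (h : IsGramExpansion ρ f kern G) (n : ℕ) :
    ∀ᵐ x ∂(Measure.pi fun _ : Fin n => ρ), ∀ i, x i ∈ G :=
  ae_all_iff.2 fun i => ae_pi_apply i h.ae_mem

lemma integrable_prod_diag (hκ : Integrable (fun x => RCLike.re (kern x x)) ρ) (n : ℕ) (M : ℝ) :
    Integrable (fun x : Fin n → X => M * ∏ i, RCLike.re (kern (x i) (x i)))
      (Measure.pi fun _ => ρ) :=
  (Integrable.fintype_prod fun _ => hκ).const_mul M

lemma integral_prod_diag (n : ℕ) (M : ℝ) :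
    ∫ x : Fin n → X, M * ∏ i, RCLike.re (kern (x i) (x i)) ∂(Measure.pi fun _ => ρ) =
      M * (∫ x, RCLike.re (kern x x) ∂ρ) ^ n := by
  rw [integral_const_mul, integral_fintype_prod_eq_pow fun x => RCLike.re (kern x x),
    Fintype.card_fin]

/-- A bound, uniform in `s`, from Hadamard's inequality. -/
lemma abs_integral_gramMatrix_le (h : IsGramExpansion ρ f kern G)
    (hκ : Integrable (fun x => RCLike.re (kern x x)) ρ) (hM : ∀ x, |φ x| ≤ M) (s : Finset ι) :
    |∫ x, φ x * RCLike.re (gramMatrix (fun k : s => f k) x).det ∂(Measure.pi fun _ => ρ)| ≤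
      M * (∫ x, RCLike.re (kern x x) ∂ρ) ^ n := by
  rw [← integral_prod_diag, ← Real.norm_eq_abs]
  refine norm_integral_le_of_norm_le (integrable_prod_diag hκ n M) ?_
  filter_upwards [h.ae_forall_mem n] with x hx
  exact h.norm_mul_re_det_gramMatrix_le hM hx s

variable [Countable ι]

lemma tendsto_integral_gramMatrix (h : IsGramExpansion ρ f kern G)
    (hκ : Integrable (fun x => RCLike.re (kern x x)) ρ) (hφ : Measurable φ)
    (hM : ∀ x, |φ x| ≤ M) :
    Tendsto (fun s : Finset ι => ∫ x, φ x * RCLike.re (gramMatrix (fun k : s => f k) x).det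
        ∂(Measure.pi fun _ => ρ)) atTop
      (𝓝 (∫ x, φ x * RCLike.re (Matrix.of fun i j => kern (x i) (x j)).det
        ∂(Measure.pi fun _ => ρ))) := by
  refine tendsto_integral_filter_of_dominated_convergence _
    (Eventually.of_forall fun s => (hφ.mul (measurable_re_det_gramMatrix fun k : s =>
      h.measurable k)).aestronglyMeasurable)
    (Eventually.of_forall fun s => ?_) (integrable_prod_diag hκ n M) ?_
  · filter_upwards [h.ae_forall_mem n] with x hx
    exact h.norm_mul_re_det_gramMatrix_le hM hx s
  · filter_upwards [h.ae_forall_mem n] with x hx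
    exact (h.tendsto_re_det_gramMatrix hx).const_mul _

lemma abs_integral_det_le (h : IsGramExpansion ρ f kern G)
    (hκ : Integrable (fun x => RCLike.re (kern x x)) ρ) (hφ : Measurable φ)
    (hM : ∀ x, |φ x| ≤ M) :
    |∫ x, φ x * RCLike.re (Matrix.of fun i j => kern (x i) (x j)).det ∂(Measure.pi fun _ => ρ)| ≤
      M * (∫ x, RCLike.re (kern x x) ∂ρ) ^ n :=
  le_of_tendsto' (h.tendsto_integral_gramMatrix hκ hφ hM).abs fun s =>
    h.abs_integral_gramMatrix_le hκ hM s

lemma integrable_mul_re_det (h : IsGramExpansion ρ f kern G)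
    (hκ : Integrable (fun x => RCLike.re (kern x x)) ρ) (hφ : Measurable φ)
    (hM : ∀ x, |φ x| ≤ M) :
    Integrable (fun x => φ x * RCLike.re (Matrix.of fun i j => kern (x i) (x j)).det)
      (Measure.pi fun _ => ρ) := by
  refine (integrable_prod_diag hκ n M).mono' ?_ ?_
  · refine hφ.aestronglyMeasurable.mul (aestronglyMeasurable_of_tendsto_ae atTop
      (fun s : Finset ι => (measurable_re_det_gramMatrix fun k : s =>
        h.measurable k).aestronglyMeasurable) ?_)
    filter_upwards [h.ae_forall_mem n] with x hx
    exact h.tendsto_re_det_gramMatrix hx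
  · filter_upwards [h.ae_forall_mem n] with x hx
    rw [norm_mul, Real.norm_eq_abs, Real.norm_of_nonneg (h.re_det_nonneg hx)]
    exact mul_le_mul (hM x) (h.re_det_le hx) (h.re_det_nonneg hx) M.2

lemma lintegral_mul_ofReal_det (h : IsGramExpansion ρ f kern G)
    (hκ : Integrable (fun x => RCLike.re (kern x x)) ρ) {g : (Fin n → X) → ℝ≥0∞}
    (hg : Measurable g) (hM : ∀ x, g x ≤ M) :
    ∫⁻ x, g x * ENNReal.ofReal (RCLike.re (Matrix.of fun i j => kern (x i) (x j)).det)
        ∂(Measure.pi fun _ => ρ) =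
      ENNReal.ofReal (∫ x, (g x).toReal *
        RCLike.re (Matrix.of fun i j => kern (x i) (x j)).det ∂(Measure.pi fun _ => ρ)) := by
  have hb (x) : |(g x).toReal| ≤ M := by
    rw [abs_of_nonneg ENNReal.toReal_nonneg]
    exact ENNReal.toReal_le_coe_of_le_coe (hM x)
  rw [ofReal_integral_eq_lintegral_ofReal (h.integrable_mul_re_det hκ hg.ennreal_toReal hb)]
  · refine lintegral_congr fun x => ?_
    rw [ENNReal.ofReal_mul ENNReal.toReal_nonneg,
      ENNReal.ofReal_toReal ((hM x).trans_lt ENNReal.coe_lt_top).ne]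
  · filter_upwards [h.ae_forall_mem n] with x hx
    exact mul_nonneg ENNReal.toReal_nonneg (h.re_det_nonneg hx)

lemma summable_pow_div_factorial (a : ℝ) (M : ℝ) (n : ℕ) :
    Summable fun m : ℕ => (m.factorial : ℝ)⁻¹ * (M * a ^ (n + m)) := by
  have := (Real.summable_pow_div_factorial a).mul_left (M * a ^ n)
  refine this.congr fun m => ?_
  rw [pow_add]
  ring

/-- The Janossy series of the Gram kernels of finite rank converge to that of the full kernel. -/
lemma tendsto_gramSeries (h : IsGramExpansion ρ f kern G)
    (hκ : Integrable (fun x => RCLike.re (kern x x)) ρ) {B : Set X} (hB : MeasurableSet B)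
    {g : (Fin n → X) → ℝ≥0∞} (hg : Measurable g) (hM : ∀ x, g x ≤ M) :
    Tendsto (fun s : Finset ι => gramSeries ρ (fun k : s => f k) B n g) atTop
      (𝓝 (∑' m : ℕ, (-1 : ℝ) ^ m / m.factorial * ∫ x, (extendTuple B g m x).toReal *
        RCLike.re (Matrix.of fun i j => kern (x i) (x j)).det ∂(Measure.pi fun _ => ρ))) := by
  have hb (m : ℕ) (x) : |(extendTuple B g m x).toReal| ≤ M := by
    rw [abs_of_nonneg ENNReal.toReal_nonneg]
    exact ENNReal.toReal_le_coe_of_le_coe (extendTuple_le hM m x)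
  refine tendsto_tsum_of_dominated_convergence
    (summable_pow_div_factorial (∫ x, RCLike.re (kern x x) ∂ρ) M n)
    (fun m => (h.tendsto_integral_gramMatrix hκ (measurable_extendTuple hB hg m).ennreal_toReal
      (hb m)).const_mul _)
    (Eventually.of_forall fun s m => ?_)
  rw [norm_mul, norm_div, norm_pow, norm_neg, norm_one, one_pow, Real.norm_natCast, one_div]
  exact mul_le_mul_of_nonneg_left (h.abs_integral_gramMatrix_le hκ (hb m) s) (by positivity)

end IsGramExpansion

end GramSeries

/-! ### The Palm bound for fermion processes -/

section Palm

lemma lintegral_pi_restrict {X : Type*} [MeasurableSpace X] {ν : Measure X} [SigmaFinite ν]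
    {B : Set X} (hB : MeasurableSet B) {n : ℕ}
    {F : (Fin n → X) → ℝ≥0∞} (hF : ∀ x, F x ≠ 0 → ∀ i, x i ∈ B) :
    ∫⁻ x, F x ∂(Measure.pi fun _ => ν.restrict B) = ∫⁻ x, F x ∂(Measure.pi fun _ => ν) := by
  rw [← Measure.restrict_pi_pi (fun _ : Fin n => ν) fun _ => B,
    ← lintegral_indicator (MeasurableSet.univ_pi fun _ => hB)]
  refine lintegral_congr fun x => ?_
  by_cases hx : F x = 0
  · simp [hx]
  · have hmem : x ∈ Set.univ.pi fun _ => B := fun i _ => hF x hx i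
    exact Set.indicator_of_mem hmem _

namespace IsGramExpansion

variable {𝕜 : Type*} [RCLike 𝕜] {X : Type*} [TopologicalSpace X] [MeasurableSpace X]
  [LocallyCompactSpace X] [SecondCountableTopology X] [T2Space X] [BorelSpace X]
  {ι : Type*} [Countable ι] {ν : Measure X} [SigmaFinite ν] {f : ι → X → 𝕜} {kern : X → X → 𝕜}
  {G : Set X} {μ : Measure (Configuration X)}

/-- For a process whose correlation functions are determinants of a Gram kernel, the expectation of
an exact sum is the limit of the Janossy series of the finite subfamilies. -/
lemma lintegral_exactSum_ne_top_and_tendsto (h : IsGramExpansion ν f kern G)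
    (hk : ∀ n, IsCorrelationFunction ν μ n fun x =>
      ENNReal.ofReal (RCLike.re (Matrix.of fun i j : Fin n => kern (x i) (x j)).det))
    {B : Set X} (hB : IsBoundedBorel B) (hκ : IntegrableOn (fun x => RCLike.re (kern x x)) B ν)
    {n : ℕ} {g : (Fin n → X) → ℝ≥0∞} (hgm : Measurable g) {M : ℝ≥0} (hM : ∀ x, g x ≤ M)
    (hg : ∀ x, g x ≠ 0 → ∀ i, x i ∈ B) :
    ∫⁻ γ, exactSum B n g γ ∂μ ≠ ∞ ∧
    Tendsto (fun s : Finset ι => gramSeries (ν.restrict B) (fun k : s => f k) B n g) atTop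
      (𝓝 (∫⁻ γ, exactSum B n g γ ∂μ).toReal) := by
  have hρ := h.restrict B
  have hext := measurable_extendTuple hB.1 hgm
  have hb (m : ℕ) (x) : |(extendTuple B g m x).toReal| ≤ M := by
    rw [abs_of_nonneg ENNReal.toReal_nonneg]
    exact ENNReal.toReal_le_coe_of_le_coe (extendTuple_le hM m x)
  have hnonneg (m : ℕ) : 0 ≤ ∫ x, (extendTuple B g m x).toReal *
      RCLike.re (Matrix.of fun i j => kern (x i) (x j)).det
        ∂(Measure.pi fun _ => ν.restrict B) := by
    refine integral_nonneg_of_ae ?_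
    filter_upwards [hρ.ae_forall_mem (n + m)] with x hx
    exact mul_nonneg ENNReal.toReal_nonneg (h.re_det_nonneg hx)
  have hval (m : ℕ) : ∫⁻ x, extendTuple B g m x * ENNReal.ofReal (RCLike.re
      (Matrix.of fun i j : Fin (n + m) => kern (x i) (x j)).det) ∂(Measure.pi fun _ => ν) =
      ENNReal.ofReal (∫ x, (extendTuple B g m x).toReal *
        RCLike.re (Matrix.of fun i j => kern (x i) (x j)).det
          ∂(Measure.pi fun _ => ν.restrict B)) := by
    rw [← hρ.lintegral_mul_ofReal_det hκ (hext m) (extendTuple_le hM m),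
      lintegral_pi_restrict hB.1]
    intro x hx
    exact extendTuple_support hg m x (left_ne_zero_of_mul hx)
  refine ⟨ne_top_of_le_ne_top ?_ (lintegral_mono fun γ => Set.indicator_le_self _ _ γ), ?_⟩
  · change ∫⁻ γ, tupleSum n g γ ∂μ ≠ ∞
    rw [lintegral_tupleSum (hk n) hgm]
    exact (hval 0).trans_ne ENNReal.ofReal_ne_top
  have hsum := hasSum_lintegral_exactSum hk hB hgm hg
    (fun m => (hval m).trans_ne ENNReal.ofReal_ne_top) (by
      simp_rw [hval, ENNReal.toReal_ofReal (hnonneg _)]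
      refine Summable.of_nonneg_of_le (fun m => mul_nonneg (by positivity) (hnonneg m))
        (fun m => mul_le_mul_of_nonneg_left ((le_abs_self _).trans
          (hρ.abs_integral_det_le hκ (hext m).ennreal_toReal (hb m))) (by positivity))
        (summable_pow_div_factorial (∫ x in B, RCLike.re (kern x x) ∂ν) M n))
  simp_rw [hval, ENNReal.toReal_ofReal (hnonneg _)] at hsum
  rw [← hsum.tsum_eq]
  exact hρ.tendsto_gramSeries hκ hB.1 hgm hM

/-- The comparison of the Janossy series of finite subfamilies has a constant that does not depend
on the subfamily, so it passes to the limit. -/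
lemma hasPalmBound (h : IsGramExpansion ν f kern G)
    (hk : ∀ n, IsCorrelationFunction ν μ n fun x =>
      ENNReal.ofReal (RCLike.re (Matrix.of fun i j : Fin n => kern (x i) (x j)).det))
    (hκ : ∀ B, IsBoundedBorel B → IntegrableOn (fun x => RCLike.re (kern x x)) B ν)
    (hf : ∀ k, MemLp (f k) 2 ν) {q : ℝ} (hq1 : q < 1)
    (hq : ∀ (s : Finset ι) (c : s → 𝕜), ∫ y, ‖∑ k, c k * f k y‖ ^ 2 ∂ν ≤ q * ∑ k, ‖c k‖ ^ 2) :
    HasPalmBound μ := by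
  refine hasPalmBound_of_exactSum fun Λ hΛ => ?_
  let C : ℝ := (1 - q)⁻¹ * ∫ x in Λ, RCLike.re (kern x x) ∂ν
  refine ⟨ENNReal.ofReal C, ENNReal.ofReal_ne_top, fun B hB hΛB n g M hgm hM hg => ?_⟩
  have hI (x : X) : (Λ.indicator 1 x : ℝ≥0∞) ≤ 1 := Set.indicator_le_self _ _ x
  have hρ := h.restrict B
  obtain ⟨ht, hlim⟩ := h.lintegral_exactSum_ne_top_and_tendsto hk hB (hκ B hB) hgm hM hg
  obtain ⟨ht', hlim'⟩ := h.lintegral_exactSum_ne_top_and_tendsto hk hB (hκ B hB)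
    (g := fun x : Fin (n + 1) → X => Λ.indicator 1 (x 0) * g (Fin.tail x)) (M := M)
    (((measurable_one.indicator hΛ.1).comp (measurable_pi_apply 0)).mul
      (hgm.comp measurable_fin_tail))
    (fun x => (mul_le_mul' (hI _) (hM _)).trans_eq (one_mul _)) fun x hx i => by
      have h0 : x 0 ∈ Λ := by
        by_contra h0
        exact hx (by rw [Set.indicator_of_notMem h0, zero_mul])
      exact Fin.cases (hΛB h0) (fun j => hg _ (right_ne_zero_of_mul hx) j) i
  have hq' (s : Finset ι) (c : s → 𝕜) : ∫ y, ‖∑ k, c k * f k y‖ ^ 2 ∂(ν.restrict B) ≤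
      q * ∑ k, ‖c k‖ ^ 2 := by
    have hm : MemLp (fun y => ∑ k, c k * f k y) 2 ν :=
      memLp_finsetSum _ fun k _ => (hf k).const_mul _
    exact (setIntegral_le_integral (hm.integrable_norm_pow (by norm_num))
      (Eventually.of_forall fun y => by positivity)).trans (hq s c)
  have hle (s : Finset ι) : gramSeries (ν.restrict B) (fun k : s => f k) B (n + 1)
      (fun x => Λ.indicator 1 (x 0) * g (Fin.tail x)) ≤
      C * gramSeries (ν.restrict B) (fun k : s => f k) B n g := by
    obtain ⟨h0, h1⟩ := gramSeries_nonneg_and_cons_le (ρ := ν.restrict B)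
      (fun k : s => (hf k).restrict B) hq1 (hq' s) hB.1 (ae_restrict_mem hB.1) hΛ.1 hgm hM
    refine h1.trans (mul_le_mul_of_nonneg_right ?_ h0)
    refine mul_le_mul_of_nonneg_left ?_ (inv_nonneg.2 (by linarith))
    rw [Measure.restrict_restrict hΛ.1, Set.inter_eq_left.2 hΛB]
    refine integral_mono_of_nonneg (Eventually.of_forall fun y => by positivity) (hκ Λ hΛ) ?_
    filter_upwards [ae_restrict_of_ae h.ae_mem] with y hy
    exact h.sum_norm_sq_le hy s
  have hfinal := le_of_tendsto_of_tendsto' hlim' (hlim.const_mul C) hle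
  have hC : 0 ≤ C := by
    refine mul_nonneg (inv_nonneg.2 (by linarith)) (integral_nonneg_of_ae ?_)
    filter_upwards [ae_restrict_of_ae h.ae_mem] with y hy
    exact h.re_nonneg hy
  rw [← ENNReal.ofReal_toReal ht', ← ENNReal.ofReal_toReal ht, ← ENNReal.ofReal_mul hC]
  exact ENNReal.ofReal_le_ofReal hfinal

end IsGramExpansion

open ContinuousLinearMap in
lemma hasPalmBound_of_isFermionProcess {X : Type*} [TopologicalSpace X] [LocallyCompactSpace X]
    [SecondCountableTopology X] [T2Space X] [MeasurableSpace X] [BorelSpace X]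
    {𝕜 : Type*} [RCLike 𝕜] {ν : Measure X} [ν.Regular] {K : Lp 𝕜 2 ν →L[𝕜] Lp 𝕜 2 ν}
    (hK : IsAdmissible K) {μ : Measure (Configuration X)} (hμ : IsFermionProcess K μ) :
    HasPalmBound μ := by
  obtain ⟨S, K₁, hS, hSK, hK₁, hk⟩ := hμ
  obtain ⟨w, b, -⟩ := exists_hilbertBasis 𝕜 (Lp 𝕜 2 ν)
  have : Fact ((2 : ℝ≥0∞) ≠ ∞) := ⟨by norm_num⟩
  have : Countable w := countable_of_orthonormal b.orthonormal
  have hmeas (k : w) : Measurable fun x => ‖S (b k) x‖ₑ ^ 2 :=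
    (Lp.stronglyMeasurable _).measurable.enorm.pow_const 2
  have htr (Λ : Set X) (hΛ : IsBoundedBorel Λ) : ∑' k, ∫⁻ x in Λ, ‖S (b k) x‖ₑ ^ 2 ∂ν ≠ ∞ := by
    have := hK.locallyTraceClass Λ hΛ
    rw [← hSK] at this
    exact tsum_setLIntegral_ne_top hS b hΛ.1 this
  let B (n : ℕ) : Set X := compactCovering X n
  have hB (n) : IsBoundedBorel (B n) := isBoundedBorel_compactCovering n
  obtain ⟨T, hT, hTB⟩ := exists_isTestFamily 𝕜 ν (fun n => (hB n).1)
    (fun n => (isCompact_compactCovering X n).measure_lt_top.ne) (iUnion_compactCovering X)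
  have htrT (t) (ht : t ∈ T) : ∑' k, ∫⁻ x in t, ‖S (b k) x‖ₑ ^ 2 ∂ν ≠ ∞ := by
    obtain ⟨n, hn⟩ := hTB t ht
    exact ne_top_of_le_ne_top (htr _ (hB n))
      (ENNReal.tsum_le_tsum fun k => lintegral_mono_set hn)
  have hfin : ∀ᵐ x ∂ν, ∑' k, ‖S (b k) x‖ₑ ^ 2 ≠ ∞ := by
    refine hT.ae_of_forall_ae_restrict fun t ht => ?_
    have h1 := htrT t ht
    rw [← lintegral_tsum fun k => (hmeas k).aemeasurable] at h1
    filter_upwards [ae_lt_top (Measurable.tsum hmeas) h1] with x hx using hx.ne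
  obtain ⟨G, hG, hGk⟩ := ae_hasSum_kernel hK₁ hT
    (ae_kernel_symm b ((nonneg_iff_isPositive _).1 hS) hK₁ hT htrT) hfin
  have hexp : IsGramExpansion ν (fun k => S (b k)) (fun x y => ∫ z, K₁ x z * K₁ z y ∂ν) G :=
    ⟨fun k => (Lp.stronglyMeasurable _).measurable, hG, hGk⟩
  obtain ⟨q, hq1, hq⟩ := exists_lt_one_norm_sq_le hS hSK hK.le_one hK.one_notMem_spectrum
  refine hexp.hasPalmBound hk (fun Λ hΛ => ?_) (fun k => Lp.memLp _) hq1 fun s c => ?_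
  · -- the diagonal of the kernel is `∑ₖ |S bₖ|²`
    have h1 := htr Λ hΛ
    rw [← lintegral_tsum fun k => (hmeas k).aemeasurable] at h1
    refine (integrable_toReal_of_lintegral_ne_top
      (Measurable.tsum hmeas).aemeasurable h1).congr ?_
    filter_upwards [ae_restrict_of_ae hG, ae_restrict_of_ae hfin] with x hx hx'
    rw [ENNReal.tsum_toReal_eq fun k => ENNReal.ne_top_of_tsum_ne_top hx' k,
      ← (hexp.hasSum_norm_sq hx).tsum_eq]
    simp
  · -- `∑ₖ cₖ S bₖ = S (∑ₖ cₖ bₖ)`, the `bₖ` are orthonormal and `S` is a strict contraction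
    have h1 : (∑ k, c k • S (b k) : Lp 𝕜 2 ν) = S (∑ k, c k • b k) := by
      simp
    have h2 : ‖∑ k, c k • b k‖ ^ 2 = ∑ k, ‖c k‖ ^ 2 := by
      have h3 := (b.orthonormal.comp _ Subtype.val_injective).inner_sum c c
        (Finset.univ : Finset s)
      simp only [Function.comp_apply, inner_self_eq_norm_sq_to_K, RCLike.conj_mul] at h3
      exact_mod_cast h3
    have h3 : ∀ᵐ y ∂ν, ‖(∑ k, c k • S (b k) : Lp 𝕜 2 ν) y‖ ^ 2 =
        ‖∑ k, c k * S (b k) y‖ ^ 2 := by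
      have h4 : ∀ᵐ y ∂ν, ∀ k, (c k • S (b k)) y = c k * S (b k) y :=
        ae_all_iff.2 fun k => Lp.coeFn_smul _ _
      filter_upwards [h4, Lp.coeFn_finsetSum Finset.univ fun k => c k • S (b k)] with y hy hy'
      rw [hy', Finset.sum_apply, Finset.sum_congr rfl fun k _ => hy k]
    rw [← integral_congr_ae h3, h1, ← h2]
    refine le_trans (le_of_eq ?_) (hq _)
    rw [← @inner_self_eq_norm_sq 𝕜, L2.inner_def, ← integral_re (L2.integrable_inner _ _)]
    exact integral_congr_ae (Eventually.of_forall fun y => (inner_self_eq_norm_sq _).symm)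

end Palm

end FermionDynamics

open FermionDynamics in
theorem lemma3p2 {X : Type*} [TopologicalSpace X] [LocallyCompactSpace X]
    [SecondCountableTopology X] [T2Space X] [MeasurableSpace X] [BorelSpace X]
    {𝕜 : Type*} [RCLike 𝕜]
    (ν : Measure X) [ν.Regular] [NullSingletonClass ν]
    (K : Lp 𝕜 2 ν →L[𝕜] Lp 𝕜 2 ν) (hK : IsAdmissible K)
    (μ : Measure (Configuration X)) [IsProbabilityMeasure μ] (hμ : IsFermionProcess K μ) :
    -- part 1: the Glauber form
    (∀ d : X → Configuration X → ℝ≥0,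
      Measurable (fun p : X × Configuration X => d p.1 p.2) →
      (∀ Λ : Set X, IsBoundedBorel Λ →
        ∫⁻ γ, ∫⁻ x in Λ, (d x (γ.erase x) : ℝ≥0∞) ∂γ.toMeasure ∂μ < ∞) →
      IsClosableForm μ (CylinderFunctions X) (glauberForm μ d)) ∧
    -- part 2: the Kawasaki form
    (∀ (r : X → Configuration X → ℝ≥0∞) (c : X → X → Configuration X → ℝ≥0),
      IsPapangelouIntensity ν μ r →
      Measurable (fun p : X × X × Configuration X => c p.1 p.2.1 p.2.2) →
      (∀ x y γ, ¬(0 < r x γ ∧ 0 < r y γ) → c x y γ = 0) →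
      (∀ Λ : Set X, IsBoundedBorel Λ →
        ∫⁻ γ, ∫⁻ x, ∫⁻ y, (c x y (γ.erase x) : ℝ≥0∞) *
          (Λ.indicator 1 x + Λ.indicator 1 y) ∂ν ∂γ.toMeasure ∂μ < ∞) →
      (∃ u : ℝ, ∀ Λ : Set X, IsBoundedBorel Λ →
        ∫⁻ γ, (∫⁻ x in Λ, ∫⁻ y in Λ, r x (γ.erase y) *
          (Set.Ioi (0 : ℝ≥0∞)).indicator (fun s => s ^ u) (r y (γ.erase y)) *
          (c x y (γ.erase y) : ℝ≥0∞) ∂γ.toMeasure ∂ν) ^ 2 ∂μ < ∞) →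
      IsClosableForm μ (CylinderFunctions X) (kawasakiForm ν μ c)) := by
  have : SigmaFinite ν := inferInstance
  exact ⟨fun d hd hdint =>
      isClosableForm_glauberForm (hasPalmBound_of_isFermionProcess hK hμ) hd hdint,
    fun r c hr hc hcr hcint _ => isClosableForm_kawasakiForm hr hc hcr hcint⟩
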